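/- Let $\mathbb K\in\{\mathbb R,\mathbb C\}$ and let $G\subset GL(m,\mathbb K)$ be a matrix Lie group (a Lie group with an injective smooth immersive homomorphism into $GL(m,\mathbb K)$); its Lie algebra $\mathfrak g$ is viewed as a space of matrices. *Conventions.* $BG_\bullet$ is the simplicial manifold with $BG_p=G^p$, with $d_0(g_1,\dots,g_p)=(g_2,\dots,g_p)$, $d_i(g_1,\dots,g_p)=(g_1,\dots,g_{i+1}g_i,\dots,g_p)$ for $0<i<p$, $d_p(g_1,\dots,g_p)=(g_1,\dots,g_{p-1})$, and with $s_i$ inserting the neutral element after $g_i$. $\mathrm{Tot}^n(BG_\bullet)=\bigoplus_{p+q=n}C^{p,q}$, where $C^{p,q}$ consists of the smooth $q$-forms on $G^p$ killed by all $s_i^*$, with differential $D=\sum_j(-1)^jd_j^*+(-1)^pd$, and $H^n(BG_\bullet)$ is its cohomology. $EG_n=G^{n+1}$, and $\gamma_n:EG_n\to BG_n$ is $(g_0,\dots,g_n)\mapsto(g_1g_0^{-1},\dots,g_ng_{n-1}^{-1})$. Let $\omega^l(v)=(L_{g^{-1}})_*v$ and $\omega^r(v)=(R_{g^{-1}})_*v$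 for $v\in T_gG$ be the Maurer–Cartan forms, and let $\mathrm{inv}:TG\to TG$ be the tangent map of $g\mapsto g^{-1}$. Wedge products are normalized by $(\phi\wedge\psi)(v_1,\dots,v_{j+k})=\frac1{j!k!}\sum_\sigma \mathrm{sign}(\sigma)\,\phi(v_{\sigma(1)},\dots)\otimes\psi(\dots,v_{\sigma(j+k)})$, and $f(\phi_1,\dots,\phi_k)$ means $f\circ(\phi_1\wedge\dots\wedge\phi_k)$ for a multilinear map $f$ (so for $\mathrm{tr}(\phi\cdot\psi)$, $\mathrm{tr}(\phi)\,\mathrm{tr}(\psi)$, $\mathrm{tr}(\phi\cdot\phi\cdot\phi)$). The polynomial $p_1$ is the polarization of the quadratic form sending $A$ to the coefficient of $t^{m-2}$ in $\det(t\cdot\mathrm{id}-\frac1{2\pi}A)$ (zero if $m<2$). *The first Pontryagin class.* On $\Delta^n\times EG_n$ let $\hat\omega_n=\sum_{j=0}^nt_j\omega_j$, where $t_0,\dots,t_n$ are the barycentric coordinates and $\omega_j$ is the pullback of $\omega^l$ along the $j$-th projection $EG_n\to G$; let $\kappa_n=d\hat\omega_n+\frac12[\hat\omega_n\wedge\hat\omega_n]$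 and $\chi_n=\int_{\Delta^n}p_1(\kappa_n,\kappa_n)\in\Omega^{4-n}(EG_n)$ (fibre integration, orientation $(t_1,\dots,t_n)$, the vertical vectors inserted first). The first Pontryagin class of $BG_\bullet$ is the class in $H^4(BG_\bullet)$ of a cocycle $z\in\mathrm{Tot}^4(BG_\bullet)$ with $\gamma_n^*z_n=\chi_n$ for all $n$. *Statement.* 1. The first Pontryagin class (with coefficients in $\mathbb K$) exists, is unique, and is represented by the cocycle $$\Bigl(0,\ \tfrac1{24\pi^2}\mathrm{tr}(\omega^l\cdot\omega^l\cdot\omega^l),\ \tfrac1{8\pi^2}\bigl(\mathrm{tr}(d_2^*(\omega^l\circ\mathrm{inv}))\,\mathrm{tr}(d_0^*\omega^l)-\mathrm{tr}(d_2^*(\omega^l\circ\mathrm{inv})\cdot d_0^*\omega^l)\bigr),\ 0,\dots\Bigr).$$ 2. If $G\subset U(m)$ (respectively $G\subset O(m)$ when $\mathbb K=\mathbb R$), then $\omega^l\circ\mathrm{inv}=-\omega^r$, and the class is represented by $$\Bigl(0,\ \tfrac1{24\pi^2}\mathrm{tr}(\omega^l\cdot\omega^l\cdot\omega^l),\ \tfrac1{8\pi^2}\bigl(\mathrm{tr}(d_2^*\omega^r\cdot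 d_0^*\omega^l)-\mathrm{tr}(d_2^*\omega^r)\,\mathrm{tr}(d_0^*\omega^l)\bigr),\ 0,\dots\Bigr).$$ These forms are real valued, and the assertion holds with coefficients in $\mathbb R$ as well as in $\mathbb K$. 3. If moreover $G\subset O(m)$ (real orthogonal matrices) or $G\subset SU(m)$, in particular for $G=O(m),SO(m),SU(m)$, then $\mathrm{tr}(d_2^*\omega^r)\,\mathrm{tr}(d_0^*\omega^l)=0$, and the class is represented, with coefficients in $\mathbb R$ as well as in $\mathbb K$, by $$\Bigl(0,\ \tfrac1{24\pi^2}\mathrm{tr}(\omega^l\cdot\omega^l\cdot\omega^l),\ \tfrac1{8\pi^2}\mathrm{tr}(d_2^*\omega^r\cdot d_0^*\omega^l),\ 0,\dots\Bigr).$$ -/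

import Mathlib

open scoped Manifold ContDiff

noncomputable section

namespace BGForms

/-! ### Differential forms on manifolds -/

section Forms

variable {E : Type*} [NormedAddCommGroup E] [NormedSpace ℝ E]
  {H : Type*} [TopologicalSpace H] (I : ModelWithCorners ℝ E H)
  {M : Type*} [TopologicalSpace M] [ChartedSpace H M]
  {E' : Type*} [NormedAddCommGroup E'] [NormedSpace ℝ E']
  {H' : Type*} [TopologicalSpace H'] (I' : ModelWithCorners ℝ E' H')
  {M' : Type*} [TopologicalSpace M'] [ChartedSpace H' M']
  {k : ℕ} {F : Type*} [NormedAddCommGroup F] [NormedSpace ℝ F]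

variable (M k F) in
/-- Fields of alternating `k`-forms on `M` with values in the real vector space `F`
(no regularity required; smoothness is `IsSmooth`). -/
abbrev AltField : Type _ := (x : M) → TangentSpace I x [⋀^Fin k]→L[ℝ] F

/-- The expression of a field of alternating forms in the chart at `x₀`. -/
def inChart (θ : AltField I M k F) (x₀ : M) : E → E [⋀^Fin k]→L[ℝ] F := fun y =>
  (θ ((extChartAt I x₀).symm y)).compContinuousLinearMap
    (mfderivWithin 𝓘(ℝ, E) I (extChartAt I x₀).symm (Set.range I) y)

/-- Smoothness of a differential form: smoothness in all charts. -/
def IsSmooth (θ : AltField I M k F) : Prop :=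
  ∀ x₀ : M, ContDiffOn ℝ ∞ (inChart I θ x₀) (extChartAt I x₀).target

/-- The exterior derivative, computed in the chart at `x`. -/
def extD (θ : AltField I M k F) : AltField I M (k + 1) F := fun x =>
  (extDerivWithin (inChart I θ x) (Set.range I)
    (extChartAt I x x)).compContinuousLinearMap (mfderiv I 𝓘(ℝ, E) (extChartAt I x) x)

/-- The pullback of a differential form along a map. -/
def pullback (f : M → M') (θ : AltField I' M' k F) : AltField I M k F := fun x =>
  (θ (f x)).compContinuousLinearMap (mfderiv I I' f x)

variable {I}

theorem inChart_add (θ η : AltField I M k F) (x₀ : M) :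
    inChart I (θ + η) x₀ = inChart I θ x₀ + inChart I η x₀ := rfl

theorem inChart_smul (c : ℝ) (θ : AltField I M k F) (x₀ : M) :
    inChart I (c • θ) x₀ = c • inChart I θ x₀ := rfl

theorem IsSmooth.zero : IsSmooth I (0 : AltField I M k F) :=
  fun _ => (contDiffOn_const (c := (0 : E [⋀^Fin k]→L[ℝ] F))).congr fun _ _ => rfl

theorem IsSmooth.add {θ η : AltField I M k F} (hθ : IsSmooth I θ) (hη : IsSmooth I η) :
    IsSmooth I (θ + η) := fun x₀ => by
  rw [inChart_add]; exact (hθ x₀).add (hη x₀)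

theorem IsSmooth.smul (c : ℝ) {θ : AltField I M k F} (hθ : IsSmooth I θ) :
    IsSmooth I (c • θ) := fun x₀ => by
  rw [inChart_smul]; exact (hθ x₀).const_smul c

theorem IsSmooth.differentiableWithinAt {θ : AltField I M k F} (hθ : IsSmooth I θ) (x : M) :
    DifferentiableWithinAt ℝ (inChart I θ x) (Set.range I) (extChartAt I x x) :=
  (((hθ x) _ (mem_extChartAt_target x)).differentiableWithinAt (by simp)).mono_of_mem_nhdsWithin
    (extChartAt_target_mem_nhdsWithin x)

theorem extD_add {θ η : AltField I M k F} (hθ : IsSmooth I θ) (hη : IsSmooth I η) :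
    extD I (θ + η) = extD I θ + extD I η := by
  funext x
  have h := extDerivWithin_add
    (I.uniqueDiffOn _ (extChartAt_target_subset_range x (mem_extChartAt_target x)))
    (hθ.differentiableWithinAt x) (hη.differentiableWithinAt x)
  simp only [extD, inChart_add, h]
  rfl

theorem extD_smul (c : ℝ) (θ : AltField I M k F) :
    extD I (c • θ) = c • extD I θ := by
  funext x
  have h := extDerivWithin_smul c (inChart I θ x)
    (I.uniqueDiffOn _ (extChartAt_target_subset_range x (mem_extChartAt_target x)))
  simp only [extD, inChart_smul, h]
  rfl

end Forms

/-- The product `B(φ ∧ ψ)` of a `V`-valued `j`-form and a `W`-valued `k`-form (at one point) for a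
bilinear `B : V × W → Z`:
`(v₁, …, v_{j+k}) ↦ 1/(j! k!) ∑_σ sign(σ) B(φ(v_σ(1), …, v_σ(j)), ψ(v_σ(j+1), …, v_σ(j+k)))`. -/
def wedge {T V W Z : Type*} [AddCommGroup Z] [Module ℝ Z] {j k : ℕ} (B : V → W → Z)
    (φ : (Fin j → T) → V) (ψ : (Fin k → T) → W) : (Fin (j + k) → T) → Z := fun v =>
  ((j.factorial : ℝ) * (k.factorial : ℝ))⁻¹ • ∑ σ : Equiv.Perm (Fin (j + k)),
    (Equiv.Perm.sign σ : ℤ) • B (φ fun i => v (σ (Fin.castAdd k i)))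
      (ψ fun i => v (σ (Fin.natAdd j i)))

/-! ### The simplicial manifold `BG` and its total de Rham complex -/

section Simplicial

variable {G : Type*} [Group G]

/-- The face maps `BG_{n+1} = G^{n+1} → BG_n = G^n`:
`d_i (g₁, …, g_{n+1}) = (g₁, …, g_{i+1} g_i, …, g_{n+1})`, where `d₀` and `d_{n+1}` omit the first
and the last entry. -/
def face {n : ℕ} (i : Fin (n + 2)) (g : Fin (n + 1) → G) : Fin n → G := fun j =>
  if (j : ℕ) + 1 < i then g j.castSucc
  else if (j : ℕ) + 1 = i then g j.succ * g j.castSucc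
  else g j.succ

/-- The degeneracy maps `s_i (g₁, …, g_n) = (g₁, …, g_i, e, g_{i+1}, …, g_n)`. -/
def degen {n : ℕ} (i : Fin (n + 1)) (g : Fin n → G) : Fin (n + 1) → G :=
  Fin.insertNth (α := fun _ => G) i 1 g

/-- The projection `γ_n : EG_n = G^{n+1} → BG_n = G^n`,
`(g₀, …, g_n) ↦ (g₁ g₀⁻¹, …, g_n g_{n-1}⁻¹)`. -/
def proj {n : ℕ} (g : Fin (n + 1) → G) : Fin n → G := fun j => g j.succ * (g j.castSucc)⁻¹

end Simplicial

/-- The model of the product manifold `G^n`, for `G` modelled on `E`. -/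
abbrev powModel (E : Type*) [NormedAddCommGroup E] [NormedSpace ℝ E] (n : ℕ) :
    ModelWithCorners ℝ (Fin n → E) (ModelPi fun _ : Fin n => E) :=
  ModelWithCorners.pi fun _ : Fin n => 𝓘(ℝ, E)

section Complex

variable (E : Type*) [NormedAddCommGroup E] [NormedSpace ℝ E]
  (G : Type*) [TopologicalSpace G] [ChartedSpace E G] [Group G]
  (F : Type*) [NormedAddCommGroup F] [NormedSpace ℝ F]

/-- Bigraded families `(α_{p,q})`, where `α_{p,q}` is a field of `q`-forms on `BG_p = G^p`. -/
abbrev BiFamily : Type _ := (p q : ℕ) → AltField (powModel E p) (Fin p → G) q F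

/-- `Tot^n(BG) = ⨁_{p+q=n} C^{p,q}(BG)`, where `C^{p,q}(BG) ⊆ Ω^q(BG_p)` consists of the smooth
forms that are killed by all the `s_i^*`. -/
def tot (n : ℕ) : Submodule ℝ (BiFamily E G F) where
  carrier := {α | (∀ p q, IsSmooth (powModel E p) (α p q)) ∧
    (∀ p q, ∀ i : Fin (p + 1),
      pullback (powModel E p) (powModel E (p + 1)) (degen i) (α (p + 1) q) = 0) ∧
    ∀ p q, p + q ≠ n → α p q = 0}
  zero_mem' := ⟨fun _ _ => IsSmooth.zero, fun _ _ _ => rfl, fun _ _ _ => rfl⟩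
  add_mem' := by
    rintro α β ⟨hα, hα', hα''⟩ ⟨hβ, hβ', hβ''⟩
    refine ⟨fun p q => (hα p q).add (hβ p q), fun p q i => ?_, fun p q h => ?_⟩
    · have : pullback (powModel E p) (powModel E (p + 1)) (degen i) ((α + β) (p + 1) q)
        = pullback (powModel E p) (powModel E (p + 1)) (degen i) (α (p + 1) q)
          + pullback (powModel E p) (powModel E (p + 1)) (degen i) (β (p + 1) q) := rfl
      rw [this, hα', hβ', add_zero]
    · show α p q + β p q = 0
      rw [hα'' p q h, hβ'' p q h, add_zero]
  smul_mem' := by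
    rintro c α ⟨hα, hα', hα''⟩
    refine ⟨fun p q => (hα p q).smul c, fun p q i => ?_, fun p q h => ?_⟩
    · have : pullback (powModel E p) (powModel E (p + 1)) (degen i) ((c • α) (p + 1) q)
        = c • pullback (powModel E p) (powModel E (p + 1)) (degen i) (α (p + 1) q) := rfl
      rw [this, hα', smul_zero]
    · show c • α p q = 0
      rw [hα'' p q h, smul_zero]

variable {E G F}

/-- The horizontal differential `δ = ∑_j (-1)^j d_j^*`. -/
def horD (α : BiFamily E G F) : BiFamily E G F
  | 0, _ => 0
  | p + 1, q => ∑ j : Fin (p + 2),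
      (-1 : ℝ) ^ (j : ℕ) • pullback (powModel E (p + 1)) (powModel E p) (face j) (α p q)

/-- The vertical differential, the exterior derivative on each `BG_p`. -/
def verD (α : BiFamily E G F) : BiFamily E G F
  | _, 0 => 0
  | p, q + 1 => extD (powModel E p) (α p q)

/-- The total differential `D = δ + (-1)^p d`. -/
def totalD (α : BiFamily E G F) : BiFamily E G F := fun p q =>
  horD α p q + (-1 : ℝ) ^ p • verD α p q

theorem horD_add (α β : BiFamily E G F) : horD (α + β) = horD α + horD β := by
  funext p q
  cases p with
  | zero => exact (add_zero _).symm
  | succ p =>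
    show _ = horD α (p + 1) q + horD β (p + 1) q
    simp only [horD]
    rw [← Finset.sum_add_distrib]
    refine Finset.sum_congr rfl fun j _ => ?_
    rw [← smul_add]
    rfl

theorem horD_smul (c : ℝ) (α : BiFamily E G F) : horD (c • α) = c • horD α := by
  funext p q
  cases p with
  | zero => exact (smul_zero c).symm
  | succ p =>
    show _ = c • horD α (p + 1) q
    simp only [horD]
    rw [Finset.smul_sum]
    refine Finset.sum_congr rfl fun j _ => ?_
    rw [smul_comm]
    rfl

theorem verD_add {α β : BiFamily E G F} (hα : ∀ p q, IsSmooth (powModel E p) (α p q))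
    (hβ : ∀ p q, IsSmooth (powModel E p) (β p q)) : verD (α + β) = verD α + verD β := by
  funext p q
  cases q with
  | zero => exact (add_zero _).symm
  | succ q => exact extD_add (hα p q) (hβ p q)

theorem verD_smul (c : ℝ) (α : BiFamily E G F) : verD (c • α) = c • verD α := by
  funext p q
  cases q with
  | zero => exact (smul_zero c).symm
  | succ q => exact extD_smul c (α p q)

variable (E G F)

/-- The total differential on `Tot^n(BG)`. -/
def totD (n : ℕ) : tot E G F n →ₗ[ℝ] BiFamily E G F where
  toFun α := totalD α.1
  map_add' α β := by
    funext p q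
    show horD (α.1 + β.1) p q + _ • verD (α.1 + β.1) p q
      = (horD α.1 p q + _ • verD α.1 p q) + (horD β.1 p q + _ • verD β.1 p q)
    rw [horD_add, verD_add α.2.1 β.2.1]
    show (horD α.1 p q + horD β.1 p q) + _ • (verD α.1 p q + verD β.1 p q) = _
    rw [smul_add]
    abel
  map_smul' c α := by
    funext p q
    show horD (c • α.1) p q + _ • verD (c • α.1) p q
      = c • (horD α.1 p q + _ • verD α.1 p q)
    rw [horD_smul, verD_smul]
    show c • horD α.1 p q + _ • c • verD α.1 p q = _
    rw [smul_add, smul_comm c]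

/-- The cocycles of `Tot^n(BG)`. -/
def cocycles (n : ℕ) : Submodule ℝ (BiFamily E G F) :=
  (LinearMap.ker (totD E G F n)).map (tot E G F n).subtype

/-- The coboundaries `D(Tot^{n-1}(BG))`. -/
def coboundaries : (n : ℕ) → Submodule ℝ (BiFamily E G F)
  | 0 => ⊥
  | n + 1 => LinearMap.range (totD E G F n)

/-- The cohomology `H^n(BG) = H^n(Tot(BG))` with coefficients in `F`. -/
abbrev Cohomology (n : ℕ) : Type _ :=
  cocycles E G F n ⧸ (coboundaries E G F n).comap (cocycles E G F n).subtype

end Complex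

/-! ### Matrix Lie groups, Maurer-Cartan forms, the canonical connection on `EG` -/

section MatrixGroup

variable {𝕜 : Type*} [RCLike 𝕜] {m : ℕ}
  {E : Type*} [NormedAddCommGroup E] [NormedSpace ℝ E]
  {G : Type*} [TopologicalSpace G] [ChartedSpace E G] [Group G]

variable (𝕜 m) in
/-- The vector space of `m × m` matrices, as a normed space of arrays (with the sup norm); the
matrix operations are those of `Matrix`, via `Matrix.of`. -/
abbrev Arr : Type _ := Fin m → Fin m → 𝕜

/-- The inclusion of `G` into the vector space of matrices. -/
def toArr (ρ : G →* GL (Fin m) 𝕜) (g : G) : Arr 𝕜 m := fun i j => (ρ g).val i j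

variable (E) in
/-- `ρ` exhibits `G` as a Lie subgroup of `GL(m, 𝕜)`: it is an injective homomorphism and a smooth
immersion. -/
structure IsLieSubgroup (ρ : G →* GL (Fin m) 𝕜) : Prop where
  injective : Function.Injective ρ
  smooth : ContMDiff 𝓘(ℝ, E) 𝓘(ℝ, Arr 𝕜 m) ∞ (toArr ρ)
  immersion : ∀ g : G, Function.Injective (mfderiv 𝓘(ℝ, E) 𝓘(ℝ, Arr 𝕜 m) (toArr ρ) g)

/-- The identification of the Lie algebra `T_e G` with a space of matrices. -/
def lieToArr (ρ : G →* GL (Fin m) 𝕜) : TangentSpace 𝓘(ℝ, E) (1 : G) →L[ℝ] Arr 𝕜 m :=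
  mfderiv 𝓘(ℝ, E) 𝓘(ℝ, Arr 𝕜 m) (toArr ρ) 1

variable (E) in
/-- The left Maurer-Cartan form `ω^l(v) = (L_{g⁻¹})_* v` for `v ∈ T_g G`, with values in the Lie
algebra, seen as a space of matrices. -/
def leftMC (ρ : G →* GL (Fin m) 𝕜) : AltField 𝓘(ℝ, E) G 1 (Arr 𝕜 m) := fun g =>
  ContinuousAlternatingMap.ofSubsingleton ℝ (TangentSpace 𝓘(ℝ, E) g) _ (0 : Fin 1)
    ((lieToArr ρ : E →L[ℝ] _).comp
      (mfderiv 𝓘(ℝ, E) 𝓘(ℝ, E) (fun h : G => g⁻¹ * h) g : E →L[ℝ] E))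

variable (E) in
/-- The right Maurer-Cartan form `ω^r(v) = (R_{g⁻¹})_* v` for `v ∈ T_g G`. -/
def rightMC (ρ : G →* GL (Fin m) 𝕜) : AltField 𝓘(ℝ, E) G 1 (Arr 𝕜 m) := fun g =>
  ContinuousAlternatingMap.ofSubsingleton ℝ (TangentSpace 𝓘(ℝ, E) g) _ (0 : Fin 1)
    ((lieToArr ρ : E →L[ℝ] _).comp
      (mfderiv 𝓘(ℝ, E) 𝓘(ℝ, E) (fun h : G => h * g⁻¹) g : E →L[ℝ] E))

variable (E) in
/-- `ω^l ∘ inv`, where `inv : T_A G → T_{A⁻¹} G` is the tangent map of the inversion. -/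
def leftMCInv (ρ : G →* GL (Fin m) 𝕜) : AltField 𝓘(ℝ, E) G 1 (Arr 𝕜 m) :=
  pullback 𝓘(ℝ, E) 𝓘(ℝ, E) (fun g : G => g⁻¹) (leftMC E ρ)

/-- A differential form on `G`, seen as a form on `BG_1 = G^1`. -/
def onBG1 {F : Type*} [NormedAddCommGroup F] [NormedSpace ℝ F] {k : ℕ}
    (θ : AltField 𝓘(ℝ, E) G k F) : AltField (powModel E 1) (Fin 1 → G) k F :=
  pullback (powModel E 1) 𝓘(ℝ, E) (fun x : Fin 1 → G => x 0) θ

/-- The pullback `d_i^* ω` to `BG_2` of a form on `G = BG_1`. -/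
def facePullback {F : Type*} [NormedAddCommGroup F] [NormedSpace ℝ F] {k : ℕ} (i : Fin 3)
    (θ : AltField 𝓘(ℝ, E) G k F) : AltField (powModel E 2) (Fin 2 → G) k F :=
  pullback (powModel E 2) (powModel E 1) (face i) (onBG1 θ)

/-- The coefficient `p_{k/2}(A, …, A)` of `t^{m-k}` in `det(t·id - A/(2π))`
(there is no such coefficient, and the value is `0`, if `k > m`). -/
def pontryaginCoeff (k : ℕ) (A : Matrix (Fin m) (Fin m) 𝕜) : 𝕜 :=
  if k ≤ m then (Matrix.charpoly ((((2 * Real.pi)⁻¹ : ℝ) : 𝕜) • A)).coeff (m - k) else 0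

/-- The first Pontryagin polynomial `p₁(A, B)`: the polarization of the quadratic polynomial
`A ↦ p₁(A, A)`. -/
def pontryagin₁ (A B : Matrix (Fin m) (Fin m) 𝕜) : 𝕜 :=
  (pontryaginCoeff 2 (A + B) - pontryaginCoeff 2 A - pontryaginCoeff 2 B) / 2

/-- The model of the manifold `ℝ^n × EG_n = ℝ^n × G^{n+1}`. -/
abbrev totalModel (E : Type*) [NormedAddCommGroup E] [NormedSpace ℝ E] (n : ℕ) :
    ModelWithCorners ℝ ((Fin n → ℝ) × (Fin (n + 1) → E))
      (ModelProd (Fin n → ℝ) (ModelPi fun _ : Fin (n + 1) => E)) :=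
  𝓘(ℝ, Fin n → ℝ).prod (powModel E (n + 1))

/-- The standard simplex `Δ^n` in the oriented coordinates `(t₁, …, t_n)`, with
`t₀ = 1 - t₁ - … - t_n`. -/
def simplex (n : ℕ) : Set (Fin n → ℝ) := {t | (∀ i, 0 ≤ t i) ∧ ∑ i, t i ≤ 1}

/-- The barycentric coordinates `(t₀, t₁, …, t_n)`. -/
def bary {n : ℕ} (t : Fin n → ℝ) : Fin (n + 1) → ℝ := Fin.cons (1 - ∑ i, t i) t

/-- The canonical connection `ω̂_n = ∑_j t_j ω_j`, where `ω_j` is the pullback of the Maurer-Cartan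
form along the `j`-th projection `EG_n → G`. It is given by the same formula on `ℝ^n × EG_n`, of
which `Δ^n × EG_n` is a full-dimensional part. -/
def connection (ρ : G →* GL (Fin m) 𝕜) (n : ℕ) :
    AltField (totalModel E n) ((Fin n → ℝ) × (Fin (n + 1) → G)) 1 (Arr 𝕜 m) := fun p =>
  ∑ j : Fin (n + 1), bary p.1 j •
    pullback (totalModel E n) 𝓘(ℝ, E)
      (fun p : (Fin n → ℝ) × (Fin (n + 1) → G) => p.2 j) (leftMC E ρ) p

/-- The curvature `κ_n = dω̂_n + ½ [ω̂_n ∧ ω̂_n]`. -/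
def curvature (ρ : G →* GL (Fin m) 𝕜) (n : ℕ) (p : (Fin n → ℝ) × (Fin (n + 1) → G))
    (v : Fin 2 → TangentSpace (totalModel E n) p) : Matrix (Fin m) (Fin m) 𝕜 :=
  Matrix.of (extD (totalModel E n) (connection ρ n) p v)
    + (1 / 2 : ℝ) • wedge (fun A B => Matrix.of A * Matrix.of B - Matrix.of B * Matrix.of A)
        (connection ρ n p) (connection ρ n p) v

/-- The component `χ_n(f) = ∫_{Δ^n} f(κ_n ∧ κ_n)` on `EG_n` for a homogeneous polynomial `f` of
degree `2`. It is a form of degree `k = 4 - n`. The fibre integral evaluates the form on the vertical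
vectors `∂/∂t₁, …, ∂/∂t_n`, followed by lifts of the arguments. -/
def shulman (ρ : G →* GL (Fin m) 𝕜)
    (f : Matrix (Fin m) (Fin m) 𝕜 → Matrix (Fin m) (Fin m) 𝕜 → 𝕜)
    (n k : ℕ) (h : n + k = 4) (x : Fin (n + 1) → G)
    (u : Fin k → TangentSpace (powModel E (n + 1)) x) : 𝕜 :=
  ∫ t in simplex n, wedge f (curvature ρ n (t, x)) (curvature ρ n (t, x))
    (fun i : Fin 4 =>
      (Fin.append (α := (Fin n → ℝ) × (Fin (n + 1) → E))
        (fun a => (Pi.single a 1, 0)) (fun b => (0, u b)) (Fin.cast h.symm i)))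

variable {F : Type*} [NormedAddCommGroup F] [NormedSpace ℝ F]

/-- `c` is the first Pontryagin class in `H^4(BG)`: the class of a cocycle `z` whose pullback
along `γ : EG → BG` is the sequence `(χ_n(p₁))_n`. Here `ι : F → 𝕜` embeds the field of coefficients
(`F = 𝕜`, or `F = ℝ`) into `𝕜`. -/
def IsFirstPontryaginClass (ι : F →L[ℝ] 𝕜) (ρ : G →* GL (Fin m) 𝕜)
    (c : Cohomology E G F 4) : Prop :=
  ∃ z : cocycles E G F 4, c = Submodule.Quotient.mk z ∧
    ∀ (n k : ℕ) (h : n + k = 4) (x : Fin (n + 1) → G)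
      (u : Fin k → TangentSpace (powModel E (n + 1)) x),
      ι (pullback (powModel E (n + 1)) (powModel E n) proj (z.1 n k) x u)
        = shulman ρ pontryagin₁ n k h x u

/-- The first Pontryagin class exists, is unique, and is represented by the cocycle
`(0, Θ, Ξ, 0, …)` with `Θ ∈ Ω³(BG_1)` and `Ξ ∈ Ω²(BG_2)`. -/
def FirstPontryaginClassIs (ι : F →L[ℝ] 𝕜) (ρ : G →* GL (Fin m) 𝕜)
    (Θ : (x : Fin 1 → G) → (Fin 3 → TangentSpace (powModel E 1) x) → 𝕜)
    (Ξ : (x : Fin 2 → G) → (Fin 2 → TangentSpace (powModel E 2) x) → 𝕜) : Prop :=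
  ∃ z : cocycles E G F 4,
    (∀ x v, ι (z.1 1 3 x v) = Θ x v) ∧ (∀ x v, ι (z.1 2 2 x v) = Ξ x v) ∧
    (∀ p q, (p, q) ≠ (1, 3) → (p, q) ≠ (2, 2) → z.1 p q = 0) ∧
    ∀ c : Cohomology E G F 4,
      IsFirstPontryaginClass ι ρ c ↔ c = Submodule.Quotient.mk z

/-- `tr(φ · φ · φ)` for a matrix-valued `1`-form `φ` (at a point). -/
def trCube {T : Type*} (φ : (Fin 1 → T) → Arr 𝕜 m) (v : Fin 3 → T) : 𝕜 :=
  (wedge (fun A B => Matrix.of A * B) φ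
    (wedge (fun A B => Matrix.of A * Matrix.of B) φ φ) v).trace

/-- `tr(φ · ψ)` for matrix-valued `1`-forms. -/
def trMul {T : Type*} (φ ψ : (Fin 1 → T) → Arr 𝕜 m) (v : Fin 2 → T) : 𝕜 :=
  wedge (fun A B => (Matrix.of A * Matrix.of B).trace) φ ψ v

/-- `tr(φ) · tr(ψ)` for matrix-valued `1`-forms. -/
def trTr {T : Type*} (φ ψ : (Fin 1 → T) → Arr 𝕜 m) (v : Fin 2 → T) : 𝕜 :=
  wedge (fun A B => (Matrix.of A).trace * (Matrix.of B).trace) φ ψ v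

end MatrixGroup

end BGForms

end

/-! For a `G`-valued map g write x = g⁻¹dg and y = dg g⁻¹ for its left and right logarithmic
derivatives, computed as matrices. The map g induces the pair (A, B) = (g, g⁻¹), and every form that
must be differentiated is a pullback of a form on a vector space with coefficients polynomial in
such pairs. There B is an independent variable, and the relation B = A⁻¹ enters only as dB = -B dA B
on the tangent vectors in question. Since d commutes with these pullbacks (`extD_pullback`), the
differential geometry reduces to noncommutative algebra under a trace.

The coefficient of the characteristic polynomial is a second elementary symmetric function, so p₁ =
-Q with Q(A, B) = (tr(AB) - tr A tr B)/8π². With τ = tr/8π², the claimed cocycle is Θ = τ(x³)/3 in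
bidegree (1,3) and Ξ = Q(y₁ ∧ x₂) in bidegree (2,2), where y₁ belongs to the first factor of G² and
x₂ to the second.

It is closed for three reasons. First, dΘ is a multiple of τ(x⁴), which vanishes by cyclicity.
Second, the left logarithmic derivative of g₂g₁ is conjugate to y₁ + x₂, so δΘ is minus the mixed
part of τ((y₁ + x₂)³)/3; because dy = y², dx = -x² and Q(·,·) is τ of the product as soon as one
argument is a commutator, that mixed part is dΞ. Third, δΞ = 0 because Q is invariant under
conjugation.

To compare with χ_n, note that κ_n = ∑ dt_j ∧ ω_j - ∑ t_j ω_j² + ω̂_n² has no dt ∧ dt component.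
Hence χ₃ = χ₄ = 0, while χ₀ = 0 is the Maurer-Cartan equation. For n = 1 the horizontal curvature is
-t(1-t)(ω₁ - ω₀)², and for n = 2 only the dt_j ∧ ω_j terms contribute; the fibre integrals are 1/6
and 1/2. On the other side γ pulls x and y back to conjugates of differences ω_{j+1} - ω_j, and the
two sides agree (`shulman_eq_pullback_proj`).

Uniqueness holds already for cocycles: γ_n has a smooth section, so γ_n^* is injective on forms. For
unitary groups the Lie algebra is skew-Hermitian, which makes the forms real, so the same cochain
composed with the real part works over ℝ. For O(m) and SU(m) the Lie algebra is traceless, and the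
product of traces disappears. -/

open scoped Manifold ContDiff

noncomputable section

namespace BGForms

/-! ### The manifold structure of powers of `G`. -/

section PowManifold

variable {E : Type*} [NormedAddCommGroup E] [NormedSpace ℝ E]
  {G : Type*} [TopologicalSpace G] [ChartedSpace E G]
  {E₁ : Type*} [NormedAddCommGroup E₁] [NormedSpace ℝ E₁]
  {H₁ : Type*} [TopologicalSpace H₁] {I : ModelWithCorners ℝ E₁ H₁}
  {M : Type*} [TopologicalSpace M] [ChartedSpace H₁ M]

theorem contMDiff_pow_iff {n : ℕ} {f : M → Fin n → G} :
    ContMDiff I (powModel E n) ∞ f ↔ ∀ j, ContMDiff I 𝓘(ℝ, E) ∞ fun x => f x j := by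
  have key : ∀ x, ContMDiffAt I (powModel E n) ∞ f x ↔
      ∀ j, ContMDiffAt I 𝓘(ℝ, E) ∞ (fun x => f x j) x := fun x => by
    simp only [contMDiffAt_iff, forall_and]
    exact and_congr continuousAt_pi contDiffWithinAt_pi
  exact ⟨fun h j x => (key x).1 (h x) j, fun h x => (key x).2 fun j => h j x⟩

theorem contMDiff_pow_apply {n : ℕ} (j : Fin n) :
    ContMDiff (powModel E n) 𝓘(ℝ, E) ∞ fun x : Fin n → G => x j :=
  contMDiff_pow_iff.1 contMDiff_id j

instance boundaryless_powModel (n : ℕ) : (powModel E n).Boundaryless where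
  range_eq_univ := by
    refine Set.range_eq_univ.2 fun y => ⟨y, ?_⟩
    rfl

/-- A chart change between product charts acts coordinate by coordinate, so each coordinate is a
chart change of `G` composed with a projection. -/
instance isManifold_pow [IsManifold 𝓘(ℝ, E) ∞ G] (n : ℕ) :
    IsManifold (powModel E n) ∞ (Fin n → G) := by
  refine isManifold_of_contDiffOn _ _ _ fun e e' he he' => ?_
  obtain ⟨e, he, rfl⟩ := he
  obtain ⟨e', he', rfl⟩ := he'
  refine contDiffOn_pi.2 fun j => ?_
  have h := (contDiffGroupoid ∞ 𝓘(ℝ, E)).compatible (he j trivial) (he' j trivial)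
  have h' : ContDiffOn ℝ ∞ ((e j).symm ≫ₕ e' j) ((e j).symm ≫ₕ e' j).source := by
    have := (mem_groupoid_of_pregroupoid.1 h).1
    simpa [contDiffPregroupoid] using this
  refine h'.comp (contDiff_apply ℝ E j).contDiffOn fun x hx => ?_
  exact ⟨hx.1.1 j trivial, hx.1.2 j trivial⟩

end PowManifold

/-! ### Pullback of forms from a vector space; smoothness and exterior derivative. -/

section PullbackForms

variable {E : Type*} [NormedAddCommGroup E] [NormedSpace ℝ E]
  {H : Type*} [TopologicalSpace H] {I : ModelWithCorners ℝ E H}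
  {M : Type*} [TopologicalSpace M] [ChartedSpace H M]
  {E' : Type*} [NormedAddCommGroup E'] [NormedSpace ℝ E']
  {H' : Type*} [TopologicalSpace H'] {I' : ModelWithCorners ℝ E' H'}
  {M' : Type*} [TopologicalSpace M'] [ChartedSpace H' M']
  {E'' : Type*} [NormedAddCommGroup E''] [NormedSpace ℝ E'']
  {H'' : Type*} [TopologicalSpace H''] {I'' : ModelWithCorners ℝ E'' H''}
  {M'' : Type*} [TopologicalSpace M''] [ChartedSpace H'' M'']
  {V : Type*} [NormedAddCommGroup V] [NormedSpace ℝ V]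
  {k : ℕ} {F : Type*} [NormedAddCommGroup F] [NormedSpace ℝ F]

theorem pullback_pullback {g : M' → M''} {f : M → M'} (hg : MDifferentiable I' I'' g)
    (hf : MDifferentiable I I' f) (θ : AltField I'' M'' k F) :
    pullback I I' f (pullback I' I'' g θ) = pullback I I'' (g ∘ f) θ := by
  funext x
  have h := mfderiv_comp x (hg (f x)) (hf x)
  refine ContinuousAlternatingMap.ext fun v => ?_
  simp only [pullback, h]
  rfl

theorem pullback_zero (f : M → M') :
    pullback I I' f (0 : AltField I' M' k F) = 0 := rfl

theorem extD_zero : extD I (0 : AltField I M k F) = 0 := by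
  have h := extD_smul 0 (0 : AltField I M k F)
  simpa using h

/-- A map into alternating maps on a finite-dimensional space is smooth as soon as all its
evaluations are. -/
theorem contDiffOn_alternating [FiniteDimensional ℝ V] {f : E → V [⋀^Fin k]→L[ℝ] F} {s : Set E}
    {n : ℕ∞ω} [FiniteDimensional ℝ F] (h : ∀ v, ContDiffOn ℝ n (fun y => f y v) s) :
    ContDiffOn ℝ n f s := by
  let b := Module.finBasis ℝ V
  let ev : (V [⋀^Fin k]→L[ℝ] F) →ₗ[ℝ] ((Fin k → Fin (Module.finrank ℝ V)) → F) :=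
    { toFun := fun A c => A fun i => b (c i)
      map_add' := fun _ _ => rfl
      map_smul' := fun _ _ => rfl }
  have hev : LinearMap.ker ev = ⊥ := by
    refine LinearMap.ker_eq_bot'.2 fun A hA => ?_
    refine ContinuousAlternatingMap.toAlternatingMap_injective ?_
    exact Module.Basis.ext_alternating b fun c _ => congrFun hA c
  -- An alternating form is recovered linearly from its finitely many values on basis vectors; in
  -- finite dimension this recovery map is continuous.
  obtain ⟨g, hg⟩ := ev.exists_leftInverse_of_injective hev
  have : f = fun y => LinearMap.toContinuousLinearMap g (ev (f y)) :=
    funext fun y => (LinearMap.congr_fun hg (f y)).symm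
  rw [this]
  exact (LinearMap.toContinuousLinearMap g).contDiff.comp_contDiffOn
    (contDiffOn_pi.2 fun c => h fun i => b (c i))

variable [IsManifold I ∞ M]

theorem contDiffOn_comp_extChartAt_symm {f : M → V} (hf : ContMDiff I 𝓘(ℝ, V) ∞ f) (x₀ : M) :
    ContDiffOn ℝ ∞ (f ∘ (extChartAt I x₀).symm) (extChartAt I x₀).target :=
  (hf.comp_contMDiffOn (contMDiffOn_extChartAt_symm x₀)).contDiffOn

variable [I.Boundaryless]

/-- By the chain rule, passing to a chart turns the pullback along f into the ordinary pullback
along f ∘ φ⁻¹ between normed spaces, where the flat calculus of forms applies. -/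
theorem inChart_pullback {f : M → V} (hf : ContMDiff I 𝓘(ℝ, V) ∞ f)
    (η : V → V [⋀^Fin k]→L[ℝ] F) (x₀ : M) {y : E} (hy : y ∈ (extChartAt I x₀).target) :
    inChart I (pullback I 𝓘(ℝ, V) f η) x₀ y
      = (η ((f ∘ (extChartAt I x₀).symm) y)).compContinuousLinearMap
        (fderiv ℝ (f ∘ (extChartAt I x₀).symm) y) := by
  have h1 : MDifferentiableAt 𝓘(ℝ, E) I (extChartAt I x₀).symm y :=
    ((contMDiffOn_extChartAt_symm (n := ∞) x₀).contMDiffAt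
      (extChartAt_target_mem_nhds' hy)).mdifferentiableAt (by simp)
  have h2 := mfderiv_comp y (hf.mdifferentiable (by simp) _) h1
  rw [mfderiv_eq_fderiv] at h2
  refine ContinuousAlternatingMap.ext fun v => ?_
  simp only [inChart, pullback, h2, I.range_eq_univ, mfderivWithin_univ]
  rfl

theorem isSmooth_pullback [FiniteDimensional ℝ E] [FiniteDimensional ℝ F] {f : M → V}
    (hf : ContMDiff I 𝓘(ℝ, V) ∞ f) {η : V → V [⋀^Fin k]→L[ℝ] F}
    (hη : ContDiff ℝ ∞ fun p : V × (Fin k → V) => η p.1 p.2) :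
    IsSmooth I (pullback I 𝓘(ℝ, V) f η) := fun x₀ => by
  have hF := contDiffOn_comp_extChartAt_symm hf x₀
  refine ContDiffOn.congr ?_ fun y hy => inChart_pullback hf η x₀ hy
  refine contDiffOn_alternating fun v => ?_
  refine hη.comp_contDiffOn (hF.prodMk (contDiffOn_pi.2 fun i => ?_))
  exact (hF.fderiv_of_isOpen (isOpen_extChartAt_target x₀) (by simp)).clm_apply contDiffOn_const

/-- Naturality of d, reduced to `extDeriv_pullback` on normed spaces. It transports the exterior
derivatives of the polynomial model forms to powers of `G` and to the total space of the connection.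
-/
theorem extD_pullback [FiniteDimensional ℝ V] [FiniteDimensional ℝ F] {f : M → V}
    (hf : ContMDiff I 𝓘(ℝ, V) ∞ f) {η : V → V [⋀^Fin k]→L[ℝ] F}
    (hη : ∀ v, ContDiff ℝ ∞ fun p => η p v) :
    extD I (pullback I 𝓘(ℝ, V) f η) = pullback I 𝓘(ℝ, V) f (extDeriv η) := by
  funext x
  have hη' : ContDiff ℝ ∞ η :=
    contDiffOn_univ.1 (contDiffOn_alternating fun v => (hη v).contDiffOn)
  have hF := contDiffOn_comp_extChartAt_symm hf x
  have hx := extChartAt_target_mem_nhds (I := I) x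
  have h1 : inChart I (pullback I 𝓘(ℝ, V) f η) x =ᶠ[nhds (extChartAt I x x)] fun y =>
      (η ((f ∘ (extChartAt I x).symm) y)).compContinuousLinearMap
        (fderiv ℝ (f ∘ (extChartAt I x).symm) y) :=
    Filter.eventually_of_mem hx fun y hy => inChart_pullback hf η x hy
  have h2 : mfderiv I 𝓘(ℝ, V) f x = (fderiv ℝ (f ∘ (extChartAt I x).symm) (extChartAt I x x)).comp
      (mfderiv I 𝓘(ℝ, E) (extChartAt I x) x) := by
    -- The factorization through the chart holds only on the chart source, which is enough for the
    -- derivative at x.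
    have h3 : f =ᶠ[nhds x] (f ∘ (extChartAt I x).symm) ∘ extChartAt I x :=
      Filter.eventually_of_mem (extChartAt_source_mem_nhds (I := I) x) fun y hy => by
        simp only [Function.comp_apply, (extChartAt I x).left_inv hy]
    rw [h3.mfderiv_eq, ← mfderiv_eq_fderiv]
    refine mfderiv_comp x ?_ ?_
    · exact (((hF.contDiffAt hx).differentiableAt (by simp))).mdifferentiableAt
    · exact mdifferentiableAt_extChartAt (by simp)
  have h4 := extDeriv_pullback (r := ∞)
    (hη'.differentiable (by simp) ((f ∘ (extChartAt I x).symm) (extChartAt I x x)))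
    (hF.contDiffAt hx) (by simpa using ENat.LEInfty.out)
  refine ContinuousAlternatingMap.ext fun v => ?_
  simp only [extD, pullback, h2, I.range_eq_univ, extDerivWithin_univ, h1.extDeriv_eq, h4]
  simp only [Function.comp_apply, extChartAt_to_inv]
  rfl

end PullbackForms

/-! ### The first Pontryagin polynomial in terms of traces. -/

section Coefficient

theorem two_mul_det_of_card_eq_two {n R : Type*} [Fintype n] [DecidableEq n] [CommRing R]
    (hn : Fintype.card n = 2) (A : Matrix n n R) :
    2 * A.det = ∑ i, ∑ j, (A i i * A j j - A i j * A j i) := by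
  let e := Fintype.equivFinOfCardEq hn
  rw [← Matrix.det_submatrix_equiv_self e.symm A, Matrix.det_fin_two, ← e.symm.sum_comp]
  simp only [← e.symm.sum_comp (fun j => _), Fin.sum_univ_two, Matrix.submatrix_apply]
  ring

/-- Both sides are the sum over ordered pairs (i, j) of the 2 × 2 minor expressions. The factor 2
makes a sum over unordered pairs a sum over ordered ones without dividing in `R`. -/
theorem two_mul_sum_minors {n R : Type*} [Fintype n] [DecidableEq n] [CommRing R]
    (A : Matrix n n R) :
    2 * ∑ s ∈ Finset.univ.powersetCard 2,
      (A.submatrix (Subtype.val : s → n) (Subtype.val : s → n)).det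
      = A.trace * A.trace - (A * A).trace := by
  have h1 : A.trace * A.trace - (A * A).trace = ∑ i, ∑ j, (A i i * A j j - A i j * A j i) := by
    simp only [Matrix.trace, Matrix.diag, Matrix.mul_apply, Finset.sum_mul_sum,
      Finset.sum_sub_distrib]
  have h2 : ∀ s ∈ (Finset.univ : Finset n).powersetCard 2,
      2 * (A.submatrix (Subtype.val : s → n) (Subtype.val : s → n)).det
        = ∑ i, ∑ j, if i ∈ s ∧ j ∈ s then (A i i * A j j - A i j * A j i) else 0 := by
    intro s hs
    rw [two_mul_det_of_card_eq_two (by simpa using (Finset.mem_powersetCard.1 hs).2)]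
    have key : ∀ f : n → R, ∑ i : s, f i = ∑ i, if i ∈ s then f i else 0 := fun f => by
      rw [Finset.sum_coe_sort, Finset.sum_ite_mem, Finset.univ_inter]
    refine (key fun i => ∑ j : s, (A i i * A j j - A i j * A j i)).trans ?_
    refine Finset.sum_congr rfl fun i _ => ?_
    by_cases hi : i ∈ s
    · simpa [hi] using key fun j => A i i * A j j - A i j * A j i
    · simp [hi]
  rw [h1, Finset.mul_sum, Finset.sum_congr rfl h2, Finset.sum_comm]
  refine Finset.sum_congr rfl fun i _ => ?_
  rw [Finset.sum_comm]
  refine Finset.sum_congr rfl fun j _ => ?_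
  rw [← Finset.sum_filter, Finset.sum_const]
  -- Diagonal terms vanish, and a pair of distinct indices lies in exactly one two-element set.
  by_cases hij : i = j
  · subst hij; simp
  · have : (Finset.univ.powersetCard 2).filter (fun s : Finset n => i ∈ s ∧ j ∈ s) = {{i, j}} := by
      ext s
      simp only [Finset.mem_filter, Finset.mem_powersetCard_univ, Finset.mem_singleton]
      constructor
      · rintro ⟨hs, hi, hj⟩
        refine (Finset.eq_of_subset_of_card_le ?_ ?_).symm
        · simp [Finset.insert_subset_iff, hi, hj]
        · rw [hs, Finset.card_pair hij]
      · rintro rfl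
        simp [Finset.card_pair hij]
    rw [this]; simp

variable {𝕜 : Type*} [RCLike 𝕜] {m : ℕ}

/-- The coefficient is the sum of principal 2 × 2 minors of A/2π; the constant is 1/2 from the
doubled minor sum times 1/4π². -/
theorem pontryaginCoeff_two (A : Matrix (Fin m) (Fin m) 𝕜) :
    pontryaginCoeff 2 A = ((1 / (8 * Real.pi ^ 2) : ℝ) : 𝕜) *
      (A.trace * A.trace - (A * A).trace) := by
  have hπ : (Real.pi : 𝕜) ≠ 0 := by exact_mod_cast Real.pi_ne_zero
  unfold pontryaginCoeff
  split_ifs with h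
  · have h1 := Matrix.charpoly_coeff_eq_sum_minors
      ((((2 * Real.pi)⁻¹ : ℝ) : 𝕜) • A) 2 (by simpa using h)
    rw [Fintype.card_fin] at h1
    have h2 := two_mul_sum_minors ((((2 * Real.pi)⁻¹ : ℝ) : 𝕜) • A)
    rw [h1]
    simp only [Matrix.smul_mul, Matrix.mul_smul, Matrix.trace_smul, smul_eq_mul] at h2 ⊢
    have h3 : ∀ x y : 𝕜, 2 * x = y → (-1) ^ 2 * x = y / 2 := fun x y h => by rw [← h]; ring
    rw [h3 _ _ h2]
    push_cast
    field_simp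
    ring
  -- The default value 0 for m < 2 agrees with the trace formula, since (tr A)² = tr(A²) for
  -- matrices of size at most one.
  · have : m = 0 ∨ m = 1 := by omega
    obtain rfl | rfl := this
    · simp [Matrix.trace]
    · simp [Matrix.trace, Matrix.mul_apply]

theorem pontryagin₁_eq (A B : Matrix (Fin m) (Fin m) 𝕜) :
    pontryagin₁ A B = ((1 / (8 * Real.pi ^ 2) : ℝ) : 𝕜) *
      (A.trace * B.trace - (A * B).trace) := by
  simp only [pontryagin₁, pontryaginCoeff_two, add_mul, mul_add, Matrix.trace_add,
    Matrix.trace_mul_comm B A]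
  ring

end Coefficient

/-! ### Explicit signed sums over small symmetric groups. -/

section Permutations

/-- Each permutation is a swap of 0 with p composed with a permutation fixing 0, and the swap
contributes -1 unless p = 0. The explicit sums for three and four letters follow recursively. -/
theorem sum_perm_succ {Z : Type*} [AddCommGroup Z] {n : ℕ}
    (g : Equiv.Perm (Fin (n + 1)) → Z) :
    ∑ σ, (Equiv.Perm.sign σ : ℤ) • g σ = ∑ p, (if p = 0 then 1 else -1 : ℤ) •
      ∑ τ : Equiv.Perm (Fin n), (Equiv.Perm.sign τ : ℤ) •
        g (Equiv.Perm.decomposeFin.symm (p, τ)) := by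
  rw [← Equiv.Perm.decomposeFin.symm.sum_comp, Fintype.sum_prod_type]
  refine Finset.sum_congr rfl fun p _ => ?_
  rw [Finset.smul_sum]
  refine Finset.sum_congr rfl fun τ _ => ?_
  rw [Equiv.Perm.decomposeFin.symm_sign, smul_smul]
  split_ifs <;> simp

theorem sum_perm_two {Z : Type*} [AddCommGroup Z] (f : Fin 2 → Fin 2 → Z) :
    ∑ σ : Equiv.Perm (Fin 2), (Equiv.Perm.sign σ : ℤ) • f (σ 0) (σ 1) = f 0 1 - f 1 0 := by
  simp [Finset.univ_perm_fin_succ, Fin.sum_univ_succ, ← Finset.univ_product_univ,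
    Equiv.swap_apply_def, sub_eq_add_neg]

theorem sum_perm_three {Z : Type*} [AddCommGroup Z] (f : Fin 3 → Fin 3 → Fin 3 → Z) :
    ∑ σ : Equiv.Perm (Fin 3), (Equiv.Perm.sign σ : ℤ) • f (σ 0) (σ 1) (σ 2)
      = f 0 1 2 - f 0 2 1 - f 1 0 2 + f 1 2 0 + f 2 0 1 - f 2 1 0 := by
  have h : ∀ (p : Fin 3) (τ : Equiv.Perm (Fin 2)),
      f (Equiv.Perm.decomposeFin.symm (p, τ) 0) (Equiv.Perm.decomposeFin.symm (p, τ) 1)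
        (Equiv.Perm.decomposeFin.symm (p, τ) 2)
      = f p (Equiv.swap 0 p (τ 0).succ) (Equiv.swap 0 p (τ 1).succ) := fun p τ => by
    rw [← Equiv.Perm.decomposeFin_symm_apply_succ, ← Equiv.Perm.decomposeFin_symm_apply_succ,
      Equiv.Perm.decomposeFin_symm_apply_zero]
    rfl
  rw [sum_perm_succ]
  have h' := fun p : Fin 3 => sum_perm_two fun a b =>
    f p (Equiv.swap 0 p a.succ) (Equiv.swap 0 p b.succ)
  simp only [h, h', Fin.sum_univ_three]
  rw [show Equiv.swap (0 : Fin 3) 0 (Fin.succ 0) = 1 by decide,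
    show Equiv.swap (0 : Fin 3) 0 (Fin.succ 1) = 2 by decide,
    show Equiv.swap (0 : Fin 3) 1 (Fin.succ 0) = 0 by decide,
    show Equiv.swap (0 : Fin 3) 1 (Fin.succ 1) = 2 by decide,
    show Equiv.swap (0 : Fin 3) 2 (Fin.succ 0) = 1 by decide,
    show Equiv.swap (0 : Fin 3) 2 (Fin.succ 1) = 0 by decide]
  simp
  abel

theorem sum_perm_four {Z : Type*} [AddCommGroup Z] (f : Fin 4 → Fin 4 → Fin 4 → Fin 4 → Z) :
    ∑ σ : Equiv.Perm (Fin 4), (Equiv.Perm.sign σ : ℤ) • f (σ 0) (σ 1) (σ 2) (σ 3)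
      = (f 0 1 2 3 - f 0 1 3 2 - f 0 2 1 3 + f 0 2 3 1 + f 0 3 1 2 - f 0 3 2 1)
      - (f 1 0 2 3 - f 1 0 3 2 - f 1 2 0 3 + f 1 2 3 0 + f 1 3 0 2 - f 1 3 2 0)
      + (f 2 0 1 3 - f 2 0 3 1 - f 2 1 0 3 + f 2 1 3 0 + f 2 3 0 1 - f 2 3 1 0)
      - (f 3 0 1 2 - f 3 0 2 1 - f 3 1 0 2 + f 3 1 2 0 + f 3 2 0 1 - f 3 2 1 0) := by
  have h : ∀ (p : Fin 4) (τ : Equiv.Perm (Fin 3)),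
      f (Equiv.Perm.decomposeFin.symm (p, τ) 0) (Equiv.Perm.decomposeFin.symm (p, τ) 1)
        (Equiv.Perm.decomposeFin.symm (p, τ) 2) (Equiv.Perm.decomposeFin.symm (p, τ) 3)
      = f p (Equiv.swap 0 p (τ 0).succ) (Equiv.swap 0 p (τ 1).succ)
        (Equiv.swap 0 p (τ 2).succ) := fun p τ => by
    rw [← Equiv.Perm.decomposeFin_symm_apply_succ, ← Equiv.Perm.decomposeFin_symm_apply_succ,
      ← Equiv.Perm.decomposeFin_symm_apply_succ, Equiv.Perm.decomposeFin_symm_apply_zero]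
    rfl
  rw [sum_perm_succ]
  have h' := fun p : Fin 4 => sum_perm_three fun a b c =>
    f p (Equiv.swap 0 p a.succ) (Equiv.swap 0 p b.succ) (Equiv.swap 0 p c.succ)
  simp only [h, h', Fin.sum_univ_four]
  rw [show Equiv.swap (0 : Fin 4) 0 (Fin.succ 0) = 1 by decide,
    show Equiv.swap (0 : Fin 4) 0 (Fin.succ 1) = 2 by decide,
    show Equiv.swap (0 : Fin 4) 0 (Fin.succ 2) = 3 by decide,
    show Equiv.swap (0 : Fin 4) 1 (Fin.succ 0) = 0 by decide,
    show Equiv.swap (0 : Fin 4) 1 (Fin.succ 1) = 2 by decide,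
    show Equiv.swap (0 : Fin 4) 1 (Fin.succ 2) = 3 by decide,
    show Equiv.swap (0 : Fin 4) 2 (Fin.succ 0) = 1 by decide,
    show Equiv.swap (0 : Fin 4) 2 (Fin.succ 1) = 0 by decide,
    show Equiv.swap (0 : Fin 4) 2 (Fin.succ 2) = 3 by decide,
    show Equiv.swap (0 : Fin 4) 3 (Fin.succ 0) = 1 by decide,
    show Equiv.swap (0 : Fin 4) 3 (Fin.succ 1) = 2 by decide,
    show Equiv.swap (0 : Fin 4) 3 (Fin.succ 2) = 0 by decide]
  simp
  abel

end Permutations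

/-! ### Wedge products in the low degrees that occur. -/

section Wedge

variable {T V W Z : Type*} [AddCommGroup Z] [Module ℝ Z]

theorem wedge_one_one (B : V → W → Z) (φ : (Fin 1 → T) → V) (ψ : (Fin 1 → T) → W)
    (v : Fin 2 → T) :
    wedge B φ ψ v = B (φ fun _ => v 0) (ψ fun _ => v 1) - B (φ fun _ => v 1) (ψ fun _ => v 0) := by
  have h := sum_perm_two fun a b => B (φ fun _ => v a) (ψ fun _ => v b)
  rw [← h]
  simp only [wedge, Nat.factorial_one, Nat.cast_one, mul_one, inv_one, one_smul]
  refine Finset.sum_congr rfl fun σ _ => ?_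
  congr 4 <;> funext i <;> rw [Subsingleton.elim i 0] <;> rfl

theorem wedge_one_two (B : V → W → Z) (φ : (Fin 1 → T) → V) (ψ : (Fin 2 → T) → W)
    (v : Fin 3 → T) :
    wedge B φ ψ v = (2⁻¹ : ℝ) • (
      B (φ fun _ => v 0) (ψ ![v 1, v 2]) - B (φ fun _ => v 0) (ψ ![v 2, v 1])
      - B (φ fun _ => v 1) (ψ ![v 0, v 2]) + B (φ fun _ => v 1) (ψ ![v 2, v 0])
      + B (φ fun _ => v 2) (ψ ![v 0, v 1]) - B (φ fun _ => v 2) (ψ ![v 1, v 0])) := by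
  have h := sum_perm_three fun a b c => B (φ fun _ => v a) (ψ ![v b, v c])
  rw [← h]
  simp only [wedge, Nat.factorial_one, Nat.factorial_two, Nat.cast_one, one_mul, Nat.cast_ofNat]
  congr 1
  refine Finset.sum_congr rfl fun σ _ => ?_
  congr 3
  · funext i; rw [Subsingleton.elim i 0]; rfl
  · funext i; fin_cases i <;> rfl

/-- The 24 permutations fall into three classes, one for each splitting of four vectors into two
pairs. Each class has eight equal signed terms, and 8/(2!·2!) = 2. -/
theorem wedge_two_two {B : V → V → Z} (hB : ∀ x y, B x y = B y x) [Neg V]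
    (hneg : ∀ x y, B (-x) y = -B x y) {φ : (Fin 2 → T) → V}
    (hφ : ∀ x y, φ ![x, y] = -φ ![y, x]) (v : Fin 4 → T) :
    wedge B φ φ v = (2 : ℝ) • (B (φ ![v 0, v 1]) (φ ![v 2, v 3])
      - B (φ ![v 0, v 2]) (φ ![v 1, v 3]) + B (φ ![v 0, v 3]) (φ ![v 1, v 2])) := by
  have h := sum_perm_four fun a b c d => B (φ ![v a, v b]) (φ ![v c, v d])
  have h1 : wedge B φ φ v = (4⁻¹ : ℝ) • ∑ σ : Equiv.Perm (Fin 4), (Equiv.Perm.sign σ : ℤ) •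
      B (φ ![v (σ 0), v (σ 1)]) (φ ![v (σ 2), v (σ 3)]) := by
    simp only [wedge, Nat.factorial_two, Nat.cast_ofNat]
    norm_num only
    congr 1
    refine Finset.sum_congr rfl fun σ _ => ?_
    congr 3 <;> funext i <;> fin_cases i <;> rfl
  have hneg' : ∀ x y, B x (-y) = -B x y := fun x y => by rw [hB, hneg, hB]
  rw [h1, h, hφ (v 1) (v 0), hφ (v 2) (v 0), hφ (v 3) (v 0), hφ (v 2) (v 1), hφ (v 3) (v 1),
    hφ (v 3) (v 2)]
  simp only [hneg, hneg', hB (φ ![v 2, v 3]), hB (φ ![v 1, v 3]), hB (φ ![v 1, v 2])]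
  module

end Wedge

/-! ### The two fibre integrals over simplices. -/

section Simplex

open MeasureTheory

/-- The weight t(1-t) is the one appearing in the horizontal curvature over the 1-simplex. -/
theorem integral_simplex_one :
    ∫ t in simplex 1, (t 0 * (1 - t 0) : ℝ) = 1 / 6 := by
  have h := (volume_preserving_funUnique (Fin 1) ℝ).setIntegral_preimage_emb
    (MeasurableEquiv.funUnique (Fin 1) ℝ).measurableEmbedding (fun t => t * (1 - t)) (Set.Icc 0 1)
  have hs : simplex 1 = MeasurableEquiv.funUnique (Fin 1) ℝ ⁻¹' Set.Icc 0 1 := by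
    ext t
    simp [simplex]
  rw [hs]
  refine h.trans ?_
  rw [integral_Icc_eq_integral_Ioc, ← intervalIntegral.integral_of_le zero_le_one]
  simp only [mul_sub, mul_one, ← pow_two]
  rw [intervalIntegral.integral_sub (by simp) (by simp)]
  norm_num [integral_pow]

theorem volume_simplex_two : volume.real (simplex 2) = 1 / 2 := by
  have h1 := (volume_preserving_finTwoArrow ℝ).measure_preimage_emb
    (MeasurableEquiv.finTwoArrow (α := ℝ)).measurableEmbedding
    {p : ℝ × ℝ | p.1 ∈ Set.Icc (0 : ℝ) 1 ∧ p.2 ∈ Set.Icc 0 (1 - p.1)}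
  have hs : simplex 2 = MeasurableEquiv.finTwoArrow (α := ℝ) ⁻¹'
      {p : ℝ × ℝ | p.1 ∈ Set.Icc (0 : ℝ) 1 ∧ p.2 ∈ Set.Icc 0 (1 - p.1)} := by
    ext t
    simp [simplex, MeasurableEquiv.finTwoArrow, Fin.forall_fin_two]
    constructor
    · rintro ⟨⟨h0, h1⟩, h2⟩
      exact ⟨⟨h0, by linarith⟩, h1, by linarith⟩
    · rintro ⟨⟨h0, h1⟩, h2, h3⟩
      exact ⟨⟨h0, h2⟩, by linarith⟩
  have hm : MeasurableSet {p : ℝ × ℝ | p.1 ∈ Set.Icc (0 : ℝ) 1 ∧ p.2 ∈ Set.Icc 0 (1 - p.1)} := by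
    refine IsClosed.measurableSet ?_
    simp only [Set.mem_Icc, Set.ofPred_and]
    refine ((isClosed_le ?_ ?_).inter (isClosed_le ?_ ?_)).inter
      ((isClosed_le ?_ ?_).inter (isClosed_le ?_ ?_)) <;> fun_prop
  -- The slices of the triangle are intervals of length 1 - x for x in [0, 1] and empty otherwise;
  -- Fubini then leaves a one-dimensional integral.
  have h2 : ∀ x : ℝ, volume (Prod.mk x ⁻¹'
      {p : ℝ × ℝ | p.1 ∈ Set.Icc (0 : ℝ) 1 ∧ p.2 ∈ Set.Icc 0 (1 - p.1)})
      = (Set.Icc (0 : ℝ) 1).indicator (fun x => ENNReal.ofReal (1 - x)) x := fun x => by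
    by_cases hx : x ∈ Set.Icc (0 : ℝ) 1
    · rw [Set.indicator_of_mem hx]
      have : Prod.mk x ⁻¹' {p : ℝ × ℝ | p.1 ∈ Set.Icc (0 : ℝ) 1 ∧ p.2 ∈ Set.Icc 0 (1 - p.1)}
          = Set.Icc 0 (1 - x) := by
        ext y
        exact ⟨fun h => h.2, fun h => ⟨hx, h⟩⟩
      rw [this, Real.volume_Icc, sub_zero]
    · rw [Set.indicator_of_notMem hx]
      have : Prod.mk x ⁻¹' {p : ℝ × ℝ | p.1 ∈ Set.Icc (0 : ℝ) 1 ∧ p.2 ∈ Set.Icc 0 (1 - p.1)}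
          = ∅ := by
        ext y
        exact ⟨fun h => hx h.1, fun h => h.elim⟩
      rw [this, measure_empty]
  rw [Measure.real, hs, h1, Measure.volume_eq_prod, Measure.prod_apply hm]
  simp only [h2]
  rw [lintegral_indicator measurableSet_Icc, ← ofReal_integral_eq_lintegral_ofReal
    (Continuous.continuousOn (by fun_prop)).integrableOn_Icc
    ((ae_restrict_iff' measurableSet_Icc).2 (.of_forall fun x hx => by
      simpa using hx.2))]
  rw [integral_Icc_eq_integral_Ioc, ← intervalIntegral.integral_of_le zero_le_one,
    intervalIntegral.integral_sub (by simp) (by simp)]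
  norm_num [integral_id]

end Simplex

/-! ### Model forms on a normed algebra and their exterior derivatives. -/

section AlgebraForms

variable {𝔄 : Type*} [NormedRing 𝔄] [NormedAlgebra ℝ 𝔄]
  {F : Type*} [NormedAddCommGroup F] [NormedSpace ℝ F]

/-- The alternating form `(X₀, X₁, X₂) ↦ 3⁻¹ ∑_σ sign(σ) τ(X_σ(0) X_σ(1) X_σ(2))`. -/
def cubeForm (τ : 𝔄 →L[ℝ] F) : 𝔄 [⋀^Fin 3]→L[ℝ] F :=
  (3⁻¹ : ℝ) • ContinuousMultilinearMap.alternatization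
    (τ.compContinuousMultilinearMap (ContinuousMultilinearMap.mkPiAlgebraFin ℝ 3 𝔄))

/-- Cyclic rotations of three letters are even, so the six terms form two cyclic classes of three
equal terms, and 3⁻¹ cancels the multiplicity. -/
theorem cubeForm_apply {τ : 𝔄 →L[ℝ] F} (hτ : ∀ x y, τ (x * y) = τ (y * x)) (X : Fin 3 → 𝔄) :
    cubeForm τ X = τ (X 0 * X 1 * X 2) - τ (X 0 * X 2 * X 1) := by
  have h := sum_perm_three fun a b c => τ (X a * X b * X c)
  have h1 : ∀ a b c, τ (X a * X b * X c) = τ (X c * X a * X b) := fun a b c => by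
    rw [hτ, mul_assoc]
  have h2 : cubeForm τ X = (3⁻¹ : ℝ) • ∑ σ : Equiv.Perm (Fin 3),
      (Equiv.Perm.sign σ : ℤ) • τ (X (σ 0) * X (σ 1) * X (σ 2)) := by
    simp only [cubeForm, ContinuousAlternatingMap.smul_apply,
      ContinuousMultilinearMap.alternatization_apply_apply]
    congr 1
    refine Finset.sum_congr rfl fun σ _ => ?_
    simp [List.ofFn_succ, mul_assoc]
    rfl
  rw [h2, h, h1 1 2 0, h1 2 0 1, h1 1 2 0, h1 1 0 2, h1 2 1 0]
  module

/-- The alternating form `((y₀, x₀), (y₁, x₁)) ↦ Q(y₀, x₁) - Q(y₁, x₀)`. -/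
def crossForm (Q : 𝔄 →L[ℝ] 𝔄 →L[ℝ] F) : (𝔄 × 𝔄) [⋀^Fin 2]→L[ℝ] F :=
  ContinuousMultilinearMap.alternatization Q.uncurryBilinear

theorem crossForm_apply (Q : 𝔄 →L[ℝ] 𝔄 →L[ℝ] F) (v : Fin 2 → 𝔄 × 𝔄) :
    crossForm Q v = Q (v 0).1 (v 1).2 - Q (v 1).1 (v 0).2 := by
  rw [← sum_perm_two fun a b => Q (v a).1 (v b).2]
  simp only [crossForm, ContinuousMultilinearMap.alternatization_apply_apply,
    ContinuousLinearMap.uncurryBilinear_apply]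
  rfl

/-- The `3`-form `τ((B dA)³) / 3` on the space of pairs `(A, B)`. -/
def cubeField (τ : 𝔄 →L[ℝ] F) (p : 𝔄 × 𝔄) : (𝔄 × 𝔄) [⋀^Fin 3]→L[ℝ] F :=
  (cubeForm τ).compContinuousLinearMap
    ((ContinuousLinearMap.mul ℝ 𝔄 p.2).comp (ContinuousLinearMap.fst ℝ 𝔄 𝔄))

/-- The `2`-form `Q(dA₁ B₁ ∧ B₂ dA₂)` on the space of quadruples `((A₁, B₁), (A₂, B₂))`. -/
def crossField (Q : 𝔄 →L[ℝ] 𝔄 →L[ℝ] F) (p : (𝔄 × 𝔄) × (𝔄 × 𝔄)) :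
    ((𝔄 × 𝔄) × (𝔄 × 𝔄)) [⋀^Fin 2]→L[ℝ] F :=
  (crossForm Q).compContinuousLinearMap
    (((ContinuousLinearMap.mul ℝ 𝔄).flip p.1.2 ∘L
        ContinuousLinearMap.fst ℝ 𝔄 𝔄 ∘L ContinuousLinearMap.fst ℝ (𝔄 × 𝔄) (𝔄 × 𝔄)).prod
      (ContinuousLinearMap.mul ℝ 𝔄 p.2.2 ∘L
        ContinuousLinearMap.fst ℝ 𝔄 𝔄 ∘L ContinuousLinearMap.snd ℝ (𝔄 × 𝔄) (𝔄 × 𝔄)))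

theorem cubeField_apply (τ : 𝔄 →L[ℝ] F) (p : 𝔄 × 𝔄) (v : Fin 3 → 𝔄 × 𝔄) :
    cubeField τ p v = cubeForm τ fun i => p.2 * (v i).1 := rfl

theorem crossField_apply (Q : 𝔄 →L[ℝ] 𝔄 →L[ℝ] F) (p : (𝔄 × 𝔄) × (𝔄 × 𝔄))
    (v : Fin 2 → (𝔄 × 𝔄) × (𝔄 × 𝔄)) :
    crossField Q p v = Q ((v 0).1.1 * p.1.2) (p.2.2 * (v 1).2.1)
      - Q ((v 1).1.1 * p.1.2) (p.2.2 * (v 0).2.1) :=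
  crossForm_apply Q fun i => ((v i).1.1 * p.1.2, p.2.2 * (v i).2.1)

theorem contDiff_cubeField {τ : 𝔄 →L[ℝ] F} (hτ : ∀ x y, τ (x * y) = τ (y * x)) :
    ContDiff ℝ ∞ fun p : (𝔄 × 𝔄) × (Fin 3 → 𝔄 × 𝔄) => cubeField τ p.1 p.2 := by
  simp only [cubeField_apply, cubeForm_apply hτ]
  fun_prop

theorem contDiff_crossField (Q : 𝔄 →L[ℝ] 𝔄 →L[ℝ] F) :
    ContDiff ℝ ∞ fun p : ((𝔄 × 𝔄) × (𝔄 × 𝔄)) × (Fin 2 → (𝔄 × 𝔄) × (𝔄 × 𝔄)) =>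
      crossField Q p.1 p.2 := by
  simp only [crossField_apply]
  fun_prop

theorem contDiff_apply_of_contDiff_uncurry {V : Type*} [NormedAddCommGroup V] [NormedSpace ℝ V]
    {k : ℕ} {η : V → V [⋀^Fin k]→L[ℝ] F}
    (hη : ContDiff ℝ ∞ fun p : V × (Fin k → V) => η p.1 p.2) (v : Fin k → V) :
    ContDiff ℝ ∞ fun p => η p v :=
  hη.comp (contDiff_id.prodMk contDiff_const)

theorem extDeriv_apply_of_contDiff_uncurry {V : Type*} [NormedAddCommGroup V] [NormedSpace ℝ V]
    [FiniteDimensional ℝ V] [FiniteDimensional ℝ F] {k : ℕ} {η : V → V [⋀^Fin k]→L[ℝ] F}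
    (hη : ContDiff ℝ ∞ fun p : V × (Fin k → V) => η p.1 p.2) (p : V) (v : Fin (k + 1) → V) :
    extDeriv η p v = ∑ i : Fin (k + 1),
      (-1) ^ (i : ℕ) • fderiv ℝ (fun q => η q (i.removeNth v)) p (v i) := by
  have : ContDiff ℝ ∞ η := contDiffOn_univ.1
    (contDiffOn_alternating fun v => (contDiff_apply_of_contDiff_uncurry hη v).contDiffOn)
  exact extDeriv_apply (this.differentiable (by simp) p) v

/-- The hypothesis `hw` says that w is tangent to the locus B = A⁻¹. Differentiating B in one factor
B dA(v) then inserts -W directly in front of that factor. -/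
theorem fderiv_cubeField {τ : 𝔄 →L[ℝ] F} (hτ : ∀ x y, τ (x * y) = τ (y * x))
    (p w : 𝔄 × 𝔄) (hw : w.2 = -(p.2 * w.1 * p.2)) (v : Fin 3 → 𝔄 × 𝔄) {W X Y Z : 𝔄}
    (hW : p.2 * w.1 = W)
    (hX : p.2 * (v 0).1 = X) (hY : p.2 * (v 1).1 = Y) (hZ : p.2 * (v 2).1 = Z) :
    fderiv ℝ (fun q => cubeField τ q v) p w =
      -(τ (W * X * Y * Z) + τ (X * W * Y * Z) + τ (X * Y * W * Z))
      + (τ (W * X * Z * Y) + τ (X * W * Z * Y) + τ (X * Z * W * Y)) := by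
  have h : ∀ i, HasFDerivAt (fun q : 𝔄 × 𝔄 => q.2 * (v i).1)
      (((ContinuousLinearMap.mul ℝ 𝔄).flip (v i).1).comp (ContinuousLinearMap.snd ℝ 𝔄 𝔄)) p :=
    fun i => (((ContinuousLinearMap.mul ℝ 𝔄).flip (v i).1).comp
      (ContinuousLinearMap.snd ℝ 𝔄 𝔄)).hasFDerivAt
  have h' : ∀ i j k, HasFDerivAt (fun q : 𝔄 × 𝔄 => τ (q.2 * (v i).1 * (q.2 * (v j).1)
      * (q.2 * (v k).1))) _ p := fun i j k =>
    τ.hasFDerivAt.comp p (((h i).mul' (h j)).mul' (h k))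
  have h'' := (h' 0 1 2).sub (h' 0 2 1)
  have heq : (fun q => cubeField τ q v) = (fun q : 𝔄 × 𝔄 => τ (q.2 * (v 0).1 * (q.2 * (v 1).1)
      * (q.2 * (v 2).1))) - fun q : 𝔄 × 𝔄 => τ (q.2 * (v 0).1 * (q.2 * (v 2).1)
      * (q.2 * (v 1).1)) := by
    funext q
    simp only [cubeField_apply, cubeForm_apply hτ, Pi.sub_apply]
  have hw' : ∀ i, w.2 * (v i).1 = -(W * (p.2 * (v i).1)) := fun i => by
    rw [hw, ← hW]; simp only [neg_mul, mul_assoc]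
  rw [heq, h''.fderiv]
  simp [hX, hY, hZ, hw', mul_assoc]
  abel

/-- With ω = B dA this derivative is a multiple of τ(ω⁴). Rotating a word of four 1-forms is an odd
permutation but does not change τ, so the expression equals its own negative. -/
theorem extDeriv_cubeField [FiniteDimensional ℝ 𝔄] [FiniteDimensional ℝ F] {τ : 𝔄 →L[ℝ] F}
    (hτ : ∀ x y, τ (x * y) = τ (y * x)) (p : 𝔄 × 𝔄) (v : Fin 4 → 𝔄 × 𝔄)
    (hv : ∀ i, (v i).2 = -(p.2 * (v i).1 * p.2)) :
    extDeriv (cubeField τ) p v = 0 := by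
  rw [extDeriv_apply_of_contDiff_uncurry (contDiff_cubeField hτ), Fin.sum_univ_four,
    fderiv_cubeField hτ p (v 0) (hv 0) _ rfl rfl rfl rfl,
    fderiv_cubeField hτ p (v 1) (hv 1) _ rfl rfl rfl rfl,
    fderiv_cubeField hτ p (v 2) (hv 2) _ rfl rfl rfl rfl,
    fderiv_cubeField hτ p (v 3) (hv 3) _ rfl rfl rfl rfl]
  simp only [show Fin.removeNth (0 : Fin 4) v 0 = v 1 from rfl,
    show Fin.removeNth (0 : Fin 4) v 1 = v 2 from rfl,
    show Fin.removeNth (0 : Fin 4) v 2 = v 3 from rfl,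
    show Fin.removeNth (1 : Fin 4) v 0 = v 0 from rfl,
    show Fin.removeNth (1 : Fin 4) v 1 = v 2 from rfl,
    show Fin.removeNth (1 : Fin 4) v 2 = v 3 from rfl,
    show Fin.removeNth (2 : Fin 4) v 0 = v 0 from rfl,
    show Fin.removeNth (2 : Fin 4) v 1 = v 1 from rfl,
    show Fin.removeNth (2 : Fin 4) v 2 = v 3 from rfl,
    show Fin.removeNth (3 : Fin 4) v 0 = v 0 from rfl,
    show Fin.removeNth (3 : Fin 4) v 1 = v 1 from rfl,
    show Fin.removeNth (3 : Fin 4) v 2 = v 2 from rfl]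
  generalize p.2 * (v 0).1 = X
  generalize p.2 * (v 1).1 = Y
  generalize p.2 * (v 2).1 = Z
  generalize p.2 * (v 3).1 = W
  -- Rotating each cyclic word until X comes first gives a normal form in which the terms cancel. X
  -- never stands last: it is always either the first entry of the remaining tuple or the inserted
  -- letter, which precedes some factor.
  have r1 : ∀ a b c, τ (a * (X * (b * c))) = τ (X * (b * (c * a))) := fun a b c => by
    rw [hτ]; simp only [mul_assoc]
  have r2 : ∀ a b c, τ (a * (b * (X * c))) = τ (X * (c * (a * b))) := fun a b c => by
    rw [← mul_assoc, hτ]; simp only [mul_assoc]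
  simp only [mul_assoc, r1, r2]
  norm_num
  abel

/-- The variable B stands to the right of dA in the first slot and to the left in the second, so dB
= -B dA B appends -y on the right of the first slot and puts -x in front of the second. After
alternation this yields dy = y² and dx = -x². -/
theorem fderiv_crossField (Q : 𝔄 →L[ℝ] 𝔄 →L[ℝ] F) (p w : (𝔄 × 𝔄) × (𝔄 × 𝔄))
    (hw₁ : w.1.2 = -(p.1.2 * w.1.1 * p.1.2)) (hw₂ : w.2.2 = -(p.2.2 * w.2.1 * p.2.2))
    (v : Fin 2 → (𝔄 × 𝔄) × (𝔄 × 𝔄)) {y x y₀ x₀ y₁ x₁ : 𝔄}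
    (hy : w.1.1 * p.1.2 = y) (hx : p.2.2 * w.2.1 = x)
    (hy₀ : (v 0).1.1 * p.1.2 = y₀) (hx₀ : p.2.2 * (v 0).2.1 = x₀)
    (hy₁ : (v 1).1.1 * p.1.2 = y₁) (hx₁ : p.2.2 * (v 1).2.1 = x₁) :
    fderiv ℝ (fun q => crossField Q q v) p w =
      -Q (y₀ * y) x₁ - Q y₀ (x * x₁) + Q (y₁ * y) x₀ + Q y₁ (x * x₀) := by
  have h1 : ∀ i, HasFDerivAt (fun q : (𝔄 × 𝔄) × (𝔄 × 𝔄) => (v i).1.1 * q.1.2) _ p := fun i =>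
    ((ContinuousLinearMap.mul ℝ 𝔄 (v i).1.1) ∘L ContinuousLinearMap.snd ℝ 𝔄 𝔄 ∘L
      ContinuousLinearMap.fst ℝ (𝔄 × 𝔄) (𝔄 × 𝔄)).hasFDerivAt
  have h2 : ∀ i, HasFDerivAt (fun q : (𝔄 × 𝔄) × (𝔄 × 𝔄) => q.2.2 * (v i).2.1) _ p := fun i =>
    ((ContinuousLinearMap.mul ℝ 𝔄).flip (v i).2.1 ∘L ContinuousLinearMap.snd ℝ 𝔄 𝔄 ∘L
      ContinuousLinearMap.snd ℝ (𝔄 × 𝔄) (𝔄 × 𝔄)).hasFDerivAt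
  have h3 := (Q.hasFDerivAt_of_bilinear (h1 0) (h2 1)).sub
    (Q.hasFDerivAt_of_bilinear (h1 1) (h2 0))
  have heq : (fun q => crossField Q q v) = (fun q : (𝔄 × 𝔄) × (𝔄 × 𝔄) =>
      Q ((v 0).1.1 * q.1.2) (q.2.2 * (v 1).2.1))
      - fun q => Q ((v 1).1.1 * q.1.2) (q.2.2 * (v 0).2.1) := by
    funext q
    simp only [crossField_apply, Pi.sub_apply]
  have e1 : ∀ i, (v i).1.1 * w.1.2 = -((v i).1.1 * p.1.2 * y) := fun i => by
    rw [hw₁, ← hy]; simp only [mul_neg, mul_assoc]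
  have e2 : ∀ i, w.2.2 * (v i).2.1 = -(x * (p.2.2 * (v i).2.1)) := fun i => by
    rw [hw₂, ← hx]; simp only [neg_mul, mul_assoc]
  rw [heq, h3.fderiv]
  simp [e1, e2, hx₀, hx₁, hy₀, hy₁]
  abel

/-- `dQ(y ∧ x)` is the coboundary of the cubic form, for `Q(y, x) = τ(y x) - σ(y, x)`. -/
theorem extDeriv_crossField [FiniteDimensional ℝ 𝔄] [FiniteDimensional ℝ F] {τ : 𝔄 →L[ℝ] F}
    {Q : 𝔄 →L[ℝ] 𝔄 →L[ℝ] F} (hτ : ∀ x y, τ (x * y) = τ (y * x))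
    (hQ₁ : ∀ x y z, Q (x * y - y * x) z = τ ((x * y - y * x) * z))
    (hQ₂ : ∀ x y z, Q z (x * y - y * x) = τ ((x * y - y * x) * z))
    (p : (𝔄 × 𝔄) × (𝔄 × 𝔄)) (v : Fin 3 → (𝔄 × 𝔄) × (𝔄 × 𝔄))
    (hv₁ : ∀ i, (v i).1.2 = -(p.1.2 * (v i).1.1 * p.1.2))
    (hv₂ : ∀ i, (v i).2.2 = -(p.2.2 * (v i).2.1 * p.2.2)) :
    extDeriv (crossField Q) p v =
      cubeForm τ (fun i => (v i).1.1 * p.1.2 + p.2.2 * (v i).2.1)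
      - cubeForm τ (fun i => (v i).1.1 * p.1.2) - cubeForm τ (fun i => p.2.2 * (v i).2.1) := by
  rw [extDeriv_apply_of_contDiff_uncurry (contDiff_crossField Q), Fin.sum_univ_three,
    fderiv_crossField Q p (v 0) (hv₁ 0) (hv₂ 0) _ rfl rfl rfl rfl rfl rfl,
    fderiv_crossField Q p (v 1) (hv₁ 1) (hv₂ 1) _ rfl rfl rfl rfl rfl rfl,
    fderiv_crossField Q p (v 2) (hv₁ 2) (hv₂ 2) _ rfl rfl rfl rfl rfl rfl]
  simp only [cubeForm_apply hτ, show Fin.removeNth (0 : Fin 3) v 0 = v 1 from rfl,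
    show Fin.removeNth (0 : Fin 3) v 1 = v 2 from rfl,
    show Fin.removeNth (1 : Fin 3) v 0 = v 0 from rfl,
    show Fin.removeNth (1 : Fin 3) v 1 = v 2 from rfl,
    show Fin.removeNth (2 : Fin 3) v 0 = v 0 from rfl,
    show Fin.removeNth (2 : Fin 3) v 1 = v 1 from rfl]
  generalize (v 0).1.1 * p.1.2 = y₀
  generalize (v 1).1.1 * p.1.2 = y₁
  generalize (v 2).1.1 * p.1.2 = y₂
  generalize p.2.2 * (v 0).2.1 = x₀
  generalize p.2.2 * (v 1).2.1 = x₁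
  generalize p.2.2 * (v 2).2.1 = x₂
  -- After alternation `Q` has a commutator of two y's or of two x's in one slot, so it can be
  -- replaced by `τ` of the product. What results is the part of τ((y + x)³)/3 that is mixed in y
  -- and x.
  have a1 := hQ₁ y₀ y₁ x₂
  have a2 := hQ₁ y₁ y₂ x₀
  have a3 := hQ₁ y₂ y₀ x₁
  have b1 := hQ₂ x₀ x₁ y₂
  have b2 := hQ₂ x₁ x₂ y₀
  have b3 := hQ₂ x₂ x₀ y₁
  have c₁ : ∀ z a b, τ (a * (z * b)) = τ (z * (b * a)) := fun z a b => by
    rw [hτ, mul_assoc]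
  have c₂ : ∀ z a b, τ (a * (b * z)) = τ (z * (a * b)) := fun z a b => by
    rw [hτ z, mul_assoc]
  simp only [map_sub, sub_mul, sub_apply, mul_assoc] at a1 a2 a3 b1 b2 b3
  simp only [mul_add, add_mul, map_add, mul_assoc, c₁ x₀, c₂ x₀, c₁ y₀, c₂ y₀]
    at a1 a2 a3 b1 b2 b3 ⊢
  rw [sub_eq_iff_eq_add] at a1 a2 a3 b1 b2 b3
  norm_num [a1, a2, a3, b1, b2, b3]
  abel

end AlgebraForms

/-! ### Logarithmic derivatives in matrix form and the Maurer-Cartan forms. -/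

section LogarithmicDerivative

open scoped Matrix.Norms.Operator

variable {𝕜 : Type*} [RCLike 𝕜] {m : ℕ}
  {E : Type*} [NormedAddCommGroup E] [NormedSpace ℝ E]
  {G : Type*} [TopologicalSpace G] [ChartedSpace E G] [Group G]
  {E₁ : Type*} [NormedAddCommGroup E₁] [NormedSpace ℝ E₁]
  {H₁ : Type*} [TopologicalSpace H₁] {I : ModelWithCorners ℝ E₁ H₁}
  {M : Type*} [TopologicalSpace M] [ChartedSpace H₁ M]
  {E₂ : Type*} [NormedAddCommGroup E₂] [NormedSpace ℝ E₂]
  {H₂ : Type*} [TopologicalSpace H₂] {I₂ : ModelWithCorners ℝ E₂ H₂}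
  {N : Type*} [TopologicalSpace N] [ChartedSpace H₂ N]

variable (𝕜 m) in
/-- The algebra of `m × m` matrices, as a real normed algebra. -/
def MatAlg : Type _ := Matrix (Fin m) (Fin m) 𝕜

instance : NormedRing (MatAlg 𝕜 m) :=
  inferInstanceAs (NormedRing (Matrix (Fin m) (Fin m) 𝕜))

instance : NormedAlgebra ℝ (MatAlg 𝕜 m) :=
  inferInstanceAs (NormedAlgebra ℝ (Matrix (Fin m) (Fin m) 𝕜))

instance : FiniteDimensional ℝ (MatAlg 𝕜 m) :=
  inferInstanceAs (FiniteDimensional ℝ (Matrix (Fin m) (Fin m) 𝕜))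

variable (𝕜 m) in
/-- The identification of arrays with matrices. -/
def arrEquiv : Arr 𝕜 m ≃ₗ[ℝ] MatAlg 𝕜 m :=
  (Matrix.ofLinearEquiv ℝ : (Fin m → Fin m → 𝕜) ≃ₗ[ℝ] Matrix (Fin m) (Fin m) 𝕜)

variable (𝕜 m) in
/-- The identification of arrays with matrices, as a continuous linear map. -/
def ofArr : Arr 𝕜 m →L[ℝ] MatAlg 𝕜 m :=
  LinearMap.toContinuousLinearMap (arrEquiv 𝕜 m).toLinearMap

variable (𝕜 m) in
/-- The inverse of `ofArr`. -/
def toArrL : MatAlg 𝕜 m →L[ℝ] Arr 𝕜 m :=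
  LinearMap.toContinuousLinearMap (arrEquiv 𝕜 m).symm.toLinearMap

theorem ofArr_toArrL (A : MatAlg 𝕜 m) : ofArr 𝕜 m (toArrL 𝕜 m A) = A := rfl

theorem ofArr_injective : Function.Injective (ofArr 𝕜 m) := (arrEquiv 𝕜 m).injective

variable (𝕜 m) in
/-- The trace, as a real linear map on the algebra of matrices. -/
def trL : MatAlg 𝕜 m →L[ℝ] 𝕜 :=
  LinearMap.toContinuousLinearMap (Matrix.traceLinearMap (Fin m) ℝ 𝕜)

theorem trL_mul_comm (A B : MatAlg 𝕜 m) : trL 𝕜 m (A * B) = trL 𝕜 m (B * A) :=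
  Matrix.trace_mul_comm (A : Matrix (Fin m) (Fin m) 𝕜) B

/-- `ρ`, as a map into the algebra of matrices. -/
def toMat (ρ : G →* GL (Fin m) 𝕜) (g : G) : MatAlg 𝕜 m := (ρ g).val

omit [TopologicalSpace G] in
theorem toMat_mul (ρ : G →* GL (Fin m) 𝕜) (g h : G) : toMat ρ (g * h) = toMat ρ g * toMat ρ h := by
  rw [toMat, map_mul]
  rfl

omit [TopologicalSpace G] in
theorem toMat_one (ρ : G →* GL (Fin m) 𝕜) : toMat ρ 1 = 1 := by
  rw [toMat, map_one]
  rfl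

omit [TopologicalSpace G] in
theorem toMat_mul_inv (ρ : G →* GL (Fin m) 𝕜) (g : G) : toMat ρ g * toMat ρ g⁻¹ = 1 := by
  rw [← toMat_mul, mul_inv_cancel, toMat_one]

omit [TopologicalSpace G] in
theorem toMat_inv_mul (ρ : G →* GL (Fin m) 𝕜) (g : G) : toMat ρ g⁻¹ * toMat ρ g = 1 := by
  rw [← toMat_mul, inv_mul_cancel, toMat_one]

theorem contMDiff_toMat {ρ : G →* GL (Fin m) 𝕜} (hρ : IsLieSubgroup E ρ) :
    ContMDiff 𝓘(ℝ, E) 𝓘(ℝ, MatAlg 𝕜 m) ∞ (toMat ρ) :=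
  (ofArr 𝕜 m).contMDiff.comp hρ.smooth

variable (I) in
/-- The derivative of `ρ ∘ h`. -/
def matD (ρ : G →* GL (Fin m) 𝕜) (h : M → G) (x : M) :
    TangentSpace I x →L[ℝ] MatAlg 𝕜 m :=
  mfderiv I 𝓘(ℝ, MatAlg 𝕜 m) (fun y => toMat ρ (h y)) x

variable (I) in
/-- The left logarithmic derivative of `ρ ∘ h`. -/
def lmc (ρ : G →* GL (Fin m) 𝕜) (h : M → G) (x : M) (v : TangentSpace I x) :
    MatAlg 𝕜 m := toMat ρ (h x)⁻¹ * matD I ρ h x v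

variable (I) in
/-- The right logarithmic derivative of `ρ ∘ h`. -/
def rmc (ρ : G →* GL (Fin m) 𝕜) (h : M → G) (x : M) (v : TangentSpace I x) :
    MatAlg 𝕜 m := matD I ρ h x v * toMat ρ (h x)⁻¹

omit [TopologicalSpace G] in
theorem rmc_eq (ρ : G →* GL (Fin m) 𝕜) (h : M → G) (x : M) (v : TangentSpace I x) :
    rmc I ρ h x v = toMat ρ (h x) * lmc I ρ h x v * toMat ρ (h x)⁻¹ := by
  rw [rmc, lmc, ← mul_assoc, toMat_mul_inv, one_mul]

omit [TopologicalSpace G] in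
theorem lmc_eq (ρ : G →* GL (Fin m) 𝕜) (h : M → G) (x : M) (v : TangentSpace I x) :
    lmc I ρ h x v = toMat ρ (h x)⁻¹ * rmc I ρ h x v * toMat ρ (h x) := by
  rw [rmc, lmc, mul_assoc, mul_assoc, toMat_inv_mul, mul_one]

variable {ρ : G →* GL (Fin m) 𝕜} (hρ : IsLieSubgroup E ρ)
include hρ

theorem hasMFDerivAt_toMat_comp {h : M → G} (hh : ContMDiff I 𝓘(ℝ, E) ∞ h) (x : M) :
    HasMFDerivAt I 𝓘(ℝ, MatAlg 𝕜 m) (fun y => toMat ρ (h y)) x (matD I ρ h x) :=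
  (((contMDiff_toMat hρ).comp hh).mdifferentiable (by simp) x).hasMFDerivAt

theorem matD_comp {h : M → G} (hh : ContMDiff I 𝓘(ℝ, E) ∞ h) {φ : N → M}
    (hφ : ContMDiff I₂ I ∞ φ) (x : N) (v : TangentSpace I₂ x) :
    matD I₂ ρ (fun y => h (φ y)) x v = matD I ρ h (φ x) (mfderiv I₂ I φ x v) := by
  have := mfderiv_comp x (((contMDiff_toMat hρ).comp hh).mdifferentiable (by simp) (φ x))
    (hφ.mdifferentiable (by simp) x)
  exact DFunLike.congr_fun this v

theorem lmc_comp {h : M → G} (hh : ContMDiff I 𝓘(ℝ, E) ∞ h) {φ : N → M}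
    (hφ : ContMDiff I₂ I ∞ φ) (x : N) (v : TangentSpace I₂ x) :
    lmc I₂ ρ (fun y => h (φ y)) x v = lmc I ρ h (φ x) (mfderiv I₂ I φ x v) := by
  rw [lmc, lmc, matD_comp hρ hh hφ]

theorem rmc_comp {h : M → G} (hh : ContMDiff I 𝓘(ℝ, E) ∞ h) {φ : N → M}
    (hφ : ContMDiff I₂ I ∞ φ) (x : N) (v : TangentSpace I₂ x) :
    rmc I₂ ρ (fun y => h (φ y)) x v = rmc I ρ h (φ x) (mfderiv I₂ I φ x v) := by
  rw [rmc, rmc, matD_comp hρ hh hφ]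

theorem matD_mul {h k : M → G} (hh : ContMDiff I 𝓘(ℝ, E) ∞ h) (hk : ContMDiff I 𝓘(ℝ, E) ∞ k)
    (x : M) (v : TangentSpace I x) :
    matD I ρ (fun y => h y * k y) x v
      = toMat ρ (h x) * matD I ρ k x v + matD I ρ h x v * toMat ρ (k x) := by
  have h1 := (hasMFDerivAt_toMat_comp hρ hh x).mul' (hasMFDerivAt_toMat_comp hρ hk x)
  have h2 : (fun y => toMat ρ (h y * k y)) =
      (fun y => toMat ρ (h y)) * fun y => toMat ρ (k y) := funext fun y => toMat_mul ρ _ _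
  rw [matD, h2, h1.mfderiv]
  rfl

/-- The Leibniz rule multiplied by (hk)⁻¹ on the left. Together with `rmc_mul` it governs the inner
face maps and the projection γ. -/
theorem lmc_mul {h k : M → G} (hh : ContMDiff I 𝓘(ℝ, E) ∞ h) (hk : ContMDiff I 𝓘(ℝ, E) ∞ k)
    (x : M) (v : TangentSpace I x) :
    lmc I ρ (fun y => h y * k y) x v
      = lmc I ρ k x v + toMat ρ (k x)⁻¹ * lmc I ρ h x v * toMat ρ (k x) := by
  rw [lmc, matD_mul hρ hh hk, mul_inv_rev, toMat_mul, mul_add, lmc, lmc]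
  congr 1
  · rw [mul_assoc, ← mul_assoc (toMat ρ (h x)⁻¹), toMat_inv_mul, one_mul]
  · simp only [mul_assoc]

theorem rmc_mul {h k : M → G} (hh : ContMDiff I 𝓘(ℝ, E) ∞ h) (hk : ContMDiff I 𝓘(ℝ, E) ∞ k)
    (x : M) (v : TangentSpace I x) :
    rmc I ρ (fun y => h y * k y) x v
      = rmc I ρ h x v + toMat ρ (h x) * rmc I ρ k x v * toMat ρ (h x)⁻¹ := by
  rw [rmc, matD_mul hρ hh hk, mul_inv_rev, toMat_mul, add_mul, rmc, rmc, add_comm]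
  congr 1
  · rw [mul_assoc, ← mul_assoc (toMat ρ (k x)), toMat_mul_inv, one_mul]
  · simp only [mul_assoc]

omit [TopologicalSpace G] hρ in
theorem matD_const (g : G) (x : M) (v : TangentSpace I x) :
    matD I ρ (fun _ => g) x v = 0 := by
  rw [matD, mfderiv_const]
  rfl

variable [LieGroup 𝓘(ℝ, E) ∞ G]

/-- Obtained by differentiating h·h⁻¹ = 1; this is the relation dB = -B dA B required by the model
forms. -/
theorem matD_inv {h : M → G} (hh : ContMDiff I 𝓘(ℝ, E) ∞ h) (x : M) (v : TangentSpace I x) :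
    matD I ρ (fun y => (h y)⁻¹) x v
      = -(toMat ρ (h x)⁻¹ * matD I ρ h x v * toMat ρ (h x)⁻¹) := by
  have h1 := matD_mul hρ hh (ContMDiff.inv hh) x v
  have h2 : (fun y => h y * (h y)⁻¹) = fun _ => (1 : G) := funext fun y => mul_inv_cancel _
  rw [h2, matD_const] at h1
  have h3 := congrArg (fun A => toMat ρ (h x)⁻¹ * A) h1
  simp only [mul_zero, mul_add, ← mul_assoc, toMat_inv_mul, one_mul] at h3
  exact eq_neg_of_add_eq_zero_left h3.symm

theorem lmc_inv {h : M → G} (hh : ContMDiff I 𝓘(ℝ, E) ∞ h) (x : M) (v : TangentSpace I x) :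
    lmc I ρ (fun y => (h y)⁻¹) x v = -rmc I ρ h x v := by
  rw [lmc, rmc, matD_inv hρ hh, inv_inv, mul_neg, ← mul_assoc, ← mul_assoc, toMat_mul_inv, one_mul]

theorem rmc_inv {h : M → G} (hh : ContMDiff I 𝓘(ℝ, E) ∞ h) (x : M) (v : TangentSpace I x) :
    rmc I ρ (fun y => (h y)⁻¹) x v = -lmc I ρ h x v := by
  rw [lmc, rmc, matD_inv hρ hh, inv_inv, neg_mul, mul_assoc, toMat_inv_mul, mul_one]

omit [LieGroup 𝓘(ℝ, E) ∞ G] in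
theorem of_lieToArr (w : E) : ofArr 𝕜 m (lieToArr (E := E) ρ w)
    = matD 𝓘(ℝ, E) ρ (fun g : G => g) 1 w := by
  have h := mfderiv_comp (1 : G) (I' := 𝓘(ℝ, Arr 𝕜 m))
    ((ofArr 𝕜 m).mdifferentiableAt) (hρ.smooth.mdifferentiable (by simp) 1)
  have h' := (ofArr 𝕜 m).mfderiv_eq (x := toArr ρ 1)
  refine Eq.trans ?_ (DFunLike.congr_fun h w).symm
  exact (DFunLike.congr_fun h' _).symm

/-- Since ρ(g⁻¹h) = ρ(g)⁻¹ρ(h) with a constant left factor, translating a tangent vector to the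
identity inside `G` amounts to multiplying its matrix by ρ(g)⁻¹. -/
theorem of_lieToArr_mfderiv_mul_left (g : G) (w : TangentSpace 𝓘(ℝ, E) g) :
    ofArr 𝕜 m (lieToArr (E := E) ρ (mfderiv 𝓘(ℝ, E) 𝓘(ℝ, E) (fun h : G => g⁻¹ * h) g w))
      = lmc 𝓘(ℝ, E) ρ (fun h : G => h) g w := by
  have h1 := matD_comp hρ (contMDiff_id (I := 𝓘(ℝ, E)) (M := G))
    (contMDiff_mul_left (I := 𝓘(ℝ, E)) (n := ∞) (a := g⁻¹)) g w
  have h2 := matD_mul hρ (contMDiff_const (c := g⁻¹) (I := 𝓘(ℝ, E)) (I' := 𝓘(ℝ, E)) (M := G))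
    (contMDiff_id (I := 𝓘(ℝ, E)) (M := G)) g w
  -- The translated vector sits at g⁻¹ * g, which equals 1 only propositionally. As every tangent
  -- space is `E`, the base point can be replaced.
  have h3 : ∀ g' : G, g' = 1 → ∀ w : E, matD 𝓘(ℝ, E) ρ (fun g : G => g) g' w
    = matD 𝓘(ℝ, E) ρ (fun g : G => g) 1 w := by rintro _ rfl _; rfl
  refine (of_lieToArr hρ _).trans ((h3 (g⁻¹ * g) (inv_mul_cancel g) _).symm.trans ?_)
  refine h1.symm.trans (h2.trans ?_)
  rw [matD_const, zero_mul, add_zero]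
  rfl

theorem of_lieToArr_mfderiv_mul_right (g : G) (w : TangentSpace 𝓘(ℝ, E) g) :
    ofArr 𝕜 m (lieToArr (E := E) ρ (mfderiv 𝓘(ℝ, E) 𝓘(ℝ, E) (fun h : G => h * g⁻¹) g w))
      = rmc 𝓘(ℝ, E) ρ (fun h : G => h) g w := by
  have h1 := matD_comp hρ (contMDiff_id (I := 𝓘(ℝ, E)) (M := G))
    (contMDiff_mul_right (I := 𝓘(ℝ, E)) (n := ∞) (a := g⁻¹)) g w
  have h2 := matD_mul hρ (contMDiff_id (I := 𝓘(ℝ, E)) (M := G))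
    (contMDiff_const (c := g⁻¹) (I := 𝓘(ℝ, E)) (I' := 𝓘(ℝ, E)) (M := G)) g w
  have h3 : ∀ g' : G, g' = 1 → ∀ w : E, matD 𝓘(ℝ, E) ρ (fun g : G => g) g' w
    = matD 𝓘(ℝ, E) ρ (fun g : G => g) 1 w := by rintro _ rfl _; rfl
  refine (of_lieToArr hρ _).trans ((h3 (g * g⁻¹) (mul_inv_cancel g) _).symm.trans ?_)
  refine h1.symm.trans (h2.trans ?_)
  rw [matD_const, mul_zero, zero_add]
  rfl

theorem of_pullback_leftMC {h : M → G} (hh : ContMDiff I 𝓘(ℝ, E) ∞ h) (x : M)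
    (v : Fin 1 → TangentSpace I x) :
    ofArr 𝕜 m (pullback I 𝓘(ℝ, E) h (leftMC E ρ) x v) = lmc I ρ h x (v 0) :=
  (of_lieToArr_mfderiv_mul_left hρ _ _).trans
    (lmc_comp hρ (contMDiff_id (I := 𝓘(ℝ, E)) (M := G)) hh x (v 0)).symm

theorem of_pullback_rightMC {h : M → G} (hh : ContMDiff I 𝓘(ℝ, E) ∞ h) (x : M)
    (v : Fin 1 → TangentSpace I x) :
    ofArr 𝕜 m (pullback I 𝓘(ℝ, E) h (rightMC E ρ) x v) = rmc I ρ h x (v 0) :=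
  (of_lieToArr_mfderiv_mul_right hρ _ _).trans
    (rmc_comp hρ (contMDiff_id (I := 𝓘(ℝ, E)) (M := G)) hh x (v 0)).symm

/-- By the inversion rule, g·d(g⁻¹) = -dg·g⁻¹. -/
theorem leftMCInv_eq : leftMCInv E ρ = -rightMC E ρ := by
  funext g
  refine ContinuousAlternatingMap.ext fun v => ofArr_injective ?_
  have h1 := of_pullback_leftMC hρ (contMDiff_inv 𝓘(ℝ, E) ∞ (G := G)) g v
  refine (h1.trans (lmc_inv hρ (h := fun g => g) contMDiff_id g (v 0))).trans ?_
  have h2 := of_lieToArr_mfderiv_mul_right hρ g (v 0)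
  exact (congrArg Neg.neg h2).symm

end LogarithmicDerivative

/-! ### Pullbacks of the model forms along pairs (g, g⁻¹). -/

section Evaluation

variable {𝕜 : Type*} [RCLike 𝕜] {m : ℕ}
  {E : Type*} [NormedAddCommGroup E] [NormedSpace ℝ E]
  {G : Type*} [TopologicalSpace G] [ChartedSpace E G] [Group G] [LieGroup 𝓘(ℝ, E) ∞ G]
  {E₁ : Type*} [NormedAddCommGroup E₁] [NormedSpace ℝ E₁]
  {H₁ : Type*} [TopologicalSpace H₁] {I : ModelWithCorners ℝ E₁ H₁}
  {M : Type*} [TopologicalSpace M] [ChartedSpace H₁ M]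
  {V : Type*} [NormedAddCommGroup V] [NormedSpace ℝ V]
  {W : Type*} [NormedAddCommGroup W] [NormedSpace ℝ W]
  {F : Type*} [NormedAddCommGroup F] [NormedSpace ℝ F]

theorem clm_mfderiv {f : M → V} (hf : ContMDiff I 𝓘(ℝ, V) ∞ f) (L : V →L[ℝ] W) (x : M)
    (v : TangentSpace I x) :
    L (mfderiv I 𝓘(ℝ, V) f x v) = mfderiv I 𝓘(ℝ, W) (fun y => L (f y)) x v := by
  have h := mfderiv_comp x (I' := 𝓘(ℝ, V)) (L.mdifferentiableAt) (hf.mdifferentiable (by simp) x)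
  have h' := L.mfderiv_eq (x := f x)
  refine Eq.trans ?_ (DFunLike.congr_fun h v).symm
  exact (DFunLike.congr_fun h' _).symm

/-- The pair `(ρ(g), ρ(g)⁻¹)`. -/
def toPair (ρ : G →* GL (Fin m) 𝕜) (g : G) : MatAlg 𝕜 m × MatAlg 𝕜 m := (toMat ρ g, toMat ρ g⁻¹)

variable {ρ : G →* GL (Fin m) 𝕜} (hρ : IsLieSubgroup E ρ)
include hρ

theorem contMDiff_toPair {h : M → G} (hh : ContMDiff I 𝓘(ℝ, E) ∞ h) :
    ContMDiff I 𝓘(ℝ, MatAlg 𝕜 m × MatAlg 𝕜 m) ∞ fun x => toPair ρ (h x) :=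
  ((contMDiff_toMat hρ).comp hh).prodMk_space
    ((contMDiff_toMat hρ).comp ((contMDiff_inv 𝓘(ℝ, E) ∞).comp hh))

theorem contMDiff_toPair_prod {h k : M → G} (hh : ContMDiff I 𝓘(ℝ, E) ∞ h)
    (hk : ContMDiff I 𝓘(ℝ, E) ∞ k) :
    ContMDiff I 𝓘(ℝ, (MatAlg 𝕜 m × MatAlg 𝕜 m) × (MatAlg 𝕜 m × MatAlg 𝕜 m)) ∞
      fun x => (toPair ρ (h x), toPair ρ (k x)) :=
  (contMDiff_toPair hρ hh).prodMk_space (contMDiff_toPair hρ hk)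

/-- The second component has the shape -B dA B, which is the tangency condition in the derivative
formulas for the model forms. -/
theorem mfderiv_toPair {h : M → G} (hh : ContMDiff I 𝓘(ℝ, E) ∞ h) (x : M)
    (v : TangentSpace I x) :
    mfderiv I 𝓘(ℝ, MatAlg 𝕜 m × MatAlg 𝕜 m) (fun x => toPair ρ (h x)) x v
      = (matD I ρ h x v, -(toMat ρ (h x)⁻¹ * matD I ρ h x v * toMat ρ (h x)⁻¹)) := by
  refine Prod.ext ?_ ?_
  · exact clm_mfderiv (contMDiff_toPair hρ hh) (ContinuousLinearMap.fst ℝ _ _) x v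
  · rw [← matD_inv hρ hh]
    exact clm_mfderiv (contMDiff_toPair hρ hh) (ContinuousLinearMap.snd ℝ _ _) x v

theorem mfderiv_toPair_prod {h k : M → G} (hh : ContMDiff I 𝓘(ℝ, E) ∞ h)
    (hk : ContMDiff I 𝓘(ℝ, E) ∞ k) (x : M) (v : TangentSpace I x) :
    mfderiv I 𝓘(ℝ, (MatAlg 𝕜 m × MatAlg 𝕜 m) × (MatAlg 𝕜 m × MatAlg 𝕜 m))
      (fun x => (toPair ρ (h x), toPair ρ (k x))) x v
      = ((matD I ρ h x v, -(toMat ρ (h x)⁻¹ * matD I ρ h x v * toMat ρ (h x)⁻¹)),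
        (matD I ρ k x v, -(toMat ρ (k x)⁻¹ * matD I ρ k x v * toMat ρ (k x)⁻¹))) := by
  refine Prod.ext ?_ ?_
  · rw [← mfderiv_toPair hρ hh]
    exact clm_mfderiv (contMDiff_toPair_prod hρ hh hk) (ContinuousLinearMap.fst ℝ _ _) x v
  · rw [← mfderiv_toPair hρ hk]
    exact clm_mfderiv (contMDiff_toPair_prod hρ hh hk) (ContinuousLinearMap.snd ℝ _ _) x v

theorem pullback_cubeField (τ : MatAlg 𝕜 m →L[ℝ] F) {h : M → G}
    (hh : ContMDiff I 𝓘(ℝ, E) ∞ h) (x : M) (v : Fin 3 → TangentSpace I x) :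
    pullback I 𝓘(ℝ, MatAlg 𝕜 m × MatAlg 𝕜 m) (fun x => toPair ρ (h x)) (cubeField τ) x v
      = cubeForm τ fun i => lmc I ρ h x (v i) := by
  refine (cubeField_apply τ _ _).trans ?_
  congr 1
  funext i
  exact congrArg (fun w : MatAlg 𝕜 m × MatAlg 𝕜 m => toMat ρ (h x)⁻¹ * w.1)
    (mfderiv_toPair hρ hh x (v i))

theorem pullback_crossField (Q : MatAlg 𝕜 m →L[ℝ] MatAlg 𝕜 m →L[ℝ] F) {h k : M → G}
    (hh : ContMDiff I 𝓘(ℝ, E) ∞ h) (hk : ContMDiff I 𝓘(ℝ, E) ∞ k) (x : M)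
    (v : Fin 2 → TangentSpace I x) :
    pullback I 𝓘(ℝ, (MatAlg 𝕜 m × MatAlg 𝕜 m) × (MatAlg 𝕜 m × MatAlg 𝕜 m))
      (fun x => (toPair ρ (h x), toPair ρ (k x))) (crossField Q) x v
      = Q (rmc I ρ h x (v 0)) (lmc I ρ k x (v 1)) - Q (rmc I ρ h x (v 1)) (lmc I ρ k x (v 0)) := by
  refine (crossField_apply Q _ _).trans ?_
  have := mfderiv_toPair_prod hρ hh hk x
  have h1 := congrArg (fun w : (MatAlg 𝕜 m × MatAlg 𝕜 m) × (MatAlg 𝕜 m × MatAlg 𝕜 m) =>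
    w.1.1 * toMat ρ (h x)⁻¹) (this (v 0))
  have h2 := congrArg (fun w : (MatAlg 𝕜 m × MatAlg 𝕜 m) × (MatAlg 𝕜 m × MatAlg 𝕜 m) =>
    w.1.1 * toMat ρ (h x)⁻¹) (this (v 1))
  have h3 := congrArg (fun w : (MatAlg 𝕜 m × MatAlg 𝕜 m) × (MatAlg 𝕜 m × MatAlg 𝕜 m) =>
    toMat ρ (k x)⁻¹ * w.2.1) (this (v 0))
  have h4 := congrArg (fun w : (MatAlg 𝕜 m × MatAlg 𝕜 m) × (MatAlg 𝕜 m × MatAlg 𝕜 m) =>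
    toMat ρ (k x)⁻¹ * w.2.1) (this (v 1))
  exact congrArg₂ (· - ·) (congrArg₂ (fun a b => Q a b) h1 h4)
    (congrArg₂ (fun a b => Q a b) h2 h3)

theorem pullback_extDeriv_cubeField [FiniteDimensional ℝ F] {τ : MatAlg 𝕜 m →L[ℝ] F}
    (hτ : ∀ x y, τ (x * y) = τ (y * x)) {h : M → G} (hh : ContMDiff I 𝓘(ℝ, E) ∞ h) :
    pullback I 𝓘(ℝ, MatAlg 𝕜 m × MatAlg 𝕜 m) (fun x => toPair ρ (h x))
      (extDeriv (cubeField τ)) = 0 := by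
  funext x
  refine ContinuousAlternatingMap.ext fun v => ?_
  refine extDeriv_cubeField hτ _ _ fun i => ?_
  have := mfderiv_toPair hρ hh x (v i)
  exact (congrArg Prod.snd this).trans (congrArg (fun w : MatAlg 𝕜 m × MatAlg 𝕜 m =>
    -(toMat ρ (h x)⁻¹ * w.1 * toMat ρ (h x)⁻¹)) this).symm

theorem pullback_extDeriv_crossField [FiniteDimensional ℝ F] {τ : MatAlg 𝕜 m →L[ℝ] F}
    {Q : MatAlg 𝕜 m →L[ℝ] MatAlg 𝕜 m →L[ℝ] F} (hτ : ∀ x y, τ (x * y) = τ (y * x))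
    (hQ₁ : ∀ x y z, Q (x * y - y * x) z = τ ((x * y - y * x) * z))
    (hQ₂ : ∀ x y z, Q z (x * y - y * x) = τ ((x * y - y * x) * z)) {h k : M → G}
    (hh : ContMDiff I 𝓘(ℝ, E) ∞ h) (hk : ContMDiff I 𝓘(ℝ, E) ∞ k) (x : M)
    (v : Fin 3 → TangentSpace I x) :
    pullback I 𝓘(ℝ, (MatAlg 𝕜 m × MatAlg 𝕜 m) × (MatAlg 𝕜 m × MatAlg 𝕜 m))
      (fun x => (toPair ρ (h x), toPair ρ (k x))) (extDeriv (crossField Q)) x v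
      = cubeForm τ (fun i => rmc I ρ h x (v i) + lmc I ρ k x (v i))
        - cubeForm τ (fun i => rmc I ρ h x (v i)) - cubeForm τ (fun i => lmc I ρ k x (v i)) := by
  have hd := fun i => mfderiv_toPair_prod hρ hh hk x (v i)
  have h1 : ∀ i, _ = rmc I ρ h x (v i) := fun i =>
    congrArg (fun w : (MatAlg 𝕜 m × MatAlg 𝕜 m) × (MatAlg 𝕜 m × MatAlg 𝕜 m) =>
    w.1.1 * toMat ρ (h x)⁻¹) (hd i)
  have h2 : ∀ i, _ = lmc I ρ k x (v i) := fun i =>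
    congrArg (fun w : (MatAlg 𝕜 m × MatAlg 𝕜 m) × (MatAlg 𝕜 m × MatAlg 𝕜 m) =>
    toMat ρ (k x)⁻¹ * w.2.1) (hd i)
  simp only [← h1, ← h2]
  refine extDeriv_crossField hτ hQ₁ hQ₂ _ _ (fun i => ?_) (fun i => ?_)
  · exact (congrArg (fun w => w.1.2) (hd i)).trans
      (congrArg (fun w : (MatAlg 𝕜 m × MatAlg 𝕜 m) × (MatAlg 𝕜 m × MatAlg 𝕜 m) =>
      -(toMat ρ (h x)⁻¹ * w.1.1 * toMat ρ (h x)⁻¹)) (hd i)).symm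
  · exact (congrArg (fun w => w.2.2) (hd i)).trans
      (congrArg (fun w : (MatAlg 𝕜 m × MatAlg 𝕜 m) × (MatAlg 𝕜 m × MatAlg 𝕜 m) =>
      -(toMat ρ (k x)⁻¹ * w.2.1 * toMat ρ (k x)⁻¹)) (hd i)).symm

end Evaluation

/-! ### Smoothness of the simplicial maps, and a section of γ. -/

section SimplicialMaps

variable {E : Type*} [NormedAddCommGroup E] [NormedSpace ℝ E]
  {G : Type*} [TopologicalSpace G] [ChartedSpace E G] [Group G] [LieGroup 𝓘(ℝ, E) ∞ G]

theorem contMDiff_face {n : ℕ} (i : Fin (n + 2)) :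
    ContMDiff (powModel E (n + 1)) (powModel E n) ∞ (face (G := G) i) := by
  refine contMDiff_pow_iff.2 fun j => ?_
  unfold face
  split_ifs
  · exact contMDiff_pow_apply _
  · exact (contMDiff_pow_apply _).mul (contMDiff_pow_apply _)
  · exact contMDiff_pow_apply _

omit [LieGroup 𝓘(ℝ, E) ∞ G] in
theorem contMDiff_degen {n : ℕ} (i : Fin (n + 1)) :
    ContMDiff (powModel E n) (powModel E (n + 1)) ∞ (degen (G := G) i) := by
  refine contMDiff_pow_iff.2 fun j => ?_
  obtain rfl | ⟨k, rfl⟩ := i.eq_self_or_eq_succAbove j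
  · simpa only [degen, Fin.insertNth_apply_same] using contMDiff_const
  · simpa only [degen, Fin.insertNth_apply_succAbove] using contMDiff_pow_apply k

theorem contMDiff_proj {n : ℕ} :
    ContMDiff (powModel E (n + 1)) (powModel E n) ∞ (proj (G := G) (n := n)) := by
  refine contMDiff_pow_iff.2 fun j => ?_
  exact (contMDiff_pow_apply _).mul ((contMDiff_inv 𝓘(ℝ, E) ∞).comp (contMDiff_pow_apply _))

/-- A section of `γ : EG_n → BG_n`. -/
def projSection {n : ℕ} (g : Fin n → G) (j : Fin (n + 1)) : G :=
  Fin.induction 1 (fun j a => g j * a) j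

omit [TopologicalSpace G] in
theorem proj_projSection {n : ℕ} (g : Fin n → G) : proj (projSection g) = g := by
  funext j
  simp [proj, projSection]

theorem contMDiff_projSection {n : ℕ} :
    ContMDiff (powModel E n) (powModel E (n + 1)) ∞ (projSection (G := G) (n := n)) := by
  refine contMDiff_pow_iff.2 fun j => ?_
  induction j using Fin.induction with
  | zero => exact contMDiff_const
  | succ j ih => exact (contMDiff_pow_apply j).mul ih

/-- Pulling back further along the smooth section `projSection` recovers the form. This gives
uniqueness of the Pontryagin class, even of its defining cocycle. -/
theorem pullback_proj_injective {F : Type*} [NormedAddCommGroup F] [NormedSpace ℝ F] {n k : ℕ}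
    {θ η : AltField (powModel E n) (Fin n → G) k F}
    (h : pullback (powModel E (n + 1)) (powModel E n) proj θ
      = pullback (powModel E (n + 1)) (powModel E n) proj η) : θ = η := by
  have h1 := congrArg (pullback (powModel E n) (powModel E (n + 1)) projSection) h
  have h2 : proj ∘ projSection = (id : (Fin n → G) → _) := funext fun g => proj_projSection g
  rw [pullback_pullback (contMDiff_proj.mdifferentiable (by simp))
    (contMDiff_projSection.mdifferentiable (by simp)),
    pullback_pullback (contMDiff_proj.mdifferentiable (by simp))
    (contMDiff_projSection.mdifferentiable (by simp)), h2] at h1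
  funext x
  have h3 := congrFun h1 x
  refine ContinuousAlternatingMap.ext fun v => ?_
  have h4 := DFunLike.congr_fun h3 v
  simp only [pullback, mfderiv_id] at h4
  exact h4

end SimplicialMaps

/-! ### The explicit cochain and the cocycle identity. -/

section Cocycle

variable {𝕜 : Type*} [RCLike 𝕜] {m : ℕ}
  {E : Type*} [NormedAddCommGroup E] [NormedSpace ℝ E]
  {G : Type*} [TopologicalSpace G] [ChartedSpace E G] [Group G]
  {F : Type*} [NormedAddCommGroup F] [NormedSpace ℝ F]

theorem cubeForm_conj {𝔄 : Type*} [NormedRing 𝔄] [NormedAlgebra ℝ 𝔄] {τ : 𝔄 →L[ℝ] F}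
    (hτ : ∀ x y, τ (x * y) = τ (y * x)) {a b : 𝔄} (hab : b * a = 1) (X : Fin 3 → 𝔄) :
    cubeForm τ (fun i => a * X i * b) = cubeForm τ X := by
  have h : ∀ x y z, τ (a * x * b * (a * y * b) * (a * z * b)) = τ (x * y * z) := by
    intro x y z
    have : a * x * b * (a * y * b) * (a * z * b) = a * (x * (b * a) * y * (b * a) * z) * b := by
      noncomm_ring
    rw [this, hab, mul_one, mul_one, hτ, ← mul_assoc, hab, one_mul]
  rw [cubeForm_apply hτ, cubeForm_apply hτ, h, h]

/-- The functional `A ↦ π(tr(A) / 8π²)`. -/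
def chernTrace (𝕜 : Type*) [RCLike 𝕜] (m : ℕ) (π : 𝕜 →L[ℝ] F) : MatAlg 𝕜 m →L[ℝ] F :=
  (1 / (8 * Real.pi ^ 2) : ℝ) • π ∘L trL 𝕜 m

/-- The bilinear form `(A, B) ↦ π((tr(A B) - tr(A) tr(B)) / 8π²)`. -/
def chernPairing (𝕜 : Type*) [RCLike 𝕜] (m : ℕ) (π : 𝕜 →L[ℝ] F) :
    MatAlg 𝕜 m →L[ℝ] MatAlg 𝕜 m →L[ℝ] F :=
  (ContinuousLinearMap.compL ℝ _ _ _ (chernTrace 𝕜 m π)).comp (ContinuousLinearMap.mul ℝ _)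
    - (1 / (8 * Real.pi ^ 2) : ℝ) •
      (ContinuousLinearMap.compL ℝ _ _ _ π).comp
        ((ContinuousLinearMap.mul ℝ 𝕜).bilinearComp (trL 𝕜 m) (trL 𝕜 m))

variable (π : 𝕜 →L[ℝ] F)

theorem chernTrace_apply (A : MatAlg 𝕜 m) :
    chernTrace 𝕜 m π A = (1 / (8 * Real.pi ^ 2) : ℝ) • π (trL 𝕜 m A) := rfl

theorem chernPairing_apply (A B : MatAlg 𝕜 m) :
    chernPairing 𝕜 m π A B = (1 / (8 * Real.pi ^ 2) : ℝ) • π (trL 𝕜 m (A * B))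
      - (1 / (8 * Real.pi ^ 2) : ℝ) • π (trL 𝕜 m A * trL 𝕜 m B) := rfl

theorem chernTrace_mul_comm (A B : MatAlg 𝕜 m) :
    chernTrace 𝕜 m π (A * B) = chernTrace 𝕜 m π (B * A) := by
  rw [chernTrace_apply, chernTrace_apply, trL_mul_comm]

/-- A commutator has trace zero, so the product of traces drops out. Together with the right-hand
version it supplies the hypotheses on `Q` in `extDeriv_crossField`. -/
theorem chernPairing_commutator_left (A B C : MatAlg 𝕜 m) :
    chernPairing 𝕜 m π (A * B - B * A) C = chernTrace 𝕜 m π ((A * B - B * A) * C) := by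
  rw [chernPairing_apply, chernTrace_apply, map_sub (trL 𝕜 m) (A * B), trL_mul_comm A B, sub_self,
    zero_mul, map_zero, smul_zero, sub_zero]

theorem chernPairing_commutator_right (A B C : MatAlg 𝕜 m) :
    chernPairing 𝕜 m π C (A * B - B * A) = chernTrace 𝕜 m π ((A * B - B * A) * C) := by
  rw [chernPairing_apply, chernTrace_apply, map_sub (trL 𝕜 m) (A * B), trL_mul_comm A B, sub_self,
    mul_zero, map_zero, smul_zero, sub_zero, trL_mul_comm]

/-- Invariance of the pairing under conjugation, in the form that moves a conjugation from one slot
to the inverse conjugation in the other. -/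
theorem chernPairing_conj {a b : MatAlg 𝕜 m} (hab : b * a = 1) (hba : a * b = 1)
    (A B : MatAlg 𝕜 m) :
    chernPairing 𝕜 m π (a * A * b) B = chernPairing 𝕜 m π A (b * B * a) := by
  have h : ∀ c d : MatAlg 𝕜 m, c * d = 1 → ∀ X, trL 𝕜 m (d * X * c) = trL 𝕜 m X :=
    fun c d h X => by rw [trL_mul_comm, ← mul_assoc, h, one_mul]
  rw [chernPairing_apply, chernPairing_apply, h b a hab,
    show trL 𝕜 m (b * B * a) = trL 𝕜 m B from h a b hba B]
  congr 3
  rw [mul_assoc, mul_assoc, trL_mul_comm]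
  simp only [mul_assoc]

/-- The cochain `(0, Θ, Ξ, 0, …)` representing the first Pontryagin class. -/
def pontryaginCochain (ρ : G →* GL (Fin m) 𝕜) : BiFamily E G F
  | 1, 3 => pullback (powModel E 1) 𝓘(ℝ, MatAlg 𝕜 m × MatAlg 𝕜 m)
      (fun x => toPair ρ (x 0)) (cubeField (chernTrace 𝕜 m π))
  | 2, 2 => pullback (powModel E 2)
      𝓘(ℝ, (MatAlg 𝕜 m × MatAlg 𝕜 m) × (MatAlg 𝕜 m × MatAlg 𝕜 m))
      (fun x => (toPair ρ (x 0), toPair ρ (x 1))) (crossField (chernPairing 𝕜 m π))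
  | _, _ => 0

theorem pontryaginCochain_eq_zero (ρ : G →* GL (Fin m) 𝕜) {p q : ℕ} (h₁ : (p, q) ≠ (1, 3))
    (h₂ : (p, q) ≠ (2, 2)) : pontryaginCochain (E := E) π ρ p q = 0 := by
  unfold pontryaginCochain
  split
  · exact absurd rfl h₁
  · exact absurd rfl h₂
  · rfl

variable [LieGroup 𝓘(ℝ, E) ∞ G] {ρ : G →* GL (Fin m) 𝕜} (hρ : IsLieSubgroup E ρ)
include hρ

theorem pontryaginCochain_one_three (x : Fin 1 → G) (v : Fin 3 → TangentSpace (powModel E 1) x) :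
    pontryaginCochain π ρ 1 3 x v
      = cubeForm (chernTrace 𝕜 m π) fun i => lmc (powModel E 1) ρ (fun y => y 0) x (v i) :=
  pullback_cubeField hρ _ (contMDiff_pow_apply 0) x v

theorem pontryaginCochain_two_two (x : Fin 2 → G) (v : Fin 2 → TangentSpace (powModel E 2) x) :
    pontryaginCochain π ρ 2 2 x v
      = chernPairing 𝕜 m π (rmc (powModel E 2) ρ (fun y => y 0) x (v 0))
          (lmc (powModel E 2) ρ (fun y => y 1) x (v 1))
        - chernPairing 𝕜 m π (rmc (powModel E 2) ρ (fun y => y 0) x (v 1))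
          (lmc (powModel E 2) ρ (fun y => y 1) x (v 0)) :=
  pullback_crossField hρ _ (contMDiff_pow_apply 0) (contMDiff_pow_apply 1) x v

section Pullbacks

variable {E₁ : Type*} [NormedAddCommGroup E₁] [NormedSpace ℝ E₁]
  {H₁ : Type*} [TopologicalSpace H₁] {I : ModelWithCorners ℝ E₁ H₁}
  {M : Type*} [TopologicalSpace M] [ChartedSpace H₁ M]

theorem pullback_pontryaginCochain_one_three {f : M → Fin 1 → G}
    (hf : ContMDiff I (powModel E 1) ∞ f) (x : M) (v : Fin 3 → TangentSpace I x) :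
    pullback I (powModel E 1) f (pontryaginCochain π ρ 1 3) x v
      = cubeForm (chernTrace 𝕜 m π) fun i => lmc I ρ (fun y => f y 0) x (v i) := by
  simp only [lmc_comp hρ (contMDiff_pow_apply 0) hf]
  exact pontryaginCochain_one_three π hρ (f x) _

theorem pullback_pontryaginCochain_two_two {f : M → Fin 2 → G}
    (hf : ContMDiff I (powModel E 2) ∞ f) (x : M) (v : Fin 2 → TangentSpace I x) :
    pullback I (powModel E 2) f (pontryaginCochain π ρ 2 2) x v
      = chernPairing 𝕜 m π (rmc I ρ (fun y => f y 0) x (v 0)) (lmc I ρ (fun y => f y 1) x (v 1))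
        - chernPairing 𝕜 m π (rmc I ρ (fun y => f y 0) x (v 1))
          (lmc I ρ (fun y => f y 1) x (v 0)) := by
  simp only [lmc_comp hρ (contMDiff_pow_apply 1) hf, rmc_comp hρ (contMDiff_pow_apply 0) hf]
  exact pontryaginCochain_two_two π hρ (f x) _

end Pullbacks

/-- The alternating sum over the faces is Q(y₂, x₃) - Q(y₂ + Ad(g₂)y₁, x₃) + Q(y₁, x₂ + Ad(g₂⁻¹)x₃)
- Q(y₁, x₂), alternated in the two tangent vectors. The two conjugated terms agree by invariance,
and the rest cancels. -/
theorem horD_three_two : horD (pontryaginCochain (E := E) π ρ) 3 2 = 0 := by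
  funext x
  refine ContinuousAlternatingMap.ext fun v => ?_
  have hp := fun j => pullback_pontryaginCochain_two_two π hρ
    (contMDiff_face (E := E) (G := G) (n := 2) j) x v
  have hs : horD (pontryaginCochain (E := E) π ρ) 3 2 x v = ∑ j : Fin 4, (-1 : ℝ) ^ (j : ℕ) •
      pullback (powModel E 3) (powModel E 2) (face j) (pontryaginCochain π ρ 2 2) x v := by
    simp only [horD, Finset.sum_apply, ContinuousAlternatingMap.sum_apply]
    rfl
  have h0 := contMDiff_pow_apply (E := E) (G := G) (n := 3) 0
  have h1 := contMDiff_pow_apply (E := E) (G := G) (n := 3) 1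
  have h2 := contMDiff_pow_apply (E := E) (G := G) (n := 3) 2
  have e10 : (fun y : Fin 3 → G => face 1 y 0) = fun y => y 1 * y 0 := rfl
  have e21 : (fun y : Fin 3 → G => face 2 y 1) = fun y => y 2 * y 1 := rfl
  have hc := fun A B => chernPairing_conj π (toMat_inv_mul ρ (x 1)) (toMat_mul_inv ρ (x 1)) A B
  rw [hs, Fin.sum_univ_four, hp, hp, hp, hp, e10, e21]
  simp only [show (fun y : Fin 3 → G => face 0 y 0) = fun y => y 1 from rfl,
    show (fun y : Fin 3 → G => face 0 y 1) = fun y => y 2 from rfl,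
    show (fun y : Fin 3 → G => face 1 y 1) = fun y => y 2 from rfl,
    show (fun y : Fin 3 → G => face 2 y 0) = fun y => y 0 from rfl,
    show (fun y : Fin 3 → G => face 3 y 0) = fun y => y 0 from rfl,
    show (fun y : Fin 3 → G => face 3 y 1) = fun y => y 1 from rfl,
    rmc_mul hρ h1 h0, lmc_mul hρ h2 h1, map_add, add_apply, hc]
  norm_num
  abel

variable [FiniteDimensional ℝ F]

theorem extD_pontryaginCochain_one_three :
    extD (powModel E 1) (pontryaginCochain (E := E) π ρ 1 3) = 0 :=
  (extD_pullback (contMDiff_toPair hρ (contMDiff_pow_apply 0))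
    (contDiff_apply_of_contDiff_uncurry (contDiff_cubeField (chernTrace_mul_comm π)))).trans
  (pullback_extDeriv_cubeField hρ (chernTrace_mul_comm π) (contMDiff_pow_apply 0))

theorem extD_pontryaginCochain_two_two (x : Fin 2 → G)
    (v : Fin 3 → TangentSpace (powModel E 2) x) :
    extD (powModel E 2) (pontryaginCochain (E := E) π ρ 2 2) x v
      = cubeForm (chernTrace 𝕜 m π) (fun i => rmc (powModel E 2) ρ (fun y => y 0) x (v i)
          + lmc (powModel E 2) ρ (fun y => y 1) x (v i))
        - cubeForm (chernTrace 𝕜 m π) (fun i => rmc (powModel E 2) ρ (fun y => y 0) x (v i))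
        - cubeForm (chernTrace 𝕜 m π) (fun i => lmc (powModel E 2) ρ (fun y => y 1) x (v i)) := by
  have h1 := extD_pullback (contMDiff_toPair_prod hρ (contMDiff_pow_apply (0 : Fin 2))
    (contMDiff_pow_apply 1))
    (contDiff_apply_of_contDiff_uncurry (contDiff_crossField (chernPairing 𝕜 m π)))
  have h2 := pullback_extDeriv_crossField hρ (chernTrace_mul_comm π)
    (chernPairing_commutator_left π) (chernPairing_commutator_right π)
    (contMDiff_pow_apply (0 : Fin 2)) (contMDiff_pow_apply 1) x v
  exact (DFunLike.congr_fun (congrFun h1 x) v).trans h2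

/-- The middle face g₂g₁ has left logarithmic derivative Ad(g₁⁻¹)(y₁ + x₂). By conjugation
invariance δΘ is the cubic form of x₂ minus that of y₁ + x₂ plus that of y₁, which is -dΞ. -/
theorem totalD_two_three : totalD (pontryaginCochain (E := E) π ρ) 2 3 = 0 := by
  funext x
  refine ContinuousAlternatingMap.ext fun v => ?_
  have hp := fun j => pullback_pontryaginCochain_one_three π hρ
    (contMDiff_face (E := E) (G := G) (n := 1) j) x v
  have hs : totalD (pontryaginCochain (E := E) π ρ) 2 3 x v = (∑ j : Fin 3, (-1 : ℝ) ^ (j : ℕ) •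
      pullback (powModel E 2) (powModel E 1) (face j) (pontryaginCochain π ρ 1 3) x v)
      + (-1 : ℝ) ^ 2 • extD (powModel E 2) (pontryaginCochain (E := E) π ρ 2 2) x v := by
    have : ∀ A B : TangentSpace (powModel E 2) x [⋀^Fin 3]→L[ℝ] F, (A + B) v = A v + B v :=
      fun _ _ => rfl
    refine (this _ _).trans ?_
    simp only [horD, Finset.sum_apply, ContinuousAlternatingMap.sum_apply]
    rfl
  have h0 := contMDiff_pow_apply (E := E) (G := G) (n := 2) 0
  have h1 := contMDiff_pow_apply (E := E) (G := G) (n := 2) 1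
  have hc := cubeForm_conj (chernTrace_mul_comm π) (toMat_mul_inv ρ (x 0))
  have e : ∀ i, lmc (powModel E 2) ρ (fun y : Fin 2 → G => y 1 * y 0) x (v i)
      = toMat ρ (x 0)⁻¹ * (rmc (powModel E 2) ρ (fun y => y 0) x (v i)
        + lmc (powModel E 2) ρ (fun y => y 1) x (v i)) * toMat ρ (x 0) := fun i => by
    rw [lmc_mul hρ h1 h0, lmc_eq ρ (fun y : Fin 2 → G => y 0), mul_add, add_mul]
  rw [hs, Fin.sum_univ_three, hp, hp, hp, extD_pontryaginCochain_two_two π hρ]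
  simp only [show (fun y : Fin 2 → G => face 0 y 0) = fun y => y 1 from rfl,
    show (fun y : Fin 2 → G => face 1 y 0) = fun y => y 1 * y 0 from rfl,
    show (fun y : Fin 2 → G => face 2 y 0) = fun y => y 0 from rfl, e, hc]
  simp only [lmc_eq ρ (fun y : Fin 2 → G => y 0), hc]
  norm_num
  abel

/-- Only in bidegree (2,3) do the horizontal and vertical parts have to cancel each other. The other
possible contributions, δΞ in (3,2) and dΘ in (1,4), vanish separately. -/
theorem totalD_pontryaginCochain : totalD (pontryaginCochain (E := E) π ρ) = 0 := by
  funext p q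
  have hor : (p, q) ≠ (2, 3) → horD (pontryaginCochain (E := E) π ρ) p q = 0 := fun h => by
    match p with
    | 0 => rfl
    | p + 1 =>
      by_cases h₂ : (p, q) = (2, 2)
      · obtain ⟨rfl, rfl⟩ := Prod.mk.inj h₂
        exact horD_three_two π hρ
      · have h₁ : (p, q) ≠ (1, 3) := by rintro h₁; exact h (by cases h₁; rfl)
        simp only [horD, pontryaginCochain_eq_zero π ρ h₁ h₂, pullback_zero, smul_zero,
          Finset.sum_const_zero]
  have ver : (p, q) ≠ (2, 3) → verD (pontryaginCochain (E := E) π ρ) p q = 0 := fun h => by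
    match q with
    | 0 => rfl
    | q + 1 =>
      by_cases h₁ : (p, q) = (1, 3)
      · obtain ⟨rfl, rfl⟩ := Prod.mk.inj h₁
        exact extD_pontryaginCochain_one_three π hρ
      · have h₂ : (p, q) ≠ (2, 2) := by rintro h₂; exact h (by cases h₂; rfl)
        simp only [verD, pontryaginCochain_eq_zero π ρ h₁ h₂, extD_zero]
  by_cases h : (p, q) = (2, 3)
  · obtain ⟨rfl, rfl⟩ := Prod.mk.inj h
    exact totalD_two_three π hρ
  · simp only [totalD, hor h, ver h, smul_zero, add_zero]
    rfl

variable [FiniteDimensional ℝ E]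

theorem isSmooth_pontryaginCochain (p q : ℕ) :
    IsSmooth (powModel E p) (pontryaginCochain (E := E) π ρ p q) := by
  by_cases h₁ : (p, q) = (1, 3)
  · obtain ⟨rfl, rfl⟩ := Prod.mk.inj h₁
    exact isSmooth_pullback (contMDiff_toPair hρ (contMDiff_pow_apply 0))
      (contDiff_cubeField (chernTrace_mul_comm π))
  by_cases h₂ : (p, q) = (2, 2)
  · obtain ⟨rfl, rfl⟩ := Prod.mk.inj h₂
    exact isSmooth_pullback (contMDiff_toPair_prod hρ (contMDiff_pow_apply 0)
      (contMDiff_pow_apply 1)) (contDiff_crossField _)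
  rw [pontryaginCochain_eq_zero π ρ h₁ h₂]
  exact IsSmooth.zero

theorem pontryaginCochain_mem_tot : pontryaginCochain π ρ ∈ tot E G F 4 := by
  refine ⟨isSmooth_pontryaginCochain π hρ, fun p q i => ?_, fun p q h => ?_⟩
  · by_cases h₁ : (p + 1, q) = (1, 3)
    · obtain ⟨h, rfl⟩ := Prod.mk.inj h₁
      obtain rfl : p = 0 := by omega
      funext x
      refine ContinuousAlternatingMap.ext fun v => ?_
      -- The degeneracy starts at the point G⁰, whose tangent space is zero.
      exact ContinuousAlternatingMap.map_coord_zero _ (0 : Fin 3)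
        (Subsingleton.elim (α := Fin 0 → E) _ _)
    by_cases h₂ : (p + 1, q) = (2, 2)
    · obtain ⟨h, rfl⟩ := Prod.mk.inj h₂
      obtain rfl : p = 1 := by omega
      funext x
      refine ContinuousAlternatingMap.ext fun v => ?_
      refine (pullback_pontryaginCochain_two_two π hρ (contMDiff_degen i) x v).trans ?_
      have h0 : (fun y : Fin 1 → G => degen 0 y 0) = fun _ => 1 := rfl
      have h1 : (fun y : Fin 1 → G => degen 1 y 1) = fun _ => 1 := rfl
      -- Inserting the neutral element makes one of the two arguments of the pairing the logarithmic
      -- derivative of a constant.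
      fin_cases i
      · simp [h0, rmc, matD_const]
      · simp [h1, lmc, matD_const]
    · rw [pontryaginCochain_eq_zero π ρ h₁ h₂, pullback_zero]
  · exact pontryaginCochain_eq_zero π ρ (by rintro ⟨⟩; omega) (by rintro ⟨⟩; omega)

theorem pontryaginCochain_mem_cocycles : pontryaginCochain π ρ ∈ cocycles E G F 4 :=
  ⟨⟨pontryaginCochain π ρ, pontryaginCochain_mem_tot π hρ⟩,
    LinearMap.mem_ker.2 (totalD_pontryaginCochain π hρ), rfl⟩

end Cocycle

/-! ### The canonical connection and its curvature in matrix form. -/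

section Curvature

variable {𝕜 : Type*} [RCLike 𝕜] {m : ℕ}
  {E : Type*} [NormedAddCommGroup E] [NormedSpace ℝ E]
  {G : Type*} [TopologicalSpace G] [ChartedSpace E G] [Group G]

/-- The linear part of the `j`-th barycentric coordinate. -/
def baryL {n : ℕ} (j : Fin (n + 1)) : (Fin n → ℝ) →L[ℝ] ℝ :=
  Fin.cases (-∑ i, ContinuousLinearMap.proj i) (fun i => ContinuousLinearMap.proj i) j

theorem bary_eq {n : ℕ} (t : Fin n → ℝ) (j : Fin (n + 1)) :
    bary t j = (Fin.cons 1 0 : Fin (n + 1) → ℝ) j + baryL j t := by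
  induction j using Fin.cases with
  | zero => simp [bary, baryL, sub_eq_add_neg]
  | succ i => simp [bary, baryL]

/-- The form `∑_j t_j B_j dA_j` on the space of all `(t, (A_j, B_j)_j)`. -/
def connField (𝕜 : Type*) [RCLike 𝕜] (m n : ℕ)
    (p : (Fin n → ℝ) × (Fin (n + 1) → MatAlg 𝕜 m × MatAlg 𝕜 m)) :
    ((Fin n → ℝ) × (Fin (n + 1) → MatAlg 𝕜 m × MatAlg 𝕜 m)) [⋀^Fin 1]→L[ℝ] Arr 𝕜 m :=
  ContinuousAlternatingMap.ofSubsingleton ℝ _ _ (0 : Fin 1)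
    (∑ j, bary p.1 j • toArrL 𝕜 m ∘L ContinuousLinearMap.mul ℝ (MatAlg 𝕜 m) (p.2 j).2 ∘L
      ContinuousLinearMap.fst ℝ _ _ ∘L ContinuousLinearMap.proj j ∘L ContinuousLinearMap.snd ℝ _ _)

theorem connField_apply {n : ℕ} (p : (Fin n → ℝ) × (Fin (n + 1) → MatAlg 𝕜 m × MatAlg 𝕜 m))
    (w : Fin 1 → (Fin n → ℝ) × (Fin (n + 1) → MatAlg 𝕜 m × MatAlg 𝕜 m)) :
    connField 𝕜 m n p w = ∑ j, bary p.1 j • toArrL 𝕜 m ((p.2 j).2 * ((w 0).2 j).1) := by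
  simp [connField]

theorem contDiff_connField (n : ℕ) :
    ContDiff ℝ ∞ fun p : ((Fin n → ℝ) × (Fin (n + 1) → MatAlg 𝕜 m × MatAlg 𝕜 m)) ×
      (Fin 1 → (Fin n → ℝ) × (Fin (n + 1) → MatAlg 𝕜 m × MatAlg 𝕜 m)) =>
      connField 𝕜 m n p.1 p.2 := by
  simp only [connField_apply, bary_eq]
  fun_prop

theorem fderiv_connField {n : ℕ}
    (p u : (Fin n → ℝ) × (Fin (n + 1) → MatAlg 𝕜 m × MatAlg 𝕜 m))
    (w : Fin 1 → (Fin n → ℝ) × (Fin (n + 1) → MatAlg 𝕜 m × MatAlg 𝕜 m)) :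
    ofArr 𝕜 m (fderiv ℝ (fun q => connField 𝕜 m n q w) p u)
      = ∑ j, (baryL j u.1 • ((p.2 j).2 * ((w 0).2 j).1)
        + bary p.1 j • ((u.2 j).2 * ((w 0).2 j).1)) := by
  let L : Fin (n + 1) → ((Fin n → ℝ) × (Fin (n + 1) → MatAlg 𝕜 m × MatAlg 𝕜 m)) →L[ℝ] ℝ :=
    fun j => (baryL j).comp (ContinuousLinearMap.fst ℝ _ _)
  let L' : Fin (n + 1) → ((Fin n → ℝ) × (Fin (n + 1) → MatAlg 𝕜 m × MatAlg 𝕜 m)) →L[ℝ] Arr 𝕜 m :=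
    fun j => toArrL 𝕜 m ∘L (ContinuousLinearMap.mul ℝ (MatAlg 𝕜 m)).flip ((w 0).2 j).1 ∘L
      ContinuousLinearMap.snd ℝ _ _ ∘L ContinuousLinearMap.proj j ∘L
      ContinuousLinearMap.snd ℝ _ _
  have h1 : ∀ j, HasFDerivAt (fun q : (Fin n → ℝ) × (Fin (n + 1) → MatAlg 𝕜 m × MatAlg 𝕜 m) =>
      bary q.1 j) (L j) p := fun j => by
    simp only [bary_eq]
    exact (L j).hasFDerivAt.const_add _
  have h2 : ∀ j, HasFDerivAt (fun q : (Fin n → ℝ) × (Fin (n + 1) → MatAlg 𝕜 m × MatAlg 𝕜 m) =>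
      toArrL 𝕜 m ((q.2 j).2 * ((w 0).2 j).1)) (L' j) p := fun j => (L' j).hasFDerivAt
  have h3 := HasFDerivAt.fun_sum (u := Finset.univ) fun j _ => (h1 j).smul (h2 j)
  have heq : (fun q => connField 𝕜 m n q w) = fun q => ∑ j, bary q.1 j •
      toArrL 𝕜 m ((q.2 j).2 * ((w 0).2 j).1) := funext fun q => connField_apply q w
  rw [heq]
  refine (congrArg (fun D => ofArr 𝕜 m (D u)) h3.fderiv).trans ?_
  simp [ofArr_toArrL, add_comm, L, L']

/-- The computation d(t_j ω_j) = dt_j ∧ ω_j - t_j ω_j², where ω_j = B_j dA_j and the last term comes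
from dB_j = -B_j dA_j B_j. -/
theorem extDeriv_connField {n : ℕ}
    (p : (Fin n → ℝ) × (Fin (n + 1) → MatAlg 𝕜 m × MatAlg 𝕜 m))
    (v : Fin 2 → (Fin n → ℝ) × (Fin (n + 1) → MatAlg 𝕜 m × MatAlg 𝕜 m))
    (hv : ∀ i j, ((v i).2 j).2 = -((p.2 j).2 * ((v i).2 j).1 * (p.2 j).2))
    {X Y : Fin (n + 1) → MatAlg 𝕜 m}
    (hX : ∀ j, (p.2 j).2 * ((v 0).2 j).1 = X j) (hY : ∀ j, (p.2 j).2 * ((v 1).2 j).1 = Y j) :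
    ofArr 𝕜 m (extDeriv (connField 𝕜 m n) p v) =
      ∑ j, (baryL j (v 0).1 • Y j - baryL j (v 1).1 • X j
        - bary p.1 j • (X j * Y j - Y j * X j)) := by
  have e0 : ∀ j (w : MatAlg 𝕜 m), ((v 0).2 j).2 * w = -(X j * ((p.2 j).2 * w)) := fun j w => by
    rw [hv, ← hX]; simp only [neg_mul, mul_assoc]
  have e1 : ∀ j (w : MatAlg 𝕜 m), ((v 1).2 j).2 * w = -(Y j * ((p.2 j).2 * w)) := fun j w => by
    rw [hv, ← hY]; simp only [neg_mul, mul_assoc]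
  rw [extDeriv_apply_of_contDiff_uncurry (contDiff_connField (𝕜 := 𝕜) (m := m) n), Fin.sum_univ_two, map_add,
    map_zsmul, map_zsmul, fderiv_connField, fderiv_connField]
  simp only [show Fin.removeNth (0 : Fin 2) v 0 = v 1 from rfl,
    show Fin.removeNth (1 : Fin 2) v 0 = v 0 from rfl, e0, e1, hX, hY]
  rw [Finset.smul_sum, Finset.smul_sum, ← Finset.sum_add_distrib]
  refine Finset.sum_congr rfl fun j _ => ?_
  simp
  module

variable [LieGroup 𝓘(ℝ, E) ∞ G] {ρ : G →* GL (Fin m) 𝕜} (hρ : IsLieSubgroup E ρ)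

/-- The coordinates `(t, (ρ(g_j), ρ(g_j)⁻¹)_j)` on `ℝ^n × EG_n`. -/
def totalPair (ρ : G →* GL (Fin m) 𝕜) (n : ℕ) (p : (Fin n → ℝ) × (Fin (n + 1) → G)) :
    (Fin n → ℝ) × (Fin (n + 1) → MatAlg 𝕜 m × MatAlg 𝕜 m) := (p.1, fun j => toPair ρ (p.2 j))

omit [Group G] [LieGroup 𝓘(ℝ, E) ∞ G] in
theorem contMDiff_total_apply {n : ℕ} (j : Fin (n + 1)) :
    ContMDiff (totalModel E n) 𝓘(ℝ, E) ∞ fun p : (Fin n → ℝ) × (Fin (n + 1) → G) => p.2 j :=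
  (contMDiff_pow_apply j).comp contMDiff_snd

include hρ

theorem contMDiff_totalPair (n : ℕ) :
    ContMDiff (totalModel E n) 𝓘(ℝ, (Fin n → ℝ) × (Fin (n + 1) → MatAlg 𝕜 m × MatAlg 𝕜 m)) ∞
      (totalPair ρ n) :=
  contMDiff_fst.prodMk_space
    (contMDiff_pi_space.2 fun j => contMDiff_toPair hρ (contMDiff_total_apply j))

theorem mfderiv_totalPair {n : ℕ} (p : (Fin n → ℝ) × (Fin (n + 1) → G))
    (v : TangentSpace (totalModel E n) p) :
    mfderiv (totalModel E n) 𝓘(ℝ, (Fin n → ℝ) × (Fin (n + 1) → MatAlg 𝕜 m × MatAlg 𝕜 m))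
      (totalPair ρ n) p v = (v.1, fun j => (matD (totalModel E n) ρ (fun p => p.2 j) p v,
        -(toMat ρ (p.2 j)⁻¹ * matD (totalModel E n) ρ (fun p => p.2 j) p v
          * toMat ρ (p.2 j)⁻¹))) := by
  refine Prod.ext ?_ (funext fun j => ?_)
  · refine (clm_mfderiv (contMDiff_totalPair hρ n) (ContinuousLinearMap.fst ℝ _ _) p v).trans ?_
    exact DFunLike.congr_fun (mfderiv_fst (I := 𝓘(ℝ, Fin n → ℝ)) (I' := powModel E (n + 1))
      (x := p)) v
  · refine (clm_mfderiv (contMDiff_totalPair hρ n)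
      ((ContinuousLinearMap.proj j).comp (ContinuousLinearMap.snd ℝ _ _)) p v).trans ?_
    exact mfderiv_toPair hρ (contMDiff_total_apply j) p v

theorem connection_apply {n : ℕ} (p : (Fin n → ℝ) × (Fin (n + 1) → G))
    (v : Fin 1 → TangentSpace (totalModel E n) p) :
    ofArr 𝕜 m (connection ρ n p v)
      = ∑ j, bary p.1 j • lmc (totalModel E n) ρ (fun p => p.2 j) p (v 0) := by
  have h := fun j => of_pullback_leftMC hρ (contMDiff_total_apply (E := E) (G := G) j) p v
  simp only [connection, ContinuousAlternatingMap.sum_apply, ContinuousAlternatingMap.smul_apply,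
    map_sum, map_smul]
  exact Finset.sum_congr rfl fun j _ => congrArg _ (h j)

/-- Realizes the connection as a pullback from a vector space, so that its exterior derivative can
be read off from `extDeriv_connField`. -/
theorem connection_eq_pullback (n : ℕ) :
    connection (E := E) ρ n = pullback (totalModel E n)
      𝓘(ℝ, (Fin n → ℝ) × (Fin (n + 1) → MatAlg 𝕜 m × MatAlg 𝕜 m)) (totalPair ρ n)
      (connField 𝕜 m n) := by
  funext p
  refine ContinuousAlternatingMap.ext fun v => ofArr_injective ?_
  refine (connection_apply hρ p v).trans ?_
  have h := congrArg (ofArr 𝕜 m) (connField_apply (totalPair ρ n p) fun i =>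
    mfderiv (totalModel E n) 𝓘(ℝ, (Fin n → ℝ) × (Fin (n + 1) → MatAlg 𝕜 m × MatAlg 𝕜 m))
      (totalPair ρ n) p (v i))
  refine Eq.trans ?_ h.symm
  simp only [mfderiv_totalPair hρ, map_sum, map_smul, ofArr_toArrL]
  rfl

theorem extD_connection {n : ℕ} (p : (Fin n → ℝ) × (Fin (n + 1) → G))
    (v : Fin 2 → TangentSpace (totalModel E n) p) {X Y : Fin (n + 1) → MatAlg 𝕜 m}
    (hX : ∀ j, lmc (totalModel E n) ρ (fun p => p.2 j) p (v 0) = X j)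
    (hY : ∀ j, lmc (totalModel E n) ρ (fun p => p.2 j) p (v 1) = Y j) :
    ofArr 𝕜 m (extD (totalModel E n) (connection ρ n) p v)
      = ∑ j, (baryL j (v 0).1 • Y j - baryL j (v 1).1 • X j
        - bary p.1 j • (X j * Y j - Y j * X j)) := by
  have h1 := extD_pullback (contMDiff_totalPair (E := E) hρ n)
    (contDiff_apply_of_contDiff_uncurry (contDiff_connField (𝕜 := 𝕜) (m := m) n))
  rw [connection_eq_pullback hρ, h1]
  have hd := fun i => mfderiv_totalPair hρ p (v i)
  have h2 := extDeriv_connField (𝕜 := 𝕜) (totalPair ρ n p) (fun i =>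
    mfderiv (totalModel E n) 𝓘(ℝ, (Fin n → ℝ) × (Fin (n + 1) → MatAlg 𝕜 m × MatAlg 𝕜 m))
      (totalPair ρ n) p (v i)) (X := X) (Y := Y)
    (fun i j => by rw [hd]; rfl) (fun j => by rw [hd]; exact hX j) (fun j => by rw [hd]; exact hY j)
  refine h2.trans ?_
  simp only [hd]
  rfl

theorem curvature_apply {n : ℕ} (p : (Fin n → ℝ) × (Fin (n + 1) → G))
    (v : Fin 2 → TangentSpace (totalModel E n) p) {X Y : Fin (n + 1) → MatAlg 𝕜 m}
    (hX : ∀ j, lmc (totalModel E n) ρ (fun p => p.2 j) p (v 0) = X j)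
    (hY : ∀ j, lmc (totalModel E n) ρ (fun p => p.2 j) p (v 1) = Y j) :
    (curvature ρ n p v : MatAlg 𝕜 m)
      = ∑ j, (baryL j (v 0).1 • Y j - baryL j (v 1).1 • X j
        - bary p.1 j • (X j * Y j - Y j * X j))
      + ((∑ j, bary p.1 j • X j) * (∑ j, bary p.1 j • Y j)
        - (∑ j, bary p.1 j • Y j) * (∑ j, bary p.1 j • X j)) := by
  have h1 := connection_apply hρ p fun _ => v 0
  have h2 := connection_apply hρ p fun _ => v 1
  simp only [hX, hY] at h1 h2
  rw [← extD_connection hρ p v hX hY, ← h1, ← h2]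
  have h3 := wedge_one_one (fun A B : Arr 𝕜 m => Matrix.of A * Matrix.of B
    - Matrix.of B * Matrix.of A) (connection ρ n p) (connection ρ n p) v
  -- The wedge of ω̂ with itself counts the bracket [ω̂(v₀), ω̂(v₁)] twice, and the factor 1/2 in
  -- the curvature compensates.
  have h4 : ∀ A B : MatAlg 𝕜 m, (1 / 2 : ℝ) • ((A * B - B * A) - (B * A - A * B)) = A * B - B * A :=
    fun A B => by module
  refine (congrArg (fun C => Matrix.of (extD (totalModel E n) (connection ρ n) p v)
    + (1 / 2 : ℝ) • C) h3).trans ?_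
  exact congrArg (fun C => ofArr 𝕜 m (extD (totalModel E n) (connection ρ n) p v) + C)
    (h4 (ofArr 𝕜 m (connection ρ n p fun _ => v 0)) (ofArr 𝕜 m (connection ρ n p fun _ => v 1)))

omit [LieGroup 𝓘(ℝ, E) ∞ G] in
theorem lmc_total {n : ℕ} (t : Fin n → ℝ) (x : Fin (n + 1) → G) (j : Fin (n + 1))
    (s : Fin n → ℝ) (u : TangentSpace (powModel E (n + 1)) x) :
    lmc (totalModel E n) ρ (fun p => p.2 j) (t, x) (s, u)
      = lmc (powModel E (n + 1)) ρ (fun y => y j) x u := by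
  have h := lmc_comp hρ (contMDiff_pow_apply (E := E) (G := G) j)
    (contMDiff_snd (I := 𝓘(ℝ, Fin n → ℝ)) (J := powModel E (n + 1)) (n := ∞)) (t, x) (s, u)
  rw [mfderiv_snd] at h
  exact h

end Curvature

/-! ### The forms χ_n and their comparison with the cocycle. -/

section Shulman

variable {𝕜 : Type*} [RCLike 𝕜] {m : ℕ}
  {E : Type*} [NormedAddCommGroup E] [NormedSpace ℝ E]
  {G : Type*} [TopologicalSpace G] [ChartedSpace E G] [Group G] [LieGroup 𝓘(ℝ, E) ∞ G]
  {ρ : G →* GL (Fin m) 𝕜}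

/-- The curvature with values in the normed algebra of matrices. -/
def curvatureAlg (ρ : G →* GL (Fin m) 𝕜) (n : ℕ) (p : (Fin n → ℝ) × (Fin (n + 1) → G))
    (v : Fin 2 → TangentSpace (totalModel E n) p) : MatAlg 𝕜 m := curvature ρ n p v

theorem pontryagin₁_eq_neg_chernPairing (A B : MatAlg 𝕜 m) :
    pontryagin₁ (A : Matrix (Fin m) (Fin m) 𝕜) B
      = -chernPairing 𝕜 m (ContinuousLinearMap.id ℝ 𝕜) A B := by
  refine (pontryagin₁_eq (A : Matrix (Fin m) (Fin m) 𝕜) B).trans ?_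
  rw [chernPairing_apply, RCLike.real_smul_eq_coe_mul, RCLike.real_smul_eq_coe_mul, ← mul_sub,
    ← mul_neg, neg_sub]
  rfl

theorem chernPairing_symm {F : Type*} [NormedAddCommGroup F] [NormedSpace ℝ F] (π : 𝕜 →L[ℝ] F)
    (A B : MatAlg 𝕜 m) : chernPairing 𝕜 m π A B = chernPairing 𝕜 m π B A := by
  rw [chernPairing_apply, chernPairing_apply, trL_mul_comm, mul_comm (trL 𝕜 m A)]

theorem baryL_zero {n : ℕ} (s : Fin n → ℝ) : baryL 0 s = -∑ i, s i := by simp [baryL]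

theorem baryL_succ {n : ℕ} (s : Fin n → ℝ) (i : Fin n) : baryL i.succ s = s i := rfl

section Tangent

variable {E₁ : Type*} [NormedAddCommGroup E₁] [NormedSpace ℝ E₁]
  {H₁ : Type*} [TopologicalSpace H₁] {I : ModelWithCorners ℝ E₁ H₁}
  {M : Type*} [TopologicalSpace M] [ChartedSpace H₁ M]

omit [TopologicalSpace G] in
theorem lmc_zero (h : M → G) (x : M) : lmc I ρ h x 0 = 0 := by
  rw [lmc, map_zero, mul_zero]

end Tangent

variable (hρ : IsLieSubgroup E ρ)
include hρ

theorem curvatureAlg_apply {n : ℕ} (p : (Fin n → ℝ) × (Fin (n + 1) → G))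
    (v : Fin 2 → TangentSpace (totalModel E n) p) {X Y : Fin (n + 1) → MatAlg 𝕜 m}
    (hX : ∀ j, lmc (totalModel E n) ρ (fun p => p.2 j) p (v 0) = X j)
    (hY : ∀ j, lmc (totalModel E n) ρ (fun p => p.2 j) p (v 1) = Y j) :
    curvatureAlg ρ n p v
      = ∑ j, (baryL j (v 0).1 • Y j - baryL j (v 1).1 • X j
        - bary p.1 j • (X j * Y j - Y j * X j))
      + ((∑ j, bary p.1 j • X j) * (∑ j, bary p.1 j • Y j)
        - (∑ j, bary p.1 j • Y j) * (∑ j, bary p.1 j • X j)) :=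
  curvature_apply hρ p v hX hY

variable {n : ℕ} (t : Fin n → ℝ) (x : Fin (n + 1) → G)

theorem curvature_swap (v w : TangentSpace (totalModel E n) (t, x)) :
    curvatureAlg ρ n (t, x) ![v, w] = -curvatureAlg ρ n (t, x) ![w, v] := by
  have h1 := curvatureAlg_apply hρ (t, x) ![v, w] (fun _ => rfl) (fun _ => rfl)
  have h2 := curvatureAlg_apply hρ (t, x) ![w, v] (fun _ => rfl) (fun _ => rfl)
  refine h1.trans (Eq.trans ?_ (congrArg (fun A : MatAlg 𝕜 m => -A) h2).symm)
  simp only [Matrix.cons_val_zero, Matrix.cons_val_one]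
  rw [neg_add, ← Finset.sum_neg_distrib, neg_sub]
  congr 1
  refine Finset.sum_congr rfl fun j _ => ?_
  module

/-- Every term of the curvature contains some ω_j, and all ω_j vanish on vertical vectors. -/
theorem curvature_vert_vert (s s' : Fin n → ℝ) :
    curvatureAlg ρ n (t, x) ![((s, 0) : TangentSpace (totalModel E n) (t, x)),
      ((s', 0) : TangentSpace (totalModel E n) (t, x))] = 0 := by
  have h0 : ∀ (s : Fin n → ℝ) (j : Fin (n + 1)),
      lmc (totalModel E n) ρ (fun p => p.2 j) (t, x) (s, 0) = 0 := fun s j =>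
    (lmc_total hρ t x j s 0).trans (lmc_zero _ _)
  refine (curvatureAlg_apply hρ (t, x) _ (h0 s) (h0 s')).trans ?_
  simp

theorem curvature_vert_hor (s : Fin n → ℝ) (u : TangentSpace (powModel E (n + 1)) x) :
    curvatureAlg ρ n (t, x) ![((s, 0) : TangentSpace (totalModel E n) (t, x)),
      ((0, u) : TangentSpace (totalModel E n) (t, x))]
      = ∑ j, baryL j s • lmc (powModel E (n + 1)) ρ (fun y => y j) x u := by
  have h0 : ∀ j : Fin (n + 1),
      lmc (totalModel E n) ρ (fun p => p.2 j) (t, x) (s, 0) = 0 := fun j =>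
    (lmc_total hρ t x j s 0).trans (lmc_zero _ _)
  refine (curvatureAlg_apply hρ (t, x) _ h0 fun j => lmc_total hρ t x j 0 u).trans ?_
  simp

theorem curvature_hor_hor (u u' : TangentSpace (powModel E (n + 1)) x)
    {X Y : Fin (n + 1) → MatAlg 𝕜 m}
    (hX : ∀ j, lmc (powModel E (n + 1)) ρ (fun y => y j) x u = X j)
    (hY : ∀ j, lmc (powModel E (n + 1)) ρ (fun y => y j) x u' = Y j) :
    curvatureAlg ρ n (t, x) ![((0, u) : TangentSpace (totalModel E n) (t, x)),
      ((0, u') : TangentSpace (totalModel E n) (t, x))]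
      = -∑ j, bary t j • (X j * Y j - Y j * X j)
      + ((∑ j, bary t j • X j) * (∑ j, bary t j • Y j)
        - (∑ j, bary t j • Y j) * (∑ j, bary t j • X j)) := by
  refine (curvatureAlg_apply hρ (t, x) _ (fun j => (lmc_total hρ t x j 0 u).trans (hX j))
    fun j => (lmc_total hρ t x j 0 u').trans (hY j)).trans ?_
  simp

omit t x in
/-- The integrand of `χ_n` in terms of the values of the curvature on pairs of vectors. -/
theorem wedge_curvature (p : (Fin n → ℝ) × (Fin (n + 1) → G))
    (v : Fin 4 → TangentSpace (totalModel E n) p)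
    {a b c d e f : MatAlg 𝕜 m} (ha : curvatureAlg ρ n p ![v 0, v 1] = a)
    (hb : curvatureAlg ρ n p ![v 2, v 3] = b)
    (hc : curvatureAlg ρ n p ![v 0, v 2] = c)
    (hd : curvatureAlg ρ n p ![v 1, v 3] = d)
    (he : curvatureAlg ρ n p ![v 0, v 3] = e)
    (hf : curvatureAlg ρ n p ![v 1, v 2] = f) :
    wedge pontryagin₁ (curvature ρ n p) (curvature ρ n p) v
      = (-2 : ℝ) • (chernPairing 𝕜 m (ContinuousLinearMap.id ℝ 𝕜) a b
        - chernPairing 𝕜 m (ContinuousLinearMap.id ℝ 𝕜) c d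
        + chernPairing 𝕜 m (ContinuousLinearMap.id ℝ 𝕜) e f) := by
  have hP := pontryagin₁_eq_neg_chernPairing (𝕜 := 𝕜) (m := m)
  subst ha hb hc hd he hf
  -- The constant -2 combines the multiplicity 2 of the wedge square with the sign in p₁ = -Q.
  refine (wedge_two_two (T := TangentSpace (totalModel E n) p) (fun A B => ?_) (fun A B => ?_)
    (fun v w => curvature_swap hρ p.1 p.2 v w) v).trans ?_
  · exact (hP A B).trans ((congrArg Neg.neg (chernPairing_symm _ _ _)).trans (hP B A).symm)
  · have hn : ∀ A B : MatAlg 𝕜 m, -chernPairing 𝕜 m (ContinuousLinearMap.id ℝ 𝕜) (-A) B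
        = - -chernPairing 𝕜 m (ContinuousLinearMap.id ℝ 𝕜) A B := fun A B => by
      rw [map_neg, neg_apply]
    exact (hP _ B).trans ((hn A B).trans (congrArg Neg.neg (hP A B).symm))
  · have h2 : ∀ a b c : 𝕜, (2 : ℝ) • (-a - -b + -c) = (-2 : ℝ) • (a - b + c) :=
      fun a b c => by module
    exact (congrArg (fun z : 𝕜 => (2 : ℝ) • z) (congrArg₂ (· + ·) (congrArg₂ (· - ·) (hP _ _)
      (hP _ _)) (hP _ _))).trans (h2 _ _ _)

/-- Over a point the connection is the Maurer-Cartan form itself, whose curvature is zero. -/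
theorem shulman_zero (h : 0 + 4 = 4) (x : Fin 1 → G)
    (u : Fin 4 → TangentSpace (powModel E 1) x) :
    shulman (E := E) ρ pontryagin₁ 0 4 h x u = 0 := by
  have hk : ∀ (t : Fin 0 → ℝ) (u u' : TangentSpace (powModel E 1) x),
      curvatureAlg ρ 0 (t, x) ![((0, u) : TangentSpace (totalModel E 0) (t, x)),
      ((0, u') : TangentSpace (totalModel E 0) (t, x))] = 0 := fun t u u' => by
    refine (curvature_hor_hor hρ t x u u' (fun _ => rfl) (fun _ => rfl)).trans ?_
    simp [bary]
  have hw : ∀ t : Fin 0 → ℝ, wedge pontryagin₁ (curvature ρ 0 (t, x)) (curvature ρ 0 (t, x))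
    (fun i : Fin 4 =>
      (Fin.append (α := (Fin 0 → ℝ) × (Fin 1 → E))
        (fun a => (Pi.single a 1, 0)) (fun b => (0, u b)) (Fin.cast h.symm i))) = 0 := fun t => by
    refine (wedge_curvature hρ (t, x) _ (hk t (u 0) (u 1)) (hk t (u 2) (u 3)) (hk t (u 0) (u 2))
      (hk t (u 1) (u 3)) (hk t (u 0) (u 3)) (hk t (u 1) (u 2))).trans ?_
    simp
  unfold shulman
  simp only [hw, MeasureTheory.integral_zero]

/-- With D = ω₁ - ω₀, expanding -(1-t)ω₀² - tω₁² + ((1-t)ω₀ + tω₁)² leaves -t(1-t)D². -/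
theorem curvature_hor_hor_one (t : Fin 1 → ℝ) (x : Fin 2 → G)
    (u u' : TangentSpace (powModel E 2) x) {D D' : MatAlg 𝕜 m}
    (hD : lmc (powModel E 2) ρ (fun y => y 1) x u - lmc (powModel E 2) ρ (fun y => y 0) x u = D)
    (hD' : lmc (powModel E 2) ρ (fun y => y 1) x u' - lmc (powModel E 2) ρ (fun y => y 0) x u'
      = D') :
    curvatureAlg ρ 1 (t, x) ![((0, u) : TangentSpace (totalModel E 1) (t, x)),
      ((0, u') : TangentSpace (totalModel E 1) (t, x))]
      = -(t 0 * (1 - t 0)) • (D * D' - D' * D) := by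
  refine (curvature_hor_hor hρ t x u u' (fun _ => rfl) (fun _ => rfl)).trans ?_
  subst hD hD'
  rw [Fin.sum_univ_two, Fin.sum_univ_two, Fin.sum_univ_two, show bary t 0 = 1 - t 0 by simp [bary],
    show bary t 1 = t 0 from rfl]
  simp only [mul_add, add_mul, mul_sub, sub_mul, smul_mul_assoc, mul_smul_comm, smul_sub]
  module

theorem curvature_vert_hor_one (t : Fin 1 → ℝ) (x : Fin 2 → G)
    (u : TangentSpace (powModel E 2) x) {D : MatAlg 𝕜 m}
    (hD : lmc (powModel E 2) ρ (fun y => y 1) x u - lmc (powModel E 2) ρ (fun y => y 0) x u = D) :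
    curvatureAlg ρ 1 (t, x) ![((Pi.single 0 1, 0) : TangentSpace (totalModel E 1) (t, x)),
      ((0, u) : TangentSpace (totalModel E 1) (t, x))] = D := by
  refine (curvature_vert_hor hρ t x _ u).trans ?_
  rw [← hD]
  rw [Fin.sum_univ_two, baryL_zero, show (1 : Fin 2) = Fin.succ 0 from rfl, baryL_succ]
  simp [sub_eq_neg_add]

/-- For g = hk⁻¹ the product and inversion rules give g⁻¹dg = k(h⁻¹dh - k⁻¹dk)k⁻¹. In `rmc_proj` the
same difference is conjugated by h instead. -/
theorem lmc_proj {n : ℕ} (j : Fin n) (x : Fin (n + 1) → G)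
    (u : TangentSpace (powModel E (n + 1)) x) :
    lmc (powModel E (n + 1)) ρ (fun y => proj y j) x u = toMat ρ (x j.castSucc) *
      (lmc (powModel E (n + 1)) ρ (fun y => y j.succ) x u
        - lmc (powModel E (n + 1)) ρ (fun y => y j.castSucc) x u) * toMat ρ (x j.castSucc)⁻¹ := by
  have h := contMDiff_pow_apply (E := E) (G := G) j.castSucc
  refine (lmc_mul hρ (contMDiff_pow_apply (E := E) (G := G) j.succ)
    (ContMDiff.inv h) x u).trans ?_
  rw [lmc_inv hρ h, rmc_eq, inv_inv, mul_sub, sub_mul]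
  abel

theorem rmc_proj {n : ℕ} (j : Fin n) (x : Fin (n + 1) → G)
    (u : TangentSpace (powModel E (n + 1)) x) :
    rmc (powModel E (n + 1)) ρ (fun y => proj y j) x u = toMat ρ (x j.succ) *
      (lmc (powModel E (n + 1)) ρ (fun y => y j.succ) x u
        - lmc (powModel E (n + 1)) ρ (fun y => y j.castSucc) x u) * toMat ρ (x j.succ)⁻¹ := by
  have h := contMDiff_pow_apply (E := E) (G := G) j.castSucc
  refine (rmc_mul hρ (contMDiff_pow_apply (E := E) (G := G) j.succ)
    (ContMDiff.inv h) x u).trans ?_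
  rw [rmc_inv hρ h, rmc_eq, mul_sub, sub_mul, mul_neg, neg_mul, sub_eq_add_neg]

theorem shulman_one (h : 1 + 3 = 4) (x : Fin 2 → G)
    (u : Fin 3 → TangentSpace (powModel E 2) x) :
    shulman (E := E) ρ pontryagin₁ 1 3 h x u
      = pullback (powModel E 2) (powModel E 1) proj
        (pontryaginCochain (ContinuousLinearMap.id ℝ 𝕜) ρ 1 3) x u := by
  obtain ⟨D, hD⟩ : ∃ D : Fin 3 → MatAlg 𝕜 m, ∀ i, lmc (powModel E 2) ρ (fun y => y 1) x (u i)
    - lmc (powModel E 2) ρ (fun y => y 0) x (u i) = D i := ⟨_, fun _ => rfl⟩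
  have hv := fun t i => curvature_vert_hor_one hρ t x (u i) (hD i)
  have hh := fun t i j => curvature_hor_hor_one hρ t x (u i) (u j) (hD i) (hD j)
  -- The vertical vector can be paired with any of the three arguments. Each choice contributes
  -- 2t(1-t) times the cubic form, so the total is 6t(1-t), whose integral over the simplex is 1.
  have hw : ∀ t : Fin 1 → ℝ, wedge pontryagin₁ (curvature ρ 1 (t, x)) (curvature ρ 1 (t, x))
      (fun i : Fin 4 => (Fin.append (α := (Fin 1 → ℝ) × (Fin 2 → E))
        (fun a => (Pi.single a 1, 0)) (fun b => (0, u b)) (Fin.cast h.symm i)))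
      = (t 0 * (1 - t 0)) • ((6 : ℝ) •
        cubeForm (chernTrace 𝕜 m (ContinuousLinearMap.id ℝ 𝕜)) D) := fun t => by
    refine (wedge_curvature hρ (t, x) _ (hv t 0) (hh t 1 2) (hv t 1) (hh t 0 2) (hv t 2)
      (hh t 0 1)).trans ?_
    rw [cubeForm_apply (chernTrace_mul_comm _)]
    simp only [map_smul, chernPairing_commutator_right]
    simp only [sub_mul, map_sub]
    have hc : ∀ a b c : MatAlg 𝕜 m, chernTrace 𝕜 m (ContinuousLinearMap.id ℝ 𝕜) (a * b * c)
        = chernTrace 𝕜 m (ContinuousLinearMap.id ℝ 𝕜) (c * a * b) := fun a b c => by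
      rw [chernTrace_mul_comm, mul_assoc]
    rw [hc (D 1) (D 2), hc (D 2) (D 1), hc (D 2) (D 0), hc (D 1) (D 2), hc (D 1) (D 0),
      hc (D 2) (D 1)]
    module
  have hc := cubeForm_conj (chernTrace_mul_comm (ContinuousLinearMap.id ℝ 𝕜))
    (toMat_inv_mul ρ (x 0)) D
  rw [pullback_pontryaginCochain_one_three _ hρ contMDiff_proj]
  simp only [lmc_proj hρ]
  refine Eq.trans ?_ (hc.symm.trans ?_)
  · unfold shulman
    simp only [hw]
    rw [integral_smul_const, integral_simplex_one, smul_smul]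
    norm_num
  · congr 1
    funext i
    rw [← hD]
    rfl

theorem curvature_vert_hor_two (t : Fin 2 → ℝ) (x : Fin 3 → G) (a : Fin 2)
    (u : TangentSpace (powModel E 3) x) :
    curvatureAlg ρ 2 (t, x) ![((Pi.single a 1, 0) : TangentSpace (totalModel E 2) (t, x)),
      ((0, u) : TangentSpace (totalModel E 2) (t, x))]
      = lmc (powModel E 3) ρ (fun y => y a.succ) x u - lmc (powModel E 3) ρ (fun y => y 0) x u := by
  refine (curvature_vert_hor hρ t x _ u).trans ?_
  rw [Fin.sum_univ_succ]
  simp only [baryL_zero, baryL_succ]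
  fin_cases a <;> simp [sub_eq_neg_add]

theorem shulman_two (h : 2 + 2 = 4) (x : Fin 3 → G)
    (u : Fin 2 → TangentSpace (powModel E 3) x) :
    shulman (E := E) ρ pontryagin₁ 2 2 h x u
      = pullback (powModel E 3) (powModel E 2) proj
        (pontryaginCochain (ContinuousLinearMap.id ℝ 𝕜) ρ 2 2) x u := by
  obtain ⟨X, hX⟩ : ∃ X : Fin 3 → Fin 2 → MatAlg 𝕜 m, ∀ j i,
    lmc (powModel E 3) ρ (fun y => y j) x (u i) = X j i := ⟨_, fun _ _ => rfl⟩
  have hv : ∀ (t : Fin 2 → ℝ) (a i : Fin 2),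
      curvatureAlg ρ 2 (t, x) ![((Pi.single a 1, 0) : TangentSpace (totalModel E 2) (t, x)),
        ((0, u i) : TangentSpace (totalModel E 2) (t, x))] = X a.succ i - X 0 i := fun t a i =>
    (curvature_vert_hor_two hρ t x a (u i)).trans (by rw [hX, hX])
  -- The splitting that pairs the two vertical vectors drops out. The other two give an integrand
  -- independent of t, and its factor 2 cancels against the area 1/2.
  have hw : ∀ t : Fin 2 → ℝ, wedge pontryagin₁ (curvature ρ 2 (t, x)) (curvature ρ 2 (t, x))
      (fun i : Fin 4 => (Fin.append (α := (Fin 2 → ℝ) × (Fin 3 → E))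
        (fun a => (Pi.single a 1, 0)) (fun b => (0, u b)) (Fin.cast h.symm i)))
      = (2 : ℝ) • (chernPairing 𝕜 m (ContinuousLinearMap.id ℝ 𝕜) (X 1 0 - X 0 0) (X 2 1 - X 0 1)
        - chernPairing 𝕜 m (ContinuousLinearMap.id ℝ 𝕜) (X 1 1 - X 0 1) (X 2 0 - X 0 0)) :=
      fun t => by
    refine (wedge_curvature hρ (t, x) _ (curvature_vert_vert hρ t x _ _) rfl (hv t 0 0) (hv t 1 1)
      (hv t 0 1) (hv t 1 0)).trans ?_
    rw [map_zero, zero_apply]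
    simp only [show Fin.succ (0 : Fin 2) = 1 from rfl, show Fin.succ (1 : Fin 2) = 2 from rfl]
    module
  have hc := fun A B => chernPairing_conj (ContinuousLinearMap.id ℝ 𝕜) (toMat_inv_mul ρ (x 1))
    (toMat_mul_inv ρ (x 1)) A B
  rw [pullback_pontryaginCochain_two_two _ hρ contMDiff_proj]
  simp only [lmc_proj hρ, rmc_proj hρ, show Fin.succ (0 : Fin 2) = 1 from rfl,
    show Fin.succ (1 : Fin 2) = 2 from rfl, show Fin.castSucc (0 : Fin 2) = 0 from rfl,
    show Fin.castSucc (1 : Fin 2) = 1 from rfl, hX, hc]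
  have hcc : ∀ A, toMat ρ (x 1)⁻¹ * (toMat ρ (x 1) * A * toMat ρ (x 1)⁻¹) * toMat ρ (x 1) = A :=
    fun A => by
      simp only [← mul_assoc, toMat_inv_mul, one_mul]
      rw [mul_assoc, toMat_inv_mul, mul_one]
  simp only [hcc]
  unfold shulman
  simp only [hw]
  rw [MeasureTheory.setIntegral_const, volume_simplex_two, smul_smul]
  -- The fibre integral involves ω₂ - ω₀ while γ produces ω₂ - ω₁. Their difference ω₁ - ω₀
  -- contributes nothing, because the symmetric pairing of a 1-form with itself alternates to zero.
  have hs := chernPairing_symm (ContinuousLinearMap.id ℝ 𝕜) (X 1 0 - X 0 0) (X 1 1 - X 0 1)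
  have e : ∀ i, X 2 i - X 1 i = (X 2 i - X 0 i) - (X 1 i - X 0 i) := fun i => by abel
  rw [e, e]
  generalize X 1 0 - X 0 0 = A at hs ⊢
  generalize X 1 1 - X 0 1 = B at hs ⊢
  rw [(chernPairing 𝕜 m (ContinuousLinearMap.id ℝ 𝕜) A).map_sub _ B,
    (chernPairing 𝕜 m (ContinuousLinearMap.id ℝ 𝕜) B).map_sub _ A, hs]
  norm_num

/-- With three vertical vectors among four, each splitting into pairs contains a purely vertical
pair. -/
theorem shulman_three (h : 3 + 1 = 4) (x : Fin 4 → G)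
    (u : Fin 1 → TangentSpace (powModel E 4) x) :
    shulman (E := E) ρ pontryagin₁ 3 1 h x u = 0 := by
  have hw : ∀ t : Fin 3 → ℝ, wedge pontryagin₁ (curvature ρ 3 (t, x)) (curvature ρ 3 (t, x))
    (fun i : Fin 4 =>
      (Fin.append (α := (Fin 3 → ℝ) × (Fin 4 → E))
        (fun a => (Pi.single a 1, 0)) (fun b => (0, u b)) (Fin.cast h.symm i))) = 0 := fun t => by
    refine (wedge_curvature hρ (t, x) _ (curvature_vert_vert hρ t x _ _) rfl
      (curvature_vert_vert hρ t x _ _) rfl rfl (curvature_vert_vert hρ t x _ _)).trans ?_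
    simp
  unfold shulman
  simp only [hw, MeasureTheory.integral_zero]

theorem shulman_four (h : 4 + 0 = 4) (x : Fin 5 → G)
    (u : Fin 0 → TangentSpace (powModel E 5) x) :
    shulman (E := E) ρ pontryagin₁ 4 0 h x u = 0 := by
  have hw : ∀ t : Fin 4 → ℝ, wedge pontryagin₁ (curvature ρ 4 (t, x)) (curvature ρ 4 (t, x))
    (fun i : Fin 4 =>
      (Fin.append (α := (Fin 4 → ℝ) × (Fin 5 → E))
        (fun a => (Pi.single a 1, 0)) (fun b => (0, u b)) (Fin.cast h.symm i))) = 0 := fun t => by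
    refine (wedge_curvature hρ (t, x) _ (curvature_vert_vert hρ t x _ _) rfl
      (curvature_vert_vert hρ t x _ _) rfl rfl (curvature_vert_vert hρ t x _ _)).trans ?_
    simp
  unfold shulman
  simp only [hw, MeasureTheory.integral_zero]

/-- The forms `χ_n` are the pullbacks of the components of the explicit cocycle. -/
theorem shulman_eq_pullback_proj (n k : ℕ) (h : n + k = 4) (x : Fin (n + 1) → G)
    (u : Fin k → TangentSpace (powModel E (n + 1)) x) :
    shulman (E := E) ρ pontryagin₁ n k h x u
      = pullback (powModel E (n + 1)) (powModel E n) proj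
        (pontryaginCochain (ContinuousLinearMap.id ℝ 𝕜) ρ n k) x u := by
  have hn : n ≤ 4 := by omega
  interval_cases n
  · obtain rfl : k = 4 := by omega
    exact shulman_zero hρ h x u
  · obtain rfl : k = 3 := by omega
    exact shulman_one hρ h x u
  · obtain rfl : k = 2 := by omega
    exact shulman_two hρ h x u
  · obtain rfl : k = 1 := by omega
    exact shulman_three hρ h x u
  · obtain rfl : k = 0 := by omega
    exact shulman_four hρ h x u

end Shulman

/-! ### Identification with the stated trace forms, existence and uniqueness. -/

section Representatives

variable {𝕜 : Type*} [RCLike 𝕜] {m : ℕ}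

/-- The triple wedge is the full signed sum over six words, three in each cyclic class. This factor
3 accounts for 1/24π² in Θ against 1/8π² in the trace functional. -/
theorem trCube_eq {T : Type*} (φ : (Fin 1 → T) → Arr 𝕜 m) (v : Fin 3 → T)
    {A : Fin 3 → Matrix (Fin m) (Fin m) 𝕜} (hA : ∀ i, Matrix.of (φ fun _ => v i) = A i) :
    trCube φ v = 3 * ((A 0 * A 1 * A 2).trace - (A 0 * A 2 * A 1).trace) := by
  have h : ∀ i j, wedge (fun A B : Arr 𝕜 m => Matrix.of A * Matrix.of B) φ φ ![v i, v j]
      = A i * A j - A j * A i := fun i j => by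
    rw [wedge_one_one, ← hA, ← hA]
    rfl
  have hc : ∀ i j k, (A i * A j * A k).trace = (A k * A i * A j).trace := fun i j k =>
    Matrix.trace_mul_cycle _ _ _
  rw [trCube, wedge_one_two, h, h, h, h, h, h]
  simp only [hA, mul_sub, ← mul_assoc, Matrix.trace_smul, Matrix.trace_sub, Matrix.trace_add]
  rw [hc 1 2 0, hc 2 1 0, hc 1 0 2, hc 2 0 1, hc 2 1 0, hc 1 2 0, RCLike.real_smul_eq_coe_mul]
  push_cast
  ring

theorem trMul_eq {T : Type*} (φ ψ : (Fin 1 → T) → Arr 𝕜 m) (v : Fin 2 → T)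
    {A B : Fin 2 → Matrix (Fin m) (Fin m) 𝕜} (hA : ∀ i, Matrix.of (φ fun _ => v i) = A i)
    (hB : ∀ i, Matrix.of (ψ fun _ => v i) = B i) :
    trMul φ ψ v = (A 0 * B 1).trace - (A 1 * B 0).trace := by
  rw [trMul, wedge_one_one, hA, hA, hB, hB]

theorem trTr_eq {T : Type*} (φ ψ : (Fin 1 → T) → Arr 𝕜 m) (v : Fin 2 → T)
    {A B : Fin 2 → Matrix (Fin m) (Fin m) 𝕜} (hA : ∀ i, Matrix.of (φ fun _ => v i) = A i)
    (hB : ∀ i, Matrix.of (ψ fun _ => v i) = B i) :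
    trTr φ ψ v = (A 0).trace * (B 1).trace - (A 1).trace * (B 0).trace := by
  rw [trTr, wedge_one_one, hA, hA, hB, hB]

variable {E : Type*} [NormedAddCommGroup E] [NormedSpace ℝ E]
  {G : Type*} [TopologicalSpace G] [ChartedSpace E G] [Group G] [LieGroup 𝓘(ℝ, E) ∞ G]

theorem facePullback_eq {k : ℕ} (i : Fin 3) (θ : AltField 𝓘(ℝ, E) G k (Arr 𝕜 m)) :
    facePullback i θ
      = pullback (powModel E 2) 𝓘(ℝ, E) (fun x : Fin 2 → G => face i x (0 : Fin 1)) θ :=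
  pullback_pullback ((contMDiff_pow_apply (0 : Fin 1)).mdifferentiable (by simp))
    ((contMDiff_face i).mdifferentiable (by simp)) θ

variable {ρ : G →* GL (Fin m) 𝕜} (hρ : IsLieSubgroup E ρ)
include hρ

theorem of_facePullback_leftMC (x : Fin 2 → G) (v : Fin 1 → TangentSpace (powModel E 2) x) :
    ofArr 𝕜 m (facePullback 0 (leftMC E ρ) x v) = lmc (powModel E 2) ρ (fun y => y 1) x (v 0) := by
  rw [facePullback_eq]
  exact of_pullback_leftMC hρ (contMDiff_pow_apply (1 : Fin 2)) x v

theorem of_facePullback_rightMC (x : Fin 2 → G) (v : Fin 1 → TangentSpace (powModel E 2) x) :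
    ofArr 𝕜 m (facePullback 2 (rightMC E ρ) x v) = rmc (powModel E 2) ρ (fun y => y 0) x (v 0) := by
  rw [facePullback_eq]
  exact of_pullback_rightMC hρ (contMDiff_pow_apply (0 : Fin 2)) x v

theorem pontryaginCochain_one_three_eq (x : Fin 1 → G)
    (v : Fin 3 → TangentSpace (powModel E 1) x) :
    pontryaginCochain (ContinuousLinearMap.id ℝ 𝕜) ρ 1 3 x v
      = ((1 / (24 * Real.pi ^ 2) : ℝ) : 𝕜) * trCube (onBG1 (leftMC E ρ) x) v := by
  have h := trCube_eq (onBG1 (leftMC E ρ) x) v fun i =>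
    of_pullback_leftMC hρ (contMDiff_pow_apply (0 : Fin 1)) x fun _ => v i
  rw [h, pontryaginCochain_one_three _ hρ, cubeForm_apply (chernTrace_mul_comm _),
    chernTrace_apply, chernTrace_apply, ← smul_sub, RCLike.real_smul_eq_coe_mul, ← mul_assoc]
  congr 1
  push_cast
  have : (Real.pi : 𝕜) ≠ 0 := by exact_mod_cast Real.pi_ne_zero
  field_simp
  norm_num

theorem pontryaginCochain_two_two_eq (x : Fin 2 → G)
    (v : Fin 2 → TangentSpace (powModel E 2) x) :
    pontryaginCochain (ContinuousLinearMap.id ℝ 𝕜) ρ 2 2 x v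
      = ((1 / (8 * Real.pi ^ 2) : ℝ) : 𝕜) *
        (trMul (facePullback 2 (rightMC E ρ) x) (facePullback 0 (leftMC E ρ) x) v
          - trTr (facePullback 2 (rightMC E ρ) x) (facePullback 0 (leftMC E ρ) x) v) := by
  have hA := fun i => of_facePullback_rightMC hρ x fun _ => v i
  have hB := fun i => of_facePullback_leftMC hρ x fun _ => v i
  rw [trMul_eq _ _ v hA hB, trTr_eq _ _ v hA hB, pontryaginCochain_two_two _ hρ,
    chernPairing_apply, chernPairing_apply]
  simp only [RCLike.real_smul_eq_coe_mul, ContinuousLinearMap.id_apply]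
  rw [← mul_sub, ← mul_sub, ← mul_sub, sub_sub_sub_comm]
  rfl

theorem pontryaginCochain_two_two_eq' (x : Fin 2 → G)
    (v : Fin 2 → TangentSpace (powModel E 2) x) :
    pontryaginCochain (ContinuousLinearMap.id ℝ 𝕜) ρ 2 2 x v
      = ((1 / (8 * Real.pi ^ 2) : ℝ) : 𝕜) *
        (trTr (facePullback 2 (leftMCInv E ρ) x) (facePullback 0 (leftMC E ρ) x) v
          - trMul (facePullback 2 (leftMCInv E ρ) x) (facePullback 0 (leftMC E ρ) x) v) := by
  have hA := fun i => of_facePullback_rightMC hρ x fun _ => v i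
  have hA' : ∀ i, Matrix.of (facePullback 2 (leftMCInv E ρ) x fun _ => v i)
      = -Matrix.of (facePullback 2 (rightMC E ρ) x fun _ => v i) := fun i => by
    rw [leftMCInv_eq hρ]
    rfl
  rw [pontryaginCochain_two_two_eq hρ, trMul_eq _ _ v (fun _ => rfl) (fun _ => rfl),
    trTr_eq _ _ v (fun _ => rfl) (fun _ => rfl), trMul_eq _ _ v hA' (fun _ => rfl),
    trTr_eq _ _ v hA' (fun _ => rfl)]
  simp only [Matrix.trace_neg, neg_mul]
  congr 1
  ring

variable {F : Type*} [NormedAddCommGroup F] [NormedSpace ℝ F] [FiniteDimensional ℝ F]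
  [FiniteDimensional ℝ E]

/-- One argument serves both coefficient fields: `π` is the identity for 𝕜 and the real part for ℝ,
and `hπ` says that nothing is lost. Injectivity of `ι` and of γ^* forces any admissible cocycle to
be the explicit one. -/
theorem firstPontryaginClassIs {ι : F →L[ℝ] 𝕜} (hι : Function.Injective ι) {π : 𝕜 →L[ℝ] F}
    (hπ : ∀ p q x v, ι (pontryaginCochain (E := E) π ρ p q x v)
      = pontryaginCochain (ContinuousLinearMap.id ℝ 𝕜) ρ p q x v)
    {Θ : (x : Fin 1 → G) → (Fin 3 → TangentSpace (powModel E 1) x) → 𝕜}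
    {Ξ : (x : Fin 2 → G) → (Fin 2 → TangentSpace (powModel E 2) x) → 𝕜}
    (hΘ : ∀ x v, pontryaginCochain (ContinuousLinearMap.id ℝ 𝕜) ρ 1 3 x v = Θ x v)
    (hΞ : ∀ x v, pontryaginCochain (ContinuousLinearMap.id ℝ 𝕜) ρ 2 2 x v = Ξ x v) :
    FirstPontryaginClassIs ι ρ Θ Ξ := by
  have hz : ∀ (n k : ℕ) (h : n + k = 4) (x : Fin (n + 1) → G)
      (u : Fin k → TangentSpace (powModel E (n + 1)) x),
      ι (pullback (powModel E (n + 1)) (powModel E n) proj (pontryaginCochain π ρ n k) x u)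
        = shulman ρ pontryagin₁ n k h x u := fun n k h x u =>
    (hπ n k (proj x) _).trans (shulman_eq_pullback_proj hρ n k h x u).symm
  refine ⟨⟨pontryaginCochain π ρ, pontryaginCochain_mem_cocycles π hρ⟩,
    fun x v => (hπ 1 3 x v).trans (hΘ x v), fun x v => (hπ 2 2 x v).trans (hΞ x v),
    fun p q => pontryaginCochain_eq_zero π ρ, fun c => ⟨?_, ?_⟩⟩
  · rintro ⟨z, rfl, hz'⟩
    congr 1
    refine Subtype.ext (funext fun p => funext fun q => ?_)
    by_cases h : p + q = 4
    · refine pullback_proj_injective (funext fun x => ContinuousAlternatingMap.ext fun u => hι ?_)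
      exact (hz' p q h x u).trans (hz p q h x u).symm
    -- Outside total degree 4 the condition on γ^* says nothing, but both components are zero by
    -- membership in the total complex.
    · obtain ⟨a, -, ha⟩ := z.2
      rw [← ha]
      exact (a.2.2.2 p q h).trans ((pontryaginCochain_mem_tot π hρ).2.2 p q h).symm
  · rintro rfl
    exact ⟨_, rfl, hz⟩

end Representatives

/-! ### Constraints on the Lie algebra: skewness, reality, tracelessness. -/

section Tangent

variable {𝕜 : Type*} [RCLike 𝕜] {m : ℕ}
  {E : Type*} [NormedAddCommGroup E] [NormedSpace ℝ E]
  {G : Type*} [TopologicalSpace G] [ChartedSpace E G] [Group G] [LieGroup 𝓘(ℝ, E) ∞ G]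
  {ρ : G →* GL (Fin m) 𝕜} (hρ : IsLieSubgroup E ρ)
  {F : Type*} [NormedAddCommGroup F] [NormedSpace ℝ F]

variable (𝕜 m) in
/-- The conjugate transpose, as a real linear map on the algebra of matrices. -/
def starL : MatAlg 𝕜 m →L[ℝ] MatAlg 𝕜 m :=
  LinearMap.toContinuousLinearMap
    (Matrix.conjTransposeLinearEquiv (Fin m) (Fin m) ℝ 𝕜).toLinearMap

variable (𝕜 m) in
/-- The transpose, as a real linear map on the algebra of matrices. -/
def transposeL : MatAlg 𝕜 m →L[ℝ] MatAlg 𝕜 m :=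
  LinearMap.toContinuousLinearMap (Matrix.transposeLinearEquiv (Fin m) (Fin m) ℝ 𝕜).toLinearMap

theorem starL_mul (A B : MatAlg 𝕜 m) : starL 𝕜 m (A * B) = starL 𝕜 m B * starL 𝕜 m A :=
  Matrix.conjTranspose_mul (A : Matrix (Fin m) (Fin m) 𝕜) B

theorem trL_starL (A : MatAlg 𝕜 m) : trL 𝕜 m (starL 𝕜 m A) = star (trL 𝕜 m A) :=
  Matrix.trace_conjTranspose (A : Matrix (Fin m) (Fin m) 𝕜)

theorem trL_transposeL (A : MatAlg 𝕜 m) : trL 𝕜 m (transposeL 𝕜 m A) = trL 𝕜 m A :=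
  Matrix.trace_transpose (A : Matrix (Fin m) (Fin m) 𝕜)

variable (E) in
/-- The Lie algebra of `G`, as a set of matrices. -/
def lieSet (ρ : G →* GL (Fin m) 𝕜) : Set (MatAlg 𝕜 m) :=
  Set.range fun w : E => ofArr 𝕜 m (lieToArr (E := E) ρ w)

/-- The determinant, as a function on the normed algebra of matrices. -/
def detAlg (A : MatAlg 𝕜 m) : 𝕜 := Matrix.det (A : Matrix (Fin m) (Fin m) 𝕜)

theorem differentiable_detAlg : Differentiable ℝ (detAlg (𝕜 := 𝕜) (m := m)) := by
  have h : detAlg (𝕜 := 𝕜) (m := m) = fun A => ∑ σ : Equiv.Perm (Fin m),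
      Equiv.Perm.sign σ • ∏ i, toArrL 𝕜 m A (σ i) i := funext fun A => Matrix.det_apply _
  have hc : ContDiff ℝ 1 (detAlg (𝕜 := 𝕜) (m := m)) := by
    rw [h]
    refine ContDiff.sum fun σ _ => ContDiff.const_smul _ (contDiff_prod fun i _ => ?_)
    exact (((ContinuousLinearMap.proj i : (Fin m → 𝕜) →L[ℝ] 𝕜) ∘L
      (ContinuousLinearMap.proj (σ i) : Arr 𝕜 m →L[ℝ] _)) ∘L toArrL 𝕜 m).contDiff
  exact hc.differentiable one_ne_zero

/-- Jacobi's formula at the identity. Differentiability is known because det is polynomial, so the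
derivative can be read off along lines from det(1 + tA) = 1 + t tr A + O(t²). -/
theorem hasFDerivAt_detAlg_one : HasFDerivAt (detAlg (𝕜 := 𝕜) (m := m)) (trL 𝕜 m) 1 := by
  have hd := differentiable_detAlg (𝕜 := 𝕜) (m := m) 1
  convert! hd.hasFDerivAt using 1
  refine ContinuousLinearMap.ext fun A => ?_
  obtain ⟨P, hP⟩ : ∃ P : Polynomial 𝕜, ∀ t : ℝ, detAlg (1 + t • A)
      = 1 + trL 𝕜 m A * (t : 𝕜) + P.eval (t : 𝕜) * (t : 𝕜) ^ 2 := by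
    refine ⟨_, fun t => Eq.trans ?_
      (Matrix.det_one_add_smul (t : 𝕜) (A : Matrix (Fin m) (Fin m) 𝕜))⟩
    exact congrArg (fun B : MatAlg 𝕜 m => detAlg (1 + B))
      (Matrix.ext fun i j => RCLike.real_smul_eq_coe_mul _ _)
  have h1 : HasDerivAt (fun r : 𝕜 => 1 + trL 𝕜 m A * r + P.eval r * r ^ 2) (trL 𝕜 m A)
      (((0 : ℝ)) : 𝕜) := by
    convert! (((hasDerivAt_id ((0 : ℝ) : 𝕜)).const_mul (trL 𝕜 m A)).const_add 1).add
      ((P.hasDerivAt ((0 : ℝ) : 𝕜)).mul (hasDerivAt_pow 2 ((0 : ℝ) : 𝕜))) using 1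
    simp
  have h2 : HasDerivAt (fun t : ℝ => (1 : MatAlg 𝕜 m) + t • A) A 0 := by
    simpa using ((hasDerivAt_id (0 : ℝ)).smul_const A).const_add 1
  have h3 := HasDerivAt.scomp (0 : ℝ) (h := fun t : ℝ => (t : 𝕜)) h1
    (RCLike.ofRealCLM (K := 𝕜)).hasDerivAt
  have h4 := HasFDerivAt.comp_hasDerivAt (0 : ℝ) (f := fun t : ℝ => (1 : MatAlg 𝕜 m) + t • A)
    (by simpa using hd.hasFDerivAt) h2
  refine Eq.trans ?_ (h3.unique ?_)
  · simp
  · convert! h4 using 1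
    funext t
    exact (hP t).symm

include hρ

/-- A linear map that inverts the elements of `G` is `-1` on the Lie algebra. -/
theorem map_eq_neg_of_mem_lieSet {L : MatAlg 𝕜 m →L[ℝ] MatAlg 𝕜 m}
    (hL : ∀ g, L (toMat ρ g) = toMat ρ g⁻¹) {A : MatAlg 𝕜 m} (hA : A ∈ lieSet E ρ) :
    L A = -A := by
  obtain ⟨w, rfl⟩ := hA
  have h1 := matD_inv hρ (contMDiff_id (I := 𝓘(ℝ, E)) (M := G)) 1 w
  have h2 := clm_mfderiv (contMDiff_toMat hρ) L 1 w
  have h3 : ∀ A : MatAlg 𝕜 m, toMat ρ (1 : G)⁻¹ * A * toMat ρ (1 : G)⁻¹ = A := fun A => by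
    rw [inv_one, toMat_one, one_mul, mul_one]
  have h4 : (fun g => L (toMat ρ g)) = fun g => toMat ρ g⁻¹ := funext hL
  rw [h4] at h2
  have h5 := of_lieToArr hρ w
  refine (congrArg L h5).trans (Eq.trans ?_ (congrArg Neg.neg h5).symm)
  exact h2.trans (h1.trans (congrArg Neg.neg (h3 _)))

section Pullback

variable {E₁ : Type*} [NormedAddCommGroup E₁] [NormedSpace ℝ E₁]
  {H₁ : Type*} [TopologicalSpace H₁] {I : ModelWithCorners ℝ E₁ H₁}
  {M : Type*} [TopologicalSpace M] [ChartedSpace H₁ M]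

theorem lmc_mem_lieSet {h : M → G} (hh : ContMDiff I 𝓘(ℝ, E) ∞ h) (x : M) (v : TangentSpace I x) :
    lmc I ρ h x v ∈ lieSet E ρ :=
  ⟨_, of_pullback_leftMC hρ hh x fun _ => v⟩

theorem rmc_mem_lieSet {h : M → G} (hh : ContMDiff I 𝓘(ℝ, E) ∞ h) (x : M) (v : TangentSpace I x) :
    rmc I ρ h x v ∈ lieSet E ρ :=
  ⟨_, of_pullback_rightMC hρ hh x fun _ => v⟩

end Pullback

theorem pontryaginCochain_eq_comp (π : 𝕜 →L[ℝ] F) (p q : ℕ) (x : Fin p → G)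
    (v : Fin q → TangentSpace (powModel E p) x) :
    pontryaginCochain π ρ p q x v
      = π (pontryaginCochain (ContinuousLinearMap.id ℝ 𝕜) ρ p q x v) := by
  by_cases h₁ : (p, q) = (1, 3)
  · obtain ⟨rfl, rfl⟩ := Prod.mk.inj h₁
    rw [pontryaginCochain_one_three _ hρ, pontryaginCochain_one_three _ hρ,
      cubeForm_apply (chernTrace_mul_comm _), cubeForm_apply (chernTrace_mul_comm _)]
    simp only [chernTrace_apply, map_sub, map_smul, ContinuousLinearMap.id_apply]
  by_cases h₂ : (p, q) = (2, 2)
  · obtain ⟨rfl, rfl⟩ := Prod.mk.inj h₂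
    rw [pontryaginCochain_two_two _ hρ, pontryaginCochain_two_two _ hρ]
    simp only [chernPairing_apply, map_sub, map_smul, ContinuousLinearMap.id_apply]
  rw [pontryaginCochain_eq_zero _ ρ h₁ h₂, pontryaginCochain_eq_zero _ ρ h₁ h₂]
  exact (map_zero π).symm

/-- If `G ⊆ U(m)`, the components of the cocycle are real valued. -/
theorem star_pontryaginCochain (hU : ∀ g, starL 𝕜 m (toMat ρ g) = toMat ρ g⁻¹) (p q : ℕ)
    (x : Fin p → G) (v : Fin q → TangentSpace (powModel E p) x) :
    star (pontryaginCochain (ContinuousLinearMap.id ℝ 𝕜) ρ p q x v)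
      = pontryaginCochain (ContinuousLinearMap.id ℝ 𝕜) ρ p q x v := by
  have hs : ∀ A ∈ lieSet E ρ, starL 𝕜 m A = -A := fun A => map_eq_neg_of_mem_lieSet hρ hU
  have hc : ∀ (r : ℝ) (z : 𝕜), star (r • z) = r • star z := fun r z => by
    rw [star_smul, star_trivial]
  by_cases h₁ : (p, q) = (1, 3)
  · obtain ⟨rfl, rfl⟩ := Prod.mk.inj h₁
    have hX := fun i => hs _ (lmc_mem_lieSet hρ (contMDiff_pow_apply (0 : Fin 1)) x (v i))
    rw [pontryaginCochain_one_three _ hρ, cubeForm_apply (chernTrace_mul_comm _)]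
    simp only [chernTrace_apply, ContinuousLinearMap.id_apply, star_sub, hc, ← trL_starL,
      starL_mul, hX]
    -- The adjoint reverses a word of three skew letters with sign -1. Reversal exchanges the two
    -- cyclic classes, which enter the cubic form with opposite signs.
    have ht : ∀ A B C : MatAlg 𝕜 m, trL 𝕜 m (C * (B * A)) = trL 𝕜 m (A * C * B) := fun A B C => by
      rw [← mul_assoc, trL_mul_comm, ← mul_assoc]
    simp only [neg_mul, mul_neg, map_neg, neg_neg, smul_neg, ht]
    abel
  by_cases h₂ : (p, q) = (2, 2)
  · obtain ⟨rfl, rfl⟩ := Prod.mk.inj h₂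
    have hX := fun i => hs _ (rmc_mem_lieSet hρ (contMDiff_pow_apply (0 : Fin 2)) x (v i))
    have hY := fun i => hs _ (lmc_mem_lieSet hρ (contMDiff_pow_apply (1 : Fin 2)) x (v i))
    rw [pontryaginCochain_two_two _ hρ]
    simp only [chernPairing_apply, ContinuousLinearMap.id_apply, star_sub, hc, star_mul',
      ← trL_starL, starL_mul, hX, hY]
    simp only [neg_mul, mul_neg, map_neg, neg_neg]
    rw [trL_mul_comm, trL_mul_comm (lmc _ _ _ _ (v 0))]
  rw [pontryaginCochain_eq_zero _ ρ h₁ h₂]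
  exact star_zero _

-- The constant function det ∘ ρ has zero derivative at the identity, while Jacobi's formula
-- computes that derivative as the trace.
omit [LieGroup 𝓘(ℝ, E) ∞ G] in
theorem trL_eq_zero_of_det {A : MatAlg 𝕜 m} (hA : A ∈ lieSet E ρ)
    (h : ∀ g, (ρ g).val.det = 1) : trL 𝕜 m A = 0 := by
  obtain ⟨w, rfl⟩ := hA
  have h1 := hasMFDerivAt_toMat_comp hρ (contMDiff_id (I := 𝓘(ℝ, E)) (M := G)) 1
  have h2 : HasFDerivAt detAlg (trL 𝕜 m) (toMat ρ (1 : G)) := by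
    rw [toMat_one]
    exact hasFDerivAt_detAlg_one
  have h3 := HasMFDerivAt.comp (1 : G) h2.hasMFDerivAt h1
  have h4 := hasMFDerivAt_const (I := 𝓘(ℝ, E)) (I' := 𝓘(ℝ, 𝕜)) (1 : 𝕜) (1 : G)
  have h5 := hasMFDerivAt_unique h3 (h4.congr_of_eventuallyEq (.of_forall h))
  exact (congrArg (trL 𝕜 m) (of_lieToArr hρ w)).trans (DFunLike.congr_fun h5 w)

theorem trTr_eq_zero (h : ∀ A ∈ lieSet E ρ, trL 𝕜 m A = 0) (x : Fin 2 → G)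
    (v : Fin 2 → TangentSpace (powModel E 2) x) :
    trTr (facePullback 2 (rightMC E ρ) x) (facePullback 0 (leftMC E ρ) x) v = 0 := by
  have hA := fun i => of_facePullback_rightMC hρ x fun _ => v i
  have hB := fun i => of_facePullback_leftMC hρ x fun _ => v i
  have h0 : ∀ i, Matrix.trace (rmc (powModel E 2) ρ (fun y => y 0) x (v i)) = 0 := fun i =>
    h _ (rmc_mem_lieSet hρ (contMDiff_pow_apply (0 : Fin 2)) x (v i))
  rw [trTr_eq _ _ v hA hB, h0, h0, zero_mul, zero_mul, sub_zero]

end Tangent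

/-! ### Orthogonal, unitary and special unitary groups. -/

section Subgroups

variable {𝕜 : Type*} [RCLike 𝕜] {m : ℕ} {G : Type*} [Group G] {ρ : G →* GL (Fin m) 𝕜}

theorem toMat_inv_eq {g : G} {A : MatAlg 𝕜 m} (h : A * toMat ρ g = 1) : A = toMat ρ g⁻¹ :=
  left_inv_eq_right_inv h (toMat_mul_inv ρ g)

theorem starL_toMat {g : G} (h : (ρ g).val ∈ Matrix.unitaryGroup (Fin m) 𝕜) :
    starL 𝕜 m (toMat ρ g) = toMat ρ g⁻¹ :=
  toMat_inv_eq (Matrix.mem_unitaryGroup_iff'.1 h)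

theorem star_map_algebraMap (B : Matrix (Fin m) (Fin m) ℝ) :
    star (B.map (algebraMap ℝ 𝕜)) = B.transpose.map (algebraMap ℝ 𝕜) := by
  ext i j
  simp [Matrix.star_apply]

theorem map_mem_unitaryGroup {B : Matrix (Fin m) (Fin m) ℝ}
    (hB : B ∈ Matrix.orthogonalGroup (Fin m) ℝ) :
    B.map (algebraMap ℝ 𝕜) ∈ Matrix.unitaryGroup (Fin m) 𝕜 := by
  rw [Matrix.mem_unitaryGroup_iff', star_map_algebraMap, ← Matrix.map_mul,
    (Matrix.mem_orthogonalGroup_iff' _ _).1 hB]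
  simp

/-- For a matrix with real entries the transpose is the adjoint. Unlike the adjoint, the transpose
preserves the trace exactly, which is what forces the trace to vanish also when 𝕜 = ℂ. -/
theorem transposeL_toMat {g : G} {B : Matrix (Fin m) (Fin m) ℝ}
    (hB : B ∈ Matrix.orthogonalGroup (Fin m) ℝ) (h : (ρ g).val = B.map (algebraMap ℝ 𝕜)) :
    transposeL 𝕜 m (toMat ρ g) = toMat ρ g⁻¹ := by
  refine Eq.trans ?_ (starL_toMat (h ▸ map_mem_unitaryGroup hB))
  have : (ρ g).val.transpose = star (ρ g).val := by
    rw [h, star_map_algebraMap, Matrix.transpose_map]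
  exact this

variable {E : Type*} [NormedAddCommGroup E] [NormedSpace ℝ E]
  [TopologicalSpace G] [ChartedSpace E G] [LieGroup 𝓘(ℝ, E) ∞ G] (hρ : IsLieSubgroup E ρ)
include hρ

/-- The traces of the elements of the Lie algebra vanish if `G ⊆ O(m)` or `G ⊆ SU(m)`. -/
theorem trL_eq_zero_of_mem_lieSet
    (h : (∀ g, ∃ B ∈ Matrix.orthogonalGroup (Fin m) ℝ, (ρ g).val = B.map (algebraMap ℝ 𝕜)) ∨
      ∀ g, (ρ g).val ∈ Matrix.specialUnitaryGroup (Fin m) 𝕜)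
    {A : MatAlg 𝕜 m} (hA : A ∈ lieSet E ρ) : trL 𝕜 m A = 0 := by
  rcases h with h | h
  -- A matrix with Aᵀ = -A satisfies tr A = -tr A.
  · have h1 := map_eq_neg_of_mem_lieSet hρ (L := transposeL 𝕜 m)
      (fun g => by obtain ⟨B, hB, hg⟩ := h g; exact transposeL_toMat hB hg) hA
    have h2 := trL_transposeL A
    rw [h1, map_neg] at h2
    exact self_eq_neg.1 h2.symm
  · exact trL_eq_zero_of_det hρ hA fun g => (Matrix.mem_specialUnitaryGroup_iff.1 (h g)).2

theorem ofRealCLM_pontryaginCochain (hU : ∀ g, (ρ g).val ∈ Matrix.unitaryGroup (Fin m) 𝕜)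
    (p q : ℕ) (x : Fin p → G) (v : Fin q → TangentSpace (powModel E p) x) :
    (RCLike.ofRealCLM : ℝ →L[ℝ] 𝕜) (pontryaginCochain RCLike.reCLM ρ p q x v)
      = pontryaginCochain (ContinuousLinearMap.id ℝ 𝕜) ρ p q x v := by
  rw [pontryaginCochain_eq_comp hρ]
  exact RCLike.conj_eq_iff_re.1
    (star_pontryaginCochain hρ (fun g => starL_toMat (hU g)) p q x v)

end Subgroups

end BGForms

end

theorem mainTheorem3 {𝕜 : Type*} [RCLike 𝕜] {m : ℕ}
    {E : Type*} [NormedAddCommGroup E] [NormedSpace ℝ E] [FiniteDimensional ℝ E]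
    {G : Type*} [TopologicalSpace G] [ChartedSpace E G] [Group G] [LieGroup 𝓘(ℝ, E) ∞ G]
    (ρ : G →* GL (Fin m) 𝕜) (hρ : BGForms.IsLieSubgroup E ρ) :
    -- arbitrary matrix Lie groups
    BGForms.FirstPontryaginClassIs (E := E) (ContinuousLinearMap.id ℝ 𝕜) ρ
      (fun x v => ((1 / (24 * Real.pi ^ 2) : ℝ) : 𝕜) *
        BGForms.trCube (BGForms.onBG1 (BGForms.leftMC E ρ) x) v)
      (fun x v => ((1 / (8 * Real.pi ^ 2) : ℝ) : 𝕜) *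
        (BGForms.trTr (BGForms.facePullback 2 (BGForms.leftMCInv E ρ) x)
            (BGForms.facePullback 0 (BGForms.leftMC E ρ) x) v
          - BGForms.trMul (BGForms.facePullback 2 (BGForms.leftMCInv E ρ) x)
            (BGForms.facePullback 0 (BGForms.leftMC E ρ) x) v)) ∧
    -- subgroups of `U(m)`
    ((∀ g, (ρ g).val ∈ Matrix.unitaryGroup (Fin m) 𝕜) →
      BGForms.leftMCInv E ρ = -BGForms.rightMC E ρ ∧
      BGForms.FirstPontryaginClassIs (E := E) (ContinuousLinearMap.id ℝ 𝕜) ρ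
        (fun x v => ((1 / (24 * Real.pi ^ 2) : ℝ) : 𝕜) *
          BGForms.trCube (BGForms.onBG1 (BGForms.leftMC E ρ) x) v)
        (fun x v => ((1 / (8 * Real.pi ^ 2) : ℝ) : 𝕜) *
          (BGForms.trMul (BGForms.facePullback 2 (BGForms.rightMC E ρ) x)
              (BGForms.facePullback 0 (BGForms.leftMC E ρ) x) v
            - BGForms.trTr (BGForms.facePullback 2 (BGForms.rightMC E ρ) x)
              (BGForms.facePullback 0 (BGForms.leftMC E ρ) x) v)) ∧
      BGForms.FirstPontryaginClassIs (E := E) (RCLike.ofRealCLM : ℝ →L[ℝ] 𝕜) ρ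
        (fun x v => ((1 / (24 * Real.pi ^ 2) : ℝ) : 𝕜) *
          BGForms.trCube (BGForms.onBG1 (BGForms.leftMC E ρ) x) v)
        (fun x v => ((1 / (8 * Real.pi ^ 2) : ℝ) : 𝕜) *
          (BGForms.trMul (BGForms.facePullback 2 (BGForms.rightMC E ρ) x)
              (BGForms.facePullback 0 (BGForms.leftMC E ρ) x) v
            - BGForms.trTr (BGForms.facePullback 2 (BGForms.rightMC E ρ) x)
              (BGForms.facePullback 0 (BGForms.leftMC E ρ) x) v))) ∧
    -- subgroups of `O(m)` or of `SU(m)`, such as `O(m)`, `SO(m)`, `SU(m)`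
    (((∀ g, ∃ B ∈ Matrix.orthogonalGroup (Fin m) ℝ,
          (ρ g).val = B.map (algebraMap ℝ 𝕜)) ∨
        (∀ g, (ρ g).val ∈ Matrix.specialUnitaryGroup (Fin m) 𝕜)) →
      (∀ x v, BGForms.trTr (BGForms.facePullback 2 (BGForms.rightMC E ρ) x)
        (BGForms.facePullback 0 (BGForms.leftMC E ρ) x) v = 0) ∧
      BGForms.FirstPontryaginClassIs (E := E) (ContinuousLinearMap.id ℝ 𝕜) ρ
        (fun x v => ((1 / (24 * Real.pi ^ 2) : ℝ) : 𝕜) *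
          BGForms.trCube (BGForms.onBG1 (BGForms.leftMC E ρ) x) v)
        (fun x v => ((1 / (8 * Real.pi ^ 2) : ℝ) : 𝕜) *
          BGForms.trMul (BGForms.facePullback 2 (BGForms.rightMC E ρ) x)
            (BGForms.facePullback 0 (BGForms.leftMC E ρ) x) v) ∧
      BGForms.FirstPontryaginClassIs (E := E) (RCLike.ofRealCLM : ℝ →L[ℝ] 𝕜) ρ
        (fun x v => ((1 / (24 * Real.pi ^ 2) : ℝ) : 𝕜) *
          BGForms.trCube (BGForms.onBG1 (BGForms.leftMC E ρ) x) v)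
        (fun x v => ((1 / (8 * Real.pi ^ 2) : ℝ) : 𝕜) *
          BGForms.trMul (BGForms.facePullback 2 (BGForms.rightMC E ρ) x)
            (BGForms.facePullback 0 (BGForms.leftMC E ρ) x) v)) := by
  have hid : Function.Injective (ContinuousLinearMap.id ℝ 𝕜) := Function.injective_id
  have hof : Function.Injective (RCLike.ofRealCLM : ℝ →L[ℝ] 𝕜) := RCLike.ofReal_injective
  have hΘ := BGForms.pontryaginCochain_one_three_eq hρ
  have hΞ := BGForms.pontryaginCochain_two_two_eq hρ
  refine ⟨BGForms.firstPontryaginClassIs hρ hid (fun _ _ _ _ => rfl) hΘ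
    (BGForms.pontryaginCochain_two_two_eq' hρ), fun hU => ⟨BGForms.leftMCInv_eq hρ,
    BGForms.firstPontryaginClassIs hρ hid (fun _ _ _ _ => rfl) hΘ hΞ,
    BGForms.firstPontryaginClassIs hρ hof (BGForms.ofRealCLM_pontryaginCochain hρ hU) hΘ hΞ⟩,
    fun h => ?_⟩
  -- Both alternatives lie in the unitary group, so reality of the forms is available; only the
  -- vanishing of the product of traces is new.
  have hU : ∀ g, (ρ g).val ∈ Matrix.unitaryGroup (Fin m) 𝕜 := by
    rcases h with h | h
    · intro g
      obtain ⟨B, hB, hg⟩ := h g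
      exact hg ▸ BGForms.map_mem_unitaryGroup hB
    · exact fun g => (Matrix.mem_specialUnitaryGroup_iff.1 (h g)).1
  have h0 := BGForms.trTr_eq_zero hρ fun _ => BGForms.trL_eq_zero_of_mem_lieSet hρ h
  simp only [h0, sub_zero] at hΞ
  exact ⟨h0, BGForms.firstPontryaginClassIs hρ hid (fun _ _ _ _ => rfl) hΘ hΞ,
    BGForms.firstPontryaginClassIs hρ hof (BGForms.ofRealCLM_pontryaginCochain hρ hU) hΘ hΞ⟩
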